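/- **Setting.** Let $d,m,s\ge 1$ be integers, $X=\{-m,\dots,m\}^d$, $X_\star=\{-2m,\dots,2m\}^d$. On $\mathbb T^d=(\mathbb R/\mathbb Z)^d$ use the metric $|\omega-\omega'|=\min_{n\in\mathbb Z^d}|\omega-\omega'+n|$ (Euclidean norm on the right). For $\theta_1,\dots,\theta_s\in\mathbb T^d$ and $a\in\mathbb C^s$ with $\min_\ell|a_\ell|=1$ put $|a|_\infty=\max_\ell|a_\ell|$ and $y(x)=\sum_{\ell=1}^s a_\ell e^{2\pi i\theta_\ell\cdot x}$. Given noisy samples $\tilde y=y+\eta$ on $X_\star$, let $H(\tilde y)=(\tilde y(x+x'))_{x,x'\in X}$, with singular values $\sigma_1\ge\sigma_2\ge\cdots$ (zero beyond the size of the matrix). We say that $\tilde U$ is *well defined* if $\sigma_s(H(\tilde y))>\sigma_{s+1}(H(\tilde y))$; then $\tilde U\subset\ell^2(X)$ is the $s$-dimensional span of the left singular vectors for $\sigma_1,\dots,\sigma_s$. With $\phi_\omega(x)=(2m+1)^{-d/2}e^{2\pi i\omega\cdot x}$, $x\in X$, let $\tilde q(\omega)=\langle\phi_\omega,(I-P_{\tilde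 U})\phi_\omega\rangle_{\ell^2(X)}$. *Gradient-MUSIC* has as parameters a finite nonempty grid $G\subset\mathbb T^d$ with mesh norm $\mathrm{mesh}(G)=\max_{\omega\in\mathbb T^d}\min_{g\in G}|\omega-g|$, a threshold $\alpha$, a linking length $r$, a step size $h$ and a number of iterations $n$. It forms $G_1=\{g\in G:\tilde q(g)\le\alpha\}$, splits $G_1$ into its connected clusters (the connected components of the graph on $G_1$ in which points at distance at most $r$ are adjacent), selects one arbitrary representative of each cluster, and runs $n$ steps $\omega\mapsto\omega-h\nabla\tilde q(\omega)$ from each representative. We say that it *recovers the frequencies with error* $\varepsilon$ if there are exactly $s$ clusters and, for every choice of the representatives, the $s$ output points can be ordered as $\theta_1^\sharp,\dots,\theta_s^\sharp$ so that $\max_\ell|\theta_\ell-\theta_\ell^\sharp|\le\varepsilon$. **Theorem.** There are absolute constants $0<h_1<h_2$ and $c,N>0$ such that for every $d\ge2$ there are constants $\beta,\kappa,c',C>0$, $\rho\ge2\kappa$ and $0<\alpha_-<\alpha_+$, depending only on $d$, with the following property. Let $m,s\ge1$, let $a$ be as above, let $|\theta_j-\theta_k|\ge\beta/m$ for all $j\ne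 k$, and let $$\mathrm{mesh}(G)\le\frac{\kappa}{m},\qquad 2\,\mathrm{mesh}(G)\le r\le\frac{\rho}{m},\qquad \alpha_-\le\alpha\le\alpha_+,\qquad \frac{h_1}{m^2}\le h\le\frac{h_2}{m^2}.$$ (a) *Adversarial noise.* Let $p\in[1,\infty]$ (with $d/\infty=0$) and $$\|\eta\|_{\ell^p(X_\star)}\le c\,\frac{m^{d/p}}{|a|_\infty}.$$ Then $\tilde U$ is well defined. If moreover $\eta$ does not vanish identically on $X_\star$, then for every integer $n\ge0$ with $$n\ge N\log\frac{m^{d/p}}{\|\eta\|_{\ell^p(X_\star)}}$$ Gradient-MUSIC recovers the frequencies with error $C\,\|\eta\|_{\ell^p(X_\star)}/m^{1+d/p}$. (b) *Random noise.* Let $\eta=\sigma g$ with $\sigma\ge0$, where the values of $g$ on $X_\star$ are independent standard complex normal variables (real and imaginary parts independent, centred, of variance $1/2$), and let $$\|\sigma\|_{\ell^2(X_\star)}\sqrt{\log m}\le c'\,\frac{m^d}{|a|_\infty}.$$ Then there is an event of probability at least $1-m^{-d}$ on which $\tilde U$ is well defined and, if $\sigma$ does not vanish identically on $X_\star$, for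 every integer $n\ge0$ with $$n\ge N\log\frac{m^d}{\|\sigma\|_{\ell^2(X_\star)}\sqrt{\log m}}$$ Gradient-MUSIC recovers the frequencies with error $C\,\|\sigma\|_{\ell^2(X_\star)}\sqrt{\log m}/m^{d+1}$. (For $m=1$ the probability bound is $0$ and part (b) is void.) -/

import Mathlib

open MeasureTheory ProbabilityTheory
open scoped ENNReal

noncomputable section

namespace GradientMusic

/-- Frequencies are represented by vectors of `ℝ^d`; a point of the torus `𝕋^d = (ℝ/ℤ)^d` is the
class of such a vector modulo `ℤ^d`. Every notion below depends on the classes only. -/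
abbrev Freq (d : ℕ) : Type := EuclideanSpace ℝ (Fin d)

/-- The metric of the torus, `min_{n ∈ ℤ^d} |ω - ω' + n|`, with the Euclidean norm. -/
def torusDist {d : ℕ} (ω ω' : Freq d) : ℝ :=
  ⨅ n : Fin d → ℤ, ‖ω - ω' + WithLp.toLp 2 (fun i => (n i : ℝ))‖

/-- The lattice cube `{-m, …, m}^d`. -/
def cube (d m : ℕ) : Finset (Fin d → ℤ) :=
  Fintype.piFinset fun _ => Finset.Icc (-(m : ℤ)) (m : ℤ)

/-- The exponential `e^{2πi ω·x}` at a lattice point `x`. -/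
def expo {d : ℕ} (ω : Freq d) (x : Fin d → ℤ) : ℂ :=
  Complex.exp (2 * Real.pi * Complex.I * ((∑ i, ω i * (x i : ℝ) : ℝ) : ℂ))

/-- The noiseless signal `y(x) = ∑_ℓ a_ℓ e^{2πi θ_ℓ·x}`. -/
def signal {d s : ℕ} (θ : Fin s → Freq d) (a : Fin s → ℂ) (x : Fin d → ℤ) : ℂ :=
  ∑ l, a l * expo (θ l) x

/-- The norm of the restriction of `f` to the finite set `S` in `ℓ^p(S)`, with `p ∈ [1, ∞]`. -/
def lpNormOn {ι F : Type*} [NormedAddCommGroup F] (p : ℝ≥0∞) (S : Finset ι) (f : ι → F) : ℝ :=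
  ‖(WithLp.toLp p (fun x : S => f x) : PiLp p fun _ : S => F)‖

/-- The space `L²_ν(X)`, where `X = {-m, …, m}^d` and `ν` is the counting measure on `X`. -/
abbrev SampleSpace (d m : ℕ) : Type := EuclideanSpace ℂ (cube d m)

/-- The multilevel Hankel matrix `(z(x + x'))`, with `x, x' ∈ {-m, …, m}^d`. It depends only on the
values of `z` on `{-2m, …, 2m}^d`. -/
def hankelMatrix {d : ℕ} (m : ℕ) (z : (Fin d → ℤ) → ℂ) : Matrix (cube d m) (cube d m) ℂ :=
  Matrix.of fun x x' => z (x.1 + x'.1)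

/-- The Hankel matrix as an operator on `L²_ν(X)`. -/
def hankel {d : ℕ} (m : ℕ) (z : (Fin d → ℤ) → ℂ) : SampleSpace d m →ₗ[ℂ] SampleSpace d m :=
  Matrix.toEuclideanLin (hankelMatrix m z)

/-- The `k`-th largest singular value `σ_k(H)`, for `k ≥ 1`, counted with multiplicity. -/
def sigma {d m : ℕ} (H : SampleSpace d m →ₗ[ℂ] SampleSpace d m) (k : ℕ) : ℝ :=
  H.singularValues (k - 1)

/-- The space spanned by all left singular vectors of `H` (eigenvectors of `H H^*`) that belong to
the singular values `σ_1(H), …, σ_s(H)`. When `σ_s(H) > σ_{s+1}(H)` it has dimension `s` and is the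
leading `s`-dimensional left singular space of `H`. -/
def leadingLeftSingularSpace {d m : ℕ} (H : SampleSpace d m →ₗ[ℂ] SampleSpace d m) (s : ℕ) :
    Submodule ℂ (SampleSpace d m) :=
  ⨆ k ∈ Finset.Icc 1 s, Module.End.eigenspace (H ∘ₗ LinearMap.adjoint H) ((sigma H k ^ 2 : ℝ) : ℂ)

/-- The leading `s`-dimensional left singular space of `H` is well defined: there is a gap after
the `s`-th singular value, and the space above has dimension `s`. -/
def LeadingSpaceWellDefined {d m : ℕ} (H : SampleSpace d m →ₗ[ℂ] SampleSpace d m) (s : ℕ) : Prop :=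
  sigma H (s + 1) < sigma H s ∧ Module.finrank ℂ (leadingLeftSingularSpace H s) = s

/-- The normalized vector `φ_ω(x) = (2m+1)^{-d/2} e^{2πi ω·x}`, for `x ∈ X`. -/
def steering {d : ℕ} (m : ℕ) (ω : Freq d) : SampleSpace d m :=
  WithLp.toLp 2 fun x => ((1 / √((2 * (m : ℝ) + 1) ^ d) : ℝ) : ℂ) * expo ω x.1

/-- The MUSIC function `q_W(ω) = ⟨φ_ω, (I - P_W) φ_ω⟩` of a subspace `W` of `L²_ν(X)`. -/
def music {d m : ℕ} (W : Submodule ℂ (SampleSpace d m)) (ω : Freq d) : ℝ :=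
  (inner ℂ (steering m ω) (steering m ω - W.starProjection (steering m ω))).re

/-- The mesh norm `max_{ω ∈ 𝕋^d} min_{g ∈ G} |ω - g|` of a nonempty finite set `G`. -/
def mesh {d : ℕ} (G : Finset (Freq d)) : ℝ :=
  ⨆ ω : Freq d, ⨅ g : G, torusDist ω g.1

/-- The points of the grid where `q` does not exceed the threshold `α`. -/
def thresholded {d : ℕ} (q : Freq d → ℝ) (G : Finset (Freq d)) (α : ℝ) : Set (Freq d) :=
  {g | g ∈ G ∧ q g ≤ α}

/-- Two points of `S` lie in the same connected cluster of `S` at the linking length `r` if a chain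
of points of `S` with steps of length at most `r` joins them. -/
def SameCluster {d : ℕ} (S : Set (Freq d)) (r : ℝ) : Freq d → Freq d → Prop :=
  Relation.ReflTransGen fun g g' => g ∈ S ∧ g' ∈ S ∧ torusDist g g' ≤ r

/-- One step of gradient descent with step size `h`. -/
def gradStep {d : ℕ} (q : Freq d → ℝ) (h : ℝ) (ω : Freq d) : Freq d :=
  ω - h • gradient q ω

/-- `out` is a possible output of Gradient-MUSIC: one representative is selected from every
connected cluster of the thresholded grid, there being exactly `s` clusters, and `n` steps of
gradient descent are run from every representative. -/
def IsOutput {d s : ℕ} (q : Freq d → ℝ) (G : Finset (Freq d)) (α r h : ℝ) (n : ℕ)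
    (out : Fin s → Freq d) : Prop :=
  ∃ init : Fin s → Freq d,
    (∀ l, init l ∈ thresholded q G α) ∧
    (∀ g ∈ thresholded q G α, ∃! l, SameCluster (thresholded q G α) r g (init l)) ∧
    ∀ l, out l = (gradStep q h)^[n] (init l)

/-- Gradient-MUSIC succeeds with error `ε`: the thresholded grid has exactly `s` clusters, so that
the algorithm has an output, and for every choice of representatives the output, suitably ordered,
is within `ε` of the true frequencies. -/
def Recovers {d s : ℕ} (θ : Fin s → Freq d) (q : Freq d → ℝ) (G : Finset (Freq d)) (α r h : ℝ)
    (n : ℕ) (ε : ℝ) : Prop :=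
  (∃ out : Fin s → Freq d, IsOutput q G α r h n out) ∧
  ∀ out : Fin s → Freq d, IsOutput q G α r h n out →
    ∃ π : Equiv.Perm (Fin s), ∀ l, torusDist (θ l) (out (π l)) ≤ ε

/-- The MUSIC function of the subspace estimated from the samples `z`. -/
def estimatedMusic {d : ℕ} (m s : ℕ) (z : (Fin d → ℤ) → ℂ) : Freq d → ℝ :=
  music (leadingLeftSingularSpace (hankel m z) s)

/-- The standard complex normal law: the real and imaginary parts are independent real Gaussians of
mean `0` and variance `1/2`. -/
def stdComplexNormal : Measure ℂ :=
  ((gaussianReal 0 (1 / 2)).prod (gaussianReal 0 (1 / 2))).map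
    Complex.measurableEquivRealProd.symm

end GradientMusic

end

/-!
Gradient-MUSIC recovers the frequencies because the function it minimizes is, near each frequency
and up to the noise, the one-source function `1 - |⟨φ_θ, φ_ω⟩|²`, where the correlation
`⟨φ_θ, φ_ω⟩` is a product of explicit Dirichlet kernels.

*Separation.* Steering vectors at frequencies that are `β/m`-separated, with `β` depending only on
`d`, have a Gram matrix close to the identity whatever their number
(`exists_abs_norm_sq_sum_steering_sub_le`). The kernel `∏ D_m(t_i)` itself is not summable over
separated points, but the product of two such kernels is; it appears when a sum over the cube is
compared with averages of sums over translated, slightly larger or smaller cubes. Consequently the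
projection onto the signal space is, near `θ_l`, the projection onto the line of `φ_{θ_l}` up to a
small residual, which vanishes at `θ_l` and whose derivative is controlled by a difference quotient
(`exists_separation`, `norm_residual_le_of_update`).

*Noise.* The Vandermonde factorization makes the Hankel matrix of the signal bounded below by
`3/4 (2m+1)^d` on the `s`-dimensional signal space and zero on its complement, so noise whose Hankel
matrix has norm at most `ν (2m+1)^d` leaves a gap after the `s`-th singular value and moves the
projection by at most `6ν` (`leadingSpace_of_noise`, a form of Wedin's theorem). The norm of the
Hankel matrix of the noise is bounded by Schur's test and Hölder's inequality for adversarial noise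
(`norm_hankel_le_lpNormOn`), and for Gaussian noise by the maximum of its discrete Fourier transform
of length `4m+1`, which a union bound over sub-Gaussian variables controls
(`norm_hankel_le_of_fourierCoeff_le`, `exists_event_norm_hankel_le`).

*Landscape.* In the ball of radius `1/(20m)` about `θ_l` the gradient of the one-source function is
`ω - θ_l` multiplied by a positive diagonal matrix with entries between `κ_m` and `2κ_m`, where
`κ_m = 4π²m(m+1)/3`, whatever the dimension (`exists_hasDerivAt_correlation`). Working with the
gradient rather than the Hessian, one obtains that a gradient step contracts the distance to `θ_l`
by `15/16` up to an error `O(ν/m)` (`norm_gradStep_sub_le`), and that the sublevel set at height `α`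
lies in the union of these balls (`exists_torusDist_le_of_music_le`).

*Clusters.* The gradient is large compared with the mesh norm except very near `θ_l`, so from every
point of the thresholded grid one descends, through grid points at mutual distance at most twice the
mesh norm, first along the MUSIC function and then along the distance to `θ_l`, to a grid point
within the mesh norm of `θ_l`. Hence the clusters correspond to the frequencies (`recovers_of_projectionsClose`).
-/

namespace GradientMusic

/-! ### Exponentials, the torus and Dirichlet kernels -/

/-- The inclusion of the lattice `ℤ^d` in the space of frequencies. -/
noncomputable def latticePoint {d : ℕ} (n : Fin d → ℤ) : Freq d :=
  WithLp.toLp 2 fun i => (n i : ℝ)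

@[simp]
lemma latticePoint_apply {d : ℕ} (n : Fin d → ℤ) (i : Fin d) : latticePoint n i = n i := rfl

lemma latticePoint_add {d : ℕ} (n k : Fin d → ℤ) :
    latticePoint (n + k) = latticePoint n + latticePoint k := by
  ext i; simp

lemma latticePoint_neg {d : ℕ} (n : Fin d → ℤ) : latticePoint (-n) = -latticePoint n := by
  ext i; simp

lemma expo_add_left {d : ℕ} (ω ω' : Freq d) (x : Fin d → ℤ) :
    expo (ω + ω') x = expo ω x * expo ω' x := by
  rw [expo, expo, expo, ← Complex.exp_add]
  congr 1
  simp only [PiLp.add_apply, add_mul, Finset.sum_add_distrib]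
  push_cast
  ring

lemma expo_add_right {d : ℕ} (ω : Freq d) (x y : Fin d → ℤ) :
    expo ω (x + y) = expo ω x * expo ω y := by
  rw [expo, expo, expo, ← Complex.exp_add]
  congr 1
  simp only [Pi.add_apply, Int.cast_add, mul_add, Finset.sum_add_distrib]
  push_cast
  ring

lemma norm_expo {d : ℕ} (ω : Freq d) (x : Fin d → ℤ) : ‖expo ω x‖ = 1 := by
  rw [expo]
  rw [show (2 * (Real.pi : ℂ) * Complex.I * ((∑ i, ω i * (x i : ℝ) : ℝ) : ℂ))
    = ((2 * Real.pi * ∑ i, ω i * (x i : ℝ) : ℝ) : ℂ) * Complex.I by push_cast; ring]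
  exact Complex.norm_exp_ofReal_mul_I _

lemma conj_expo {d : ℕ} (ω : Freq d) (x : Fin d → ℤ) :
    (starRingEnd ℂ) (expo ω x) = expo (-ω) x := by
  rw [expo, expo, ← Complex.exp_conj]
  congr 1
  have h2 : (starRingEnd ℂ) 2 = 2 := Complex.conj_ofNat 2
  simp only [map_mul, Complex.conj_ofReal, Complex.conj_I, h2, PiLp.neg_apply, neg_mul,
    Finset.sum_neg_distrib, Complex.ofReal_neg, mul_neg]

lemma expo_neg_right {d : ℕ} (ω : Freq d) (x : Fin d → ℤ) : expo ω (-x) = expo (-ω) x := by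
  rw [expo, expo]
  congr 2
  simp

lemma expo_latticePoint {d : ℕ} (n x : Fin d → ℤ) : expo (latticePoint n) x = 1 := by
  rw [expo, Complex.exp_eq_one_iff]
  refine ⟨∑ i, n i * x i, ?_⟩
  push_cast
  simp
  ring

lemma expo_eq_prod {d : ℕ} (ω : Freq d) (x : Fin d → ℤ) :
    expo ω x = ∏ i, Complex.exp (2 * Real.pi * Complex.I * ((ω i * (x i : ℝ) : ℝ) : ℂ)) := by
  rw [expo, ← Complex.exp_sum, Complex.ofReal_sum, Finset.mul_sum]

/-- The representative of the class of `ω` modulo `ℤ^d` that lies in `[-1/2, 1/2]^d`. -/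
noncomputable def reduce {d : ℕ} (ω : Freq d) : Freq d :=
  WithLp.toLp 2 fun i => ω i - round (ω i)

lemma reduce_eq {d : ℕ} (ω : Freq d) :
    reduce ω = ω + latticePoint (fun i => -round (ω i)) := by
  ext i; simp [reduce, sub_eq_add_neg]

lemma abs_reduce_le {d : ℕ} (ω : Freq d) (i : Fin d) : |reduce ω i| ≤ 1 / 2 :=
  abs_sub_round (ω i)

lemma expo_add_latticePoint {d : ℕ} (ω : Freq d) (n x : Fin d → ℤ) :
    expo (ω + latticePoint n) x = expo ω x := by
  rw [expo_add_left, expo_latticePoint, mul_one]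

lemma torusDist_le {d : ℕ} (ω ω' : Freq d) (n : Fin d → ℤ) :
    torusDist ω ω' ≤ ‖ω - ω' + latticePoint n‖ :=
  ciInf_le ⟨0, by rintro _ ⟨n, rfl⟩; positivity⟩ n

lemma torusDist_le_norm {d : ℕ} (ω ω' : Freq d) : torusDist ω ω' ≤ ‖ω - ω'‖ := by
  have h := torusDist_le ω ω' 0
  rwa [show latticePoint (0 : Fin d → ℤ) = 0 by ext i; simp, add_zero] at h

/-- The infimum in the torus distance is attained at the reduced representative. -/
lemma torusDist_eq {d : ℕ} (ω ω' : Freq d) : torusDist ω ω' = ‖reduce (ω - ω')‖ := by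
  refine le_antisymm ?_ ?_
  · rw [reduce_eq]; exact torusDist_le _ _ _
  · refine le_ciInf fun n => ?_
    rw [EuclideanSpace.norm_eq, EuclideanSpace.norm_eq]
    refine Real.sqrt_le_sqrt (Finset.sum_le_sum fun i _ => ?_)
    refine pow_le_pow_left₀ (norm_nonneg _) ?_ 2
    have h := round_le ((ω - ω') i) (-n i)
    simpa [reduce] using h

lemma exists_torusDist_eq {d : ℕ} (ω ω' : Freq d) :
    ∃ n : Fin d → ℤ, torusDist ω ω' = ‖ω - ω' + latticePoint n‖ :=
  ⟨_, by rw [torusDist_eq, reduce_eq]⟩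

lemma torusDist_nonneg {d : ℕ} (ω ω' : Freq d) : 0 ≤ torusDist ω ω' := by
  rw [torusDist_eq]; positivity

lemma torusDist_comm {d : ℕ} (ω ω' : Freq d) : torusDist ω ω' = torusDist ω' ω := by
  have key : ∀ ω ω' : Freq d, torusDist ω ω' ≤ torusDist ω' ω := fun ω ω' => by
    obtain ⟨n, hn⟩ := exists_torusDist_eq ω' ω
    have h := torusDist_le ω ω' (-n)
    rwa [latticePoint_neg, show ω - ω' + -latticePoint n = -(ω' - ω + latticePoint n) by abel,
      norm_neg, ← hn] at h
  exact le_antisymm (key _ _) (key _ _)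

lemma torusDist_triangle {d : ℕ} (a b c : Freq d) :
    torusDist a c ≤ torusDist a b + torusDist b c := by
  obtain ⟨n, hn⟩ := exists_torusDist_eq a b
  obtain ⟨k, hk⟩ := exists_torusDist_eq b c
  rw [hn, hk]
  refine (torusDist_le a c (n + k)).trans ?_
  rw [latticePoint_add, show a - c + (latticePoint n + latticePoint k)
    = (a - b + latticePoint n) + (b - c + latticePoint k) by abel]
  exact norm_add_le _ _

lemma torusDist_add_latticePoint_left {d : ℕ} (a b : Freq d) (n : Fin d → ℤ) :
    torusDist (a + latticePoint n) b = torusDist a b := by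
  have key : ∀ (a : Freq d) (n : Fin d → ℤ),
      torusDist (a + latticePoint n) b ≤ torusDist a b := fun a n => by
    obtain ⟨k, hk⟩ := exists_torusDist_eq a b
    have h := torusDist_le (a + latticePoint n) b (k - n)
    rwa [sub_eq_add_neg k, latticePoint_add, latticePoint_neg,
      show a + latticePoint n - b + (latticePoint k + -latticePoint n)
        = a - b + latticePoint k by abel, ← hk] at h
  refine le_antisymm (key a n) ?_
  have h := key (a + latticePoint n) (-n)
  rwa [latticePoint_neg, add_neg_cancel_right] at h

lemma torusDist_add_latticePoint_right {d : ℕ} (a b : Freq d) (n : Fin d → ℤ) :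
    torusDist a (b + latticePoint n) = torusDist a b := by
  rw [torusDist_comm, torusDist_add_latticePoint_left, torusDist_comm]

lemma norm_reduce_le {d : ℕ} (ω : Freq d) : ‖reduce ω‖ ≤ √d := by
  rw [EuclideanSpace.norm_eq]
  refine Real.sqrt_le_sqrt ?_
  calc ∑ i, ‖reduce ω i‖ ^ 2 ≤ ∑ _i : Fin d, (1 : ℝ) := Finset.sum_le_sum fun i _ => by
        have h := abs_reduce_le ω i
        rw [Real.norm_eq_abs]
        nlinarith [abs_nonneg (reduce ω i)]
    _ = d := by simp

lemma exists_mem_torusDist_le_mesh {d : ℕ} {G : Finset (Freq d)} (hG : G.Nonempty) (ω : Freq d) :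
    ∃ g ∈ G, torusDist ω g ≤ mesh G := by
  have : Nonempty G := hG.to_subtype
  obtain ⟨g, hg⟩ := exists_eq_ciInf_of_finite (f := fun g : G => torusDist ω g.1)
  refine ⟨g.1, g.2, ?_⟩
  rw [hg]
  refine le_ciSup (f := fun ω : Freq d => ⨅ g : G, torusDist ω g.1) ⟨√d, ?_⟩ ω
  rintro _ ⟨ω', rfl⟩
  refine (ciInf_le (Set.finite_range _).bddBelow g).trans ?_
  rw [torusDist_eq]
  exact norm_reduce_le _

lemma mesh_nonneg {d : ℕ} {G : Finset (Freq d)} (hG : G.Nonempty) : 0 ≤ mesh G := by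
  obtain ⟨g, -, h⟩ := exists_mem_torusDist_le_mesh hG 0
  exact (torusDist_nonneg _ _).trans h

lemma mem_cube {d m : ℕ} {x : Fin d → ℤ} : x ∈ cube d m ↔ ∀ i, -(m : ℤ) ≤ x i ∧ x i ≤ m := by
  simp [cube, Fintype.mem_piFinset]

lemma card_cube (d m : ℕ) : (cube d m).card = (2 * m + 1) ^ d := by
  rw [cube, Fintype.card_piFinset]
  simp only [Int.card_Icc, Finset.prod_const, Finset.card_univ, Fintype.card_fin]
  congr 1
  omega

/-- The (unnormalized) Dirichlet kernel `∑_{|k| ≤ m} cos(2π t k)`. -/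
noncomputable def dirichlet (m : ℕ) (t : ℝ) : ℝ :=
  ∑ k ∈ Finset.Icc (-(m : ℤ)) m, Real.cos (2 * Real.pi * (t * k))

lemma sum_Icc_neg {M : Type*} [AddCommMonoid M] (m : ℕ) (f : ℤ → M) :
    ∑ k ∈ Finset.Icc (-(m : ℤ)) m, f (-k) = ∑ k ∈ Finset.Icc (-(m : ℤ)) m, f k := by
  refine Finset.sum_nbij' (fun k => -k) (fun k => -k) ?_ ?_ ?_ ?_ ?_ <;>
    simp only [Finset.mem_Icc] <;> intros <;> first | omega | simp

/-- Odd functions sum to zero over symmetric intervals. -/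
lemma sum_Icc_odd (m : ℕ) {f : ℤ → ℝ} (hf : ∀ k, f (-k) = -f k) :
    ∑ k ∈ Finset.Icc (-(m : ℤ)) m, f k = 0 := by
  have h := sum_Icc_neg m f
  simp only [hf, Finset.sum_neg_distrib] at h
  linarith

lemma exp_two_pi_I_eq (y : ℝ) : Complex.exp (2 * Real.pi * Complex.I * (y : ℂ)) =
    (Real.cos (2 * Real.pi * y) : ℂ) + (Real.sin (2 * Real.pi * y) : ℂ) * Complex.I := by
  rw [Complex.ofReal_cos, Complex.ofReal_sin, ← Complex.exp_mul_I]
  congr 1; push_cast; ring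

lemma sum_exp_eq_dirichlet (m : ℕ) (t : ℝ) :
    ∑ k ∈ Finset.Icc (-(m : ℤ)) m, Complex.exp (2 * Real.pi * Complex.I * ((t * (k : ℝ) : ℝ) : ℂ))
      = (dirichlet m t : ℂ) := by
  simp only [exp_two_pi_I_eq, Finset.sum_add_distrib, ← Finset.sum_mul]
  rw [← Complex.ofReal_sum, ← Complex.ofReal_sum,
    sum_Icc_odd m (f := fun k => Real.sin (2 * Real.pi * (t * k))), dirichlet]
  · rw [Complex.ofReal_zero, zero_mul, add_zero]
  · intro k
    rw [← Real.sin_neg]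
    congr 1; push_cast; ring

lemma sum_cube_expo {d : ℕ} (m : ℕ) (t : Freq d) :
    ∑ x ∈ cube d m, expo t x = ((∏ i, dirichlet m (t i) : ℝ) : ℂ) := by
  simp only [expo_eq_prod]
  rw [cube, ← Finset.prod_univ_sum (fun _ => Finset.Icc (-(m : ℤ)) (m : ℤ))
    (fun i k => Complex.exp (2 * Real.pi * Complex.I * ((t i * (k : ℝ) : ℝ) : ℂ)))]
  simp only [sum_exp_eq_dirichlet, Complex.ofReal_prod]

lemma abs_dirichlet_le (m : ℕ) (t : ℝ) : |dirichlet m t| ≤ 2 * m + 1 := by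
  refine (Finset.abs_sum_le_sum_abs _ _).trans ?_
  refine (Finset.sum_le_sum fun k _ => Real.abs_cos_le_one _).trans (le_of_eq ?_)
  rw [Finset.sum_const, Int.card_Icc, nsmul_eq_mul, mul_one,
    show ((m : ℤ) + 1 - -(m : ℤ)).toNat = 2 * m + 1 by omega]
  push_cast; ring

lemma dirichlet_zero (m : ℕ) : dirichlet m 0 = 2 * m + 1 := by
  rw [dirichlet]
  simp only [zero_mul, mul_zero, Real.cos_zero, Finset.sum_const, Int.card_Icc, nsmul_eq_mul,
    mul_one]
  rw [show ((m : ℤ) + 1 - -(m : ℤ)).toNat = 2 * m + 1 by omega]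
  push_cast; ring

lemma dirichlet_neg (m : ℕ) (t : ℝ) : dirichlet m (-t) = dirichlet m t := by
  refine Finset.sum_congr rfl fun k _ => ?_
  rw [← Real.cos_neg]; congr 1; ring

lemma sum_Icc_succ {M : Type*} [AddCommGroup M] (m : ℕ) (f : ℤ → M) :
    ∑ k ∈ Finset.Icc (-((m + 1 : ℕ) : ℤ)) ((m + 1 : ℕ) : ℤ), f k
      = ∑ k ∈ Finset.Icc (-(m : ℤ)) m, f k + (f (m + 1) + f (-(m + 1))) := by
  have : Finset.Icc (-((m + 1 : ℕ) : ℤ)) ((m + 1 : ℕ) : ℤ)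
      = insert ((m : ℤ) + 1) (insert (-((m : ℤ) + 1)) (Finset.Icc (-(m : ℤ)) m)) := by
    ext k; simp only [Finset.mem_Icc, Finset.mem_insert]; omega
  rw [this, Finset.sum_insert, Finset.sum_insert]
  · abel
  · simp
  · simp only [Finset.mem_Icc, Finset.mem_insert]; omega

lemma dirichlet_mul_sin (m : ℕ) (t : ℝ) :
    dirichlet m t * Real.sin (Real.pi * t) = Real.sin ((2 * m + 1) * (Real.pi * t)) := by
  induction m with
  | zero => simp [dirichlet]
  | succ m ih =>
    rw [dirichlet, sum_Icc_succ, add_mul, ← dirichlet, ih]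
    have h1 : Real.cos (2 * Real.pi * (t * ((-((m : ℤ) + 1) : ℤ) : ℝ)))
        = Real.cos ((2 * m + 2) * (Real.pi * t)) := by
      rw [← Real.cos_neg]; congr 1; push_cast; ring
    have h2 : Real.cos (2 * Real.pi * (t * (((m : ℤ) + 1 : ℤ) : ℝ)))
        = Real.cos ((2 * m + 2) * (Real.pi * t)) := by
      congr 1; push_cast; ring
    rw [h1, h2]
    have e1 : (2 * (m : ℝ) + 1) * (Real.pi * t) = (2 * m + 2) * (Real.pi * t) - Real.pi * t := by
      ring
    have e2 : (2 * ((m + 1 : ℕ) : ℝ) + 1) * (Real.pi * t)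
        = (2 * m + 2) * (Real.pi * t) + Real.pi * t := by push_cast; ring
    rw [e1, e2, Real.sin_sub, Real.sin_add]; ring

lemma abs_sin_pi_mul_ge {t : ℝ} (ht : |t| ≤ 1 / 2) : 2 * |t| ≤ |Real.sin (Real.pi * t)| := by
  have h0 : ∀ t : ℝ, 0 ≤ t → t ≤ 1 / 2 → 2 * t ≤ Real.sin (Real.pi * t) := fun t h0 h1 => by
    have := Real.mul_le_sin (x := Real.pi * t) (by positivity) (by nlinarith [Real.pi_pos])
    have e : 2 / Real.pi * (Real.pi * t) = 2 * t := by field_simp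
    linarith
  rcases le_total 0 t with h | h
  · rw [abs_of_nonneg h] at ht ⊢
    exact (h0 t h ht).trans (le_abs_self _)
  · rw [abs_of_nonpos h] at ht ⊢
    have := h0 (-t) (by linarith) ht
    rw [mul_neg Real.pi, Real.sin_neg] at this
    linarith [neg_le_abs (Real.sin (Real.pi * t))]

/-- The decay `|D_m(t)| ≤ 1 / (2|t|)` of the Dirichlet kernel on `[-1/2, 1/2]`. -/
lemma abs_dirichlet_mul_le (m : ℕ) {t : ℝ} (ht : |t| ≤ 1 / 2) :
    |dirichlet m t| * (2 * |t|) ≤ 1 := by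
  calc |dirichlet m t| * (2 * |t|) ≤ |dirichlet m t| * |Real.sin (Real.pi * t)| := by
        gcongr; exact abs_sin_pi_mul_ge ht
    _ = |Real.sin ((2 * m + 1) * (Real.pi * t))| := by rw [← abs_mul, dirichlet_mul_sin]
    _ ≤ 1 := Real.abs_sin_le_one _

/-! ### Steering vectors -/

/-- The number `(2m+1)^d` of points of the sampling cube, as a real number. -/
noncomputable def cubeSize (d m : ℕ) : ℝ := (2 * (m : ℝ) + 1) ^ d

lemma cubeSize_pos (d m : ℕ) : 0 < cubeSize d m := by unfold cubeSize; positivity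

lemma card_cube_eq (d m : ℕ) : ((cube d m).card : ℝ) = cubeSize d m := by
  rw [card_cube, cubeSize]; push_cast; ring

lemma steering_apply {d m : ℕ} (ω : Freq d) (x : cube d m) :
    steering m ω x = ((1 / √(cubeSize d m) : ℝ) : ℂ) * expo ω x.1 := rfl

lemma inner_sampleSpace {d m : ℕ} (u v : SampleSpace d m) :
    inner ℂ u v = ∑ x : cube d m, (starRingEnd ℂ) (u x) * v x := by
  rw [PiLp.inner_apply]
  refine Finset.sum_congr rfl fun x _ => ?_
  rw [RCLike.inner_apply, mul_comm]

lemma norm_sq_sampleSpace {d m : ℕ} (u : SampleSpace d m) :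
    ‖u‖ ^ 2 = ∑ x : cube d m, ‖u x‖ ^ 2 := EuclideanSpace.norm_sq_eq u

lemma inner_steering {d m : ℕ} (ω ω' : Freq d) :
    inner ℂ (steering m ω) (steering m ω')
      = ((∏ i, dirichlet m ((ω' - ω) i) / (2 * m + 1) : ℝ) : ℂ) := by
  rw [inner_sampleSpace]
  have : ∀ x : cube d m, (starRingEnd ℂ) (steering m ω x) * steering m ω' x
      = ((1 / cubeSize d m : ℝ) : ℂ) * expo (ω' - ω) x.1 := fun x => by
    rw [steering_apply, steering_apply, map_mul, Complex.conj_ofReal, conj_expo, sub_eq_add_neg,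
      expo_add_left, show (1 / cubeSize d m : ℝ) = 1 / √(cubeSize d m) * (1 / √(cubeSize d m)) by
        rw [div_mul_div_comm, Real.mul_self_sqrt (cubeSize_pos d m).le, one_mul]]
    push_cast; ring
  simp only [this]
  rw [← Finset.mul_sum, Finset.sum_coe_sort (cube d m) (fun x => expo (ω' - ω) x), sum_cube_expo,
    ← Complex.ofReal_mul, Finset.prod_div_distrib, Finset.prod_const, Finset.card_univ,
    Fintype.card_fin, cubeSize]
  congr 1; ring

lemma norm_steering {d m : ℕ} (ω : Freq d) : ‖steering m ω‖ = 1 := by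
  have h : ‖steering m ω‖ ^ 2 = 1 := by
    have h1 := inner_self_eq_norm_sq (𝕜 := ℂ) (steering m ω)
    rw [inner_steering] at h1
    have h3 : (2 * (m : ℝ) + 1) ≠ 0 := by positivity
    simp only [sub_self, PiLp.zero_apply, dirichlet_zero, div_self h3, Finset.prod_const_one] at h1
    rw [← h1]; simp
  nlinarith [norm_nonneg (steering m ω)]

lemma steering_add_latticePoint {d m : ℕ} (ω : Freq d) (n : Fin d → ℤ) :
    steering m (ω + latticePoint n) = steering m ω := by
  ext x; rw [steering_apply, steering_apply, expo_add_latticePoint]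

/-! ### Sums of decaying kernels over separated points -/

/-- A bound for `x⁻²` (and for `1`, near the origin) on the interval `[n, n + 1)`. -/
noncomputable def boxWeight (n : ℤ) : ℝ := 1 / ((max 1 (max n (-n - 1)) : ℤ) : ℝ) ^ 2

lemma boxWeight_nonneg (n : ℤ) : 0 ≤ boxWeight n := by unfold boxWeight; positivity

lemma summable_boxWeight : Summable boxWeight := by
  have h : Summable fun n : ℤ => 4 * (1 / (n : ℝ) ^ 2) + if n = 0 then (1 : ℝ) else 0 :=
    ((Real.summable_one_div_int_pow.2 one_lt_two).mul_left 4).add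
      (summable_of_ne_finset_zero (s := {0}) fun n hn => by simpa using hn)
  refine Summable.of_nonneg_of_le boxWeight_nonneg (fun n => ?_) h
  by_cases hn : n = 0
  · subst hn; simp [boxWeight]
  · rw [if_neg hn, add_zero, boxWeight]
    have h1 : |n| ≤ 2 * max 1 (max n (-n - 1)) := by
      rcases le_total 0 n with h | h
      · rw [abs_of_nonneg h]; omega
      · rw [abs_of_nonpos h]; omega
    have h2 : |(n : ℝ)| ≤ 2 * ((max 1 (max n (-n - 1)) : ℤ) : ℝ) := by exact_mod_cast h1
    have h3 : (1 : ℝ) ≤ ((max 1 (max n (-n - 1)) : ℤ) : ℝ) := by exact_mod_cast le_max_left _ _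
    have h4 : 0 < |(n : ℝ)| := by positivity
    rw [← sq_abs (n : ℝ), mul_one_div, div_le_div_iff₀ (by positivity) (by positivity), one_mul]
    nlinarith

lemma exists_sum_prod_boxWeight_le : ∃ A : ℝ, 0 < A ∧ ∀ (d : ℕ) (S : Finset (Fin d → ℤ)),
    ∑ n ∈ S, ∏ i, boxWeight (n i) ≤ A ^ d := by
  refine ⟨1 + ∑' n, boxWeight n, add_pos_of_pos_of_nonneg one_pos
    (tsum_nonneg boxWeight_nonneg), fun d S => ?_⟩
  have hsub : S ⊆ Fintype.piFinset fun i => S.image fun n => n i := fun n hn => by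
    rw [Fintype.mem_piFinset]
    exact fun i => Finset.mem_image_of_mem _ hn
  calc ∑ n ∈ S, ∏ i, boxWeight (n i)
      ≤ ∑ n ∈ Fintype.piFinset fun i => S.image fun n => n i, ∏ i, boxWeight (n i) :=
        Finset.sum_le_sum_of_subset_of_nonneg hsub fun n _ _ =>
          Finset.prod_nonneg fun i _ => boxWeight_nonneg _
    _ = ∏ i, ∑ k ∈ S.image fun n => n i, boxWeight k :=
        (Finset.prod_univ_sum _ fun _ k => boxWeight k).symm
    _ ≤ ∏ _i : Fin d, (1 + ∑' n, boxWeight n) := by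
        refine Finset.prod_le_prod (fun i _ => Finset.sum_nonneg fun k _ => boxWeight_nonneg k)
          fun i _ => ?_
        have := summable_boxWeight.sum_le_tsum (S.image fun n => n i) fun k _ => boxWeight_nonneg k
        linarith
    _ = _ := by simp

lemma norm_le_sqrt_mul {d : ℕ} {v : Freq d} {b : ℝ} (hb : 0 ≤ b) (h : ∀ i, |v i| ≤ b) :
    ‖v‖ ≤ √d * b := by
  rw [EuclideanSpace.norm_eq]
  calc √(∑ i, ‖v i‖ ^ 2) ≤ √(∑ _i : Fin d, b ^ 2) :=
        Real.sqrt_le_sqrt (Finset.sum_le_sum fun i _ => pow_le_pow_left₀ (norm_nonneg _) (h i) 2)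
    _ = √d * b := by
        rw [Finset.sum_const, Finset.card_univ, Fintype.card_fin, nsmul_eq_mul,
          Real.sqrt_mul (Nat.cast_nonneg d), Real.sqrt_sq hb]

lemma le_boxWeight_floor {x g b : ℝ} (hb : 1 ≤ b) (hg1 : g ≤ 1) (hgx : g * x ^ 2 ≤ 1) :
    g ≤ boxWeight ⌊x / b⌋ ∧
      (⌊x / b⌋ ≠ 0 → ⌊x / b⌋ ≠ -1 → g ≤ boxWeight ⌊x / b⌋ / b ^ 2) := by
  have hb0 : 0 < b := by linarith
  set n := ⌊x / b⌋ with hn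
  have h1 : (n : ℝ) * b ≤ x := (le_div_iff₀ hb0).1 (Int.floor_le _)
  have h2 : x < ((n : ℝ) + 1) * b := (div_lt_iff₀ hb0).1 (Int.lt_floor_add_one _)
  have key : n ≠ 0 → n ≠ -1 → g ≤ boxWeight n / b ^ 2 := fun hn0 hn1 => by
    have h3 : (1 : ℝ) ≤ ((max 1 (max n (-n - 1)) : ℤ) : ℝ) := by exact_mod_cast le_max_left _ _
    have h4 : ((max 1 (max n (-n - 1)) : ℤ) : ℝ) * b ≤ |x| := by
      rcases lt_or_ge n 0 with h | h
      · rw [show max 1 (max n (-n - 1)) = -n - 1 by omega]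
        push_cast
        linarith [neg_le_abs x]
      · rw [show max 1 (max n (-n - 1)) = n by omega]
        linarith [le_abs_self x]
    set w := ((max 1 (max n (-n - 1)) : ℤ) : ℝ) with hw
    have h5 : (w * b) ^ 2 ≤ x ^ 2 := by rw [← sq_abs x]; gcongr
    rw [boxWeight, ← hw, div_div, ← mul_pow, le_div_iff₀ (by positivity)]
    rcases le_total g 0 with h | h
    · exact (mul_nonpos_of_nonpos_of_nonneg h (by positivity)).trans zero_le_one
    · exact (mul_le_mul_of_nonneg_left h5 h).trans hgx
  refine ⟨?_, key⟩
  by_cases hn0 : n = 0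
  · rw [hn0]; simpa [boxWeight] using hg1
  by_cases hn1 : n = -1
  · rw [hn1]; simpa [boxWeight] using hg1
  refine (key hn0 hn1).trans (div_le_self (boxWeight_nonneg n) ?_)
  nlinarith

/-- Products of inverse squares of coordinates, summed over points that are separated from each
other and from the origin: the points lie in distinct boxes of side `b`, and none of them lies in
the boxes next to the origin. -/
lemma exists_sum_prod_le_of_separated : ∃ A : ℝ, 0 < A ∧
    ∀ {d : ℕ} {ι : Type*} (S : Finset ι) (x : ι → Freq d) (g : ι → Fin d → ℝ) {b : ℝ},
      1 ≤ b →
      (∀ j ∈ S, ∀ k ∈ S, j ≠ k → √d * b < ‖x j - x k‖) →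
      (∀ j ∈ S, √d * b < ‖x j‖) →
      (∀ j i, 0 ≤ g j i) → (∀ j i, g j i ≤ 1) → (∀ j i, g j i * x j i ^ 2 ≤ 1) →
      ∑ j ∈ S, ∏ i, g j i ≤ A ^ d / b ^ 2 := by
  obtain ⟨A, hA, hS⟩ := exists_sum_prod_boxWeight_le
  refine ⟨A, hA, fun {d ι} S x g b hb hsep hfar hg0 hg1 hgx => ?_⟩
  classical
  have hb0 : 0 < b := by linarith
  set n : ι → Fin d → ℤ := fun j i => ⌊x j i / b⌋ with hn
  have hinj : Set.InjOn n S := by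
    intro j hj k hk hjk
    by_contra hne
    refine absurd (hsep j hj k hk hne) (not_lt.2 (norm_le_sqrt_mul hb0.le fun i => ?_))
    have h := congrFun hjk i
    have h1 := Int.abs_sub_lt_one_of_floor_eq_floor h
    rw [← sub_div, abs_div, abs_of_pos hb0, div_lt_one hb0] at h1
    exact h1.le
  have hterm : ∀ j ∈ S, ∏ i, g j i ≤ (∏ i, boxWeight (n j i)) / b ^ 2 := by
    intro j hj
    obtain ⟨i, hi0, hi1⟩ : ∃ i, n j i ≠ 0 ∧ n j i ≠ -1 := by
      by_contra hcon
      push Not at hcon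
      refine absurd (hfar j hj) (not_lt.2 (norm_le_sqrt_mul hb0.le fun i => ?_))
      have h1 : (n j i : ℝ) * b ≤ x j i := (le_div_iff₀ hb0).1 (Int.floor_le _)
      have h2 : x j i < ((n j i : ℝ) + 1) * b := (div_lt_iff₀ hb0).1 (Int.lt_floor_add_one _)
      rw [abs_le]
      by_cases h0 : n j i = 0
      · rw [h0] at h1 h2; push_cast at h1 h2; constructor <;> linarith
      · rw [hcon i h0] at h1 h2; push_cast at h1 h2; constructor <;> linarith
    rw [← Finset.mul_prod_erase _ _ (Finset.mem_univ i), ← Finset.mul_prod_erase _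
      (fun i => boxWeight (n j i)) (Finset.mem_univ i), mul_div_right_comm]
    refine mul_le_mul ((le_boxWeight_floor hb (hg1 j i) (hgx j i)).2 hi0 hi1) ?_ ?_ ?_
    · exact Finset.prod_le_prod (fun i _ => hg0 j i) fun i _ =>
        (le_boxWeight_floor hb (hg1 j i) (hgx j i)).1
    · exact Finset.prod_nonneg fun i _ => hg0 j i
    · exact div_nonneg (boxWeight_nonneg _) (by positivity)
  calc ∑ j ∈ S, ∏ i, g j i ≤ ∑ j ∈ S, (∏ i, boxWeight (n j i)) / b ^ 2 := Finset.sum_le_sum hterm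
    _ = (∑ k ∈ S.image n, ∏ i, boxWeight (k i)) / b ^ 2 := by
        rw [Finset.sum_image hinj, Finset.sum_div]
    _ ≤ A ^ d / b ^ 2 := by gcongr; exact hS d _

/-! ### Almost orthogonality of separated steering vectors -/

/-- A trigonometric sum, summed in square over a translated cube and averaged over the
translations: the cross terms carry the product of two Dirichlet kernels. -/
lemma sum_sum_norm_sq_expo {d : ℕ} {ι : Type*} [Fintype ι] (t : ι → Freq d) (c : ι → ℂ)
    (K M : ℕ) :
    ∑ k ∈ cube d K, ∑ x ∈ cube d M, ‖∑ j, c j * expo (t j) (x + k)‖ ^ 2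
      = ∑ j, ∑ l, ((starRingEnd ℂ) (c j) * c l).re *
          ((∏ i, dirichlet K ((t l - t j) i)) * ∏ i, dirichlet M ((t l - t j) i)) := by
  have h1 : ∀ z : Fin d → ℤ, ((‖∑ j, c j * expo (t j) z‖ ^ 2 : ℝ) : ℂ)
      = ∑ j, ∑ l, (starRingEnd ℂ) (c j) * c l * expo (t l - t j) z := fun z => by
    rw [Complex.ofReal_pow, ← Complex.conj_mul', map_sum, Finset.sum_mul_sum]
    refine Finset.sum_congr rfl fun j _ => Finset.sum_congr rfl fun l _ => ?_
    rw [map_mul, conj_expo, sub_eq_add_neg, expo_add_left]; ring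
  have h2 : ((∑ k ∈ cube d K, ∑ x ∈ cube d M, ‖∑ j, c j * expo (t j) (x + k)‖ ^ 2 : ℝ) : ℂ)
      = ∑ j, ∑ l, (starRingEnd ℂ) (c j) * c l *
          (((∏ i, dirichlet K ((t l - t j) i)) * ∏ i, dirichlet M ((t l - t j) i) : ℝ) : ℂ) := by
    push_cast
    simp only [← Complex.ofReal_prod, ← sum_cube_expo, ← Complex.ofReal_pow, h1]
    simp only [Finset.mul_sum]
    rw [Finset.sum_congr rfl fun k _ => Finset.sum_comm, Finset.sum_comm]
    refine Finset.sum_congr rfl fun j _ => ?_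
    rw [Finset.sum_congr rfl fun k _ => Finset.sum_comm, Finset.sum_comm]
    refine Finset.sum_congr rfl fun l _ => ?_
    rw [Finset.sum_comm]
    refine Finset.sum_congr rfl fun x _ => ?_
    rw [Finset.sum_mul, Finset.mul_sum]
    refine Finset.sum_congr rfl fun k _ => ?_
    rw [expo_add_right]; ring
  have h3 := congrArg Complex.re h2
  rw [Complex.ofReal_re, Complex.re_sum] at h3
  rw [h3]
  refine Finset.sum_congr rfl fun j _ => ?_
  rw [Complex.re_sum]
  exact Finset.sum_congr rfl fun l _ => Complex.re_mul_ofReal _ _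

/-- Schur's test for a symmetric matrix that is the identity up to small row sums. -/
lemma abs_sum_sum_sub_le {ι : Type*} [Fintype ι] [DecidableEq ι] (c : ι → ℂ) (a : ι → ι → ℝ)
    {ε : ℝ} (hdiag : ∀ j, a j j = 1) (hsymm : ∀ j l, a j l = a l j)
    (hrow : ∀ j, ∑ l ∈ Finset.univ.erase j, |a j l| ≤ ε) :
    |∑ j, ∑ l, ((starRingEnd ℂ) (c j) * c l).re * a j l - ∑ j, ‖c j‖ ^ 2|
      ≤ ε * ∑ j, ‖c j‖ ^ 2 := by
  have h1 : ∑ j, ∑ l, ((starRingEnd ℂ) (c j) * c l).re * a j l - ∑ j, ‖c j‖ ^ 2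
      = ∑ j, ∑ l ∈ Finset.univ.erase j, ((starRingEnd ℂ) (c j) * c l).re * a j l := by
    rw [← Finset.sum_sub_distrib]
    refine Finset.sum_congr rfl fun j _ => ?_
    rw [← Finset.add_sum_erase _ _ (Finset.mem_univ j), hdiag, Complex.conj_mul',
      ← Complex.ofReal_pow, Complex.ofReal_re]
    ring
  have h2 : ∀ j l, |((starRingEnd ℂ) (c j) * c l).re * a j l|
      ≤ ‖c j‖ ^ 2 * |a j l| / 2 + ‖c l‖ ^ 2 * |a l j| / 2 := fun j l => by
    rw [abs_mul, hsymm l j]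
    have h3 : |((starRingEnd ℂ) (c j) * c l).re| ≤ ‖c j‖ * ‖c l‖ := by
      refine (Complex.abs_re_le_norm _).trans ?_
      rw [norm_mul, RCLike.norm_conj]
    have h4 : ‖c j‖ * ‖c l‖ ≤ (‖c j‖ ^ 2 + ‖c l‖ ^ 2) / 2 := by
      nlinarith [sq_nonneg (‖c j‖ - ‖c l‖)]
    have := mul_le_mul_of_nonneg_right (h3.trans h4) (abs_nonneg (a j l))
    linarith
  have h5 : ∑ j, ∑ l ∈ Finset.univ.erase j, ‖c j‖ ^ 2 * |a j l| ≤ ε * ∑ j, ‖c j‖ ^ 2 := by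
    rw [Finset.mul_sum]
    refine Finset.sum_le_sum fun j _ => ?_
    rw [← Finset.mul_sum, mul_comm]
    exact mul_le_mul_of_nonneg_right (hrow j) (by positivity)
  have h6 : ∑ j, ∑ l ∈ Finset.univ.erase j, ‖c l‖ ^ 2 * |a l j|
      = ∑ j, ∑ l ∈ Finset.univ.erase j, ‖c j‖ ^ 2 * |a j l| := by
    refine Finset.sum_comm' fun j l => ?_
    simp only [Finset.mem_univ, Finset.mem_erase, true_and, and_true]
    exact ne_comm
  rw [h1]
  calc _ ≤ ∑ j, ∑ l ∈ Finset.univ.erase j, |((starRingEnd ℂ) (c j) * c l).re * a j l| :=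
        (Finset.abs_sum_le_sum_abs _ _).trans
          (Finset.sum_le_sum fun j _ => Finset.abs_sum_le_sum_abs _ _)
    _ ≤ ∑ j, ∑ l ∈ Finset.univ.erase j,
          (‖c j‖ ^ 2 * |a j l| / 2 + ‖c l‖ ^ 2 * |a l j| / 2) :=
        Finset.sum_le_sum fun j _ => Finset.sum_le_sum fun l _ => h2 j l
    _ ≤ ε * ∑ j, ‖c j‖ ^ 2 := by
        simp only [Finset.sum_add_distrib, ← Finset.sum_div]
        rw [h6]; linarith

lemma dirichlet_add_int (m : ℕ) (t : ℝ) (n : ℤ) : dirichlet m (t + n) = dirichlet m t := by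
  refine Finset.sum_congr rfl fun k _ => ?_
  rw [← Real.cos_add_int_mul_two_pi (2 * Real.pi * (t * k)) (n * k)]
  congr 1; push_cast; ring

lemma dirichlet_reduce {d : ℕ} (m : ℕ) (t : Freq d) (i : Fin d) :
    dirichlet m (reduce t i) = dirichlet m (t i) := by
  rw [reduce_eq, PiLp.add_apply, latticePoint_apply, dirichlet_add_int]

/-- The mean square of a trigonometric sum with separated frequencies over cubes `{-M, …, M}^d`,
averaged over the translations by `{-K, …, K}^d`, is nearly the sum of the squares of the
coefficients. -/
lemma exists_abs_sum_sum_norm_sq_sub_le (d : ℕ) {ε γ : ℝ} (hε : 0 < ε) (hγ : 0 < γ) :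
    ∃ B : ℝ, 0 < B ∧ ∀ (m K M : ℕ), 1 ≤ m →
      (γ * m) ^ 2 ≤ 4 * (2 * K + 1) * (2 * M + 1) →
      ∀ {ι : Type} [Fintype ι] (t : ι → Freq d),
        (∀ j k, j ≠ k → B / m ≤ torusDist (t j) (t k)) → ∀ c : ι → ℂ,
      |∑ k ∈ cube d K, ∑ x ∈ cube d M, ‖∑ j, c j * expo (t j) (x + k)‖ ^ 2
        - cubeSize d K * cubeSize d M * ∑ j, ‖c j‖ ^ 2|
        ≤ cubeSize d K * cubeSize d M * (ε * ∑ j, ‖c j‖ ^ 2) := by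
  obtain ⟨A, hA, hsum⟩ := exists_sum_prod_le_of_separated
  set b : ℝ := 1 + √(A ^ d / ε) with hb
  have hb1 : 1 ≤ b := by rw [hb]; linarith [Real.sqrt_nonneg (A ^ d / ε)]
  have hbε : A ^ d / b ^ 2 ≤ ε := by
    rw [div_le_iff₀ (by positivity), mul_comm, ← div_le_iff₀ hε]
    calc A ^ d / ε = √(A ^ d / ε) ^ 2 := (Real.sq_sqrt (by positivity)).symm
      _ ≤ b ^ 2 := by gcongr; rw [hb]; linarith
  refine ⟨(√d * b + 1) / γ, by positivity, fun m K M hm hKM ι _ t hsep c => ?_⟩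
  classical
  have hm0 : (0 : ℝ) < m := by exact_mod_cast hm
  have hNK : (0 : ℝ) < 2 * K + 1 := by positivity
  have hNM : (0 : ℝ) < 2 * M + 1 := by positivity
  set a : ι → ι → ℝ := fun j l =>
    ∏ i, (dirichlet K ((t l - t j) i) * dirichlet M ((t l - t j) i)) / ((2 * K + 1) * (2 * M + 1))
    with ha
  have hfac : ∀ j l, (∏ i, dirichlet K ((t l - t j) i)) * ∏ i, dirichlet M ((t l - t j) i)
      = cubeSize d K * cubeSize d M * a j l := fun j l => by
    have : ∀ y : ℝ, cubeSize d K * cubeSize d M * (y / (((2 * K + 1) * (2 * M + 1)) ^ d)) = y :=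
      fun y => by
        rw [cubeSize, cubeSize, ← mul_pow]; field_simp
    simp only [ha]
    rw [Finset.prod_div_distrib, Finset.prod_const, Finset.card_univ, Fintype.card_fin, this,
      Finset.prod_mul_distrib]
  -- `a j l` decays like the product of `(γ m τ_i)⁻²` over the coordinates of the reduced
  -- difference, one factor `1 / τ_i` coming from each of the two kernels
  have hdiag : ∀ j, a j j = 1 := fun j => by
    refine Finset.prod_eq_one fun i _ => ?_
    rw [sub_self, PiLp.zero_apply, dirichlet_zero, dirichlet_zero, div_self (by positivity)]
  have hsymm : ∀ j l, a j l = a l j := fun j l => by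
    refine Finset.prod_congr rfl fun i _ => ?_
    rw [← neg_sub, PiLp.neg_apply, dirichlet_neg, dirichlet_neg]
  have hrow : ∀ j, ∑ l ∈ Finset.univ.erase j, |a j l| ≤ ε := fun j => by
    refine le_trans (le_of_eq ?_) ((hsum (Finset.univ.erase j)
      (fun l => (γ * m) • reduce (t l - t j))
      (fun l i => |dirichlet K ((t l - t j) i)| / (2 * K + 1) *
        (|dirichlet M ((t l - t j) i)| / (2 * M + 1))) hb1 ?_ ?_ ?_ ?_ ?_).trans hbε)
    · refine Finset.sum_congr rfl fun l _ => ?_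
      rw [ha, Finset.abs_prod]
      refine Finset.prod_congr rfl fun i _ => ?_
      rw [abs_div, abs_mul, abs_of_pos (by positivity : (0 : ℝ) < (2 * K + 1) * (2 * M + 1)),
        div_mul_div_comm]
    · intro l _ k _ hlk
      have h1 := hsep l k hlk
      have h2 : torusDist (t l) (t k) ≤ ‖reduce (t l - t j) - reduce (t k - t j)‖ := by
        have h3 := torusDist_le (t l) (t k)
          ((fun i => -round ((t l - t j) i)) - fun i => -round ((t k - t j) i))
        rw [sub_eq_add_neg (fun i => -round ((t l - t j) i)), latticePoint_add,
          latticePoint_neg] at h3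
        rw [reduce_eq, reduce_eq]
        refine h3.trans (le_of_eq (congrArg _ ?_))
        abel
      rw [← smul_sub, norm_smul, Real.norm_eq_abs, abs_of_pos (by positivity)]
      have h4 : (√d * b + 1) / γ ≤ ‖reduce (t l - t j) - reduce (t k - t j)‖ * m :=
        (div_le_iff₀ hm0).1 (h1.trans h2)
      rw [div_le_iff₀ hγ] at h4
      linarith
    · intro l hl
      have h1 := hsep l j (Finset.ne_of_mem_erase hl)
      rw [torusDist_eq, div_le_iff₀ hm0, div_le_iff₀ hγ] at h1
      rw [norm_smul, Real.norm_eq_abs, abs_of_pos (by positivity)]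
      linarith
    · intro l i; positivity
    · intro l i
      refine mul_le_one₀ ?_ (by positivity) ?_
      · exact (div_le_one hNK).2 (abs_dirichlet_le K _)
      · exact (div_le_one hNM).2 (abs_dirichlet_le M _)
    · intro l i
      rw [← dirichlet_reduce K, ← dirichlet_reduce M]
      set τ := reduce (t l - t j) i with hτ
      have hτ2 : |τ| ≤ 1 / 2 := abs_reduce_le _ _
      have h1 := abs_dirichlet_mul_le K hτ2
      have h2 := abs_dirichlet_mul_le M hτ2
      have h3 : |dirichlet K τ| * (2 * |τ|) * (|dirichlet M τ| * (2 * |τ|)) ≤ 1 :=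
        mul_le_one₀ h1 (by positivity) h2
      have h4 : ((γ * m) • reduce (t l - t j)) i = γ * m * τ := rfl
      rw [h4, div_mul_div_comm, div_mul_eq_mul_div, div_le_one (by positivity), mul_pow,
        ← sq_abs τ]
      have h5 : |dirichlet K τ| * |dirichlet M τ| * |τ| ^ 2 * (γ * m) ^ 2
          ≤ |dirichlet K τ| * |dirichlet M τ| * |τ| ^ 2 * (4 * (2 * K + 1) * (2 * M + 1)) := by
        gcongr
      nlinarith
  have hmain := abs_sum_sum_sub_le c a hdiag hsymm hrow
  rw [sum_sum_norm_sq_expo]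
  simp only [hfac]
  have e : ∑ j, ∑ l, ((starRingEnd ℂ) (c j) * c l).re * (cubeSize d K * cubeSize d M * a j l)
      = cubeSize d K * cubeSize d M *
        ∑ j, ∑ l, ((starRingEnd ℂ) (c j) * c l).re * a j l := by
    simp only [Finset.mul_sum]
    refine Finset.sum_congr rfl fun j _ => Finset.sum_congr rfl fun l _ => by ring
  have hpos : 0 < cubeSize d K * cubeSize d M := mul_pos (cubeSize_pos _ _) (cubeSize_pos _ _)
  rw [e, ← mul_sub, abs_mul, abs_of_pos hpos]
  exact mul_le_mul_of_nonneg_left hmain hpos.le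

lemma norm_sq_sum_smul_steering {d m : ℕ} {ι : Type*} [Fintype ι] (t : ι → Freq d) (c : ι → ℂ) :
    cubeSize d m * ‖∑ j, c j • steering m (t j)‖ ^ 2
      = ∑ x ∈ cube d m, ‖∑ j, c j * expo (t j) x‖ ^ 2 := by
  rw [norm_sq_sampleSpace, ← Finset.sum_coe_sort (cube d m), Finset.mul_sum]
  refine Finset.sum_congr rfl fun x _ => ?_
  have h : (∑ j, c j • steering m (t j)) x
      = ((1 / √(cubeSize d m) : ℝ) : ℂ) * ∑ j, c j * expo (t j) x := by
    rw [WithLp.ofLp_sum, Finset.sum_apply, Finset.mul_sum]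
    refine Finset.sum_congr rfl fun j _ => ?_
    rw [PiLp.smul_apply, steering_apply, smul_eq_mul]; ring
  have hpos := cubeSize_pos d m
  rw [h, norm_mul, Complex.norm_real, Real.norm_eq_abs, mul_pow, sq_abs, div_pow, one_pow,
    Real.sq_sqrt hpos.le]
  field_simp

lemma sum_le_sum_translate {d m M : ℕ} (f : (Fin d → ℤ) → ℝ) (hf : ∀ x, 0 ≤ f x) {k : Fin d → ℤ}
    {K : ℕ} (hk : k ∈ cube d K) (hM : m + K ≤ M) :
    ∑ x ∈ cube d m, f x ≤ ∑ x ∈ cube d M, f (x + k) := by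
  rw [← Finset.sum_image (s := cube d M) (g := fun x => x + k) (f := f)
    (fun x _ y _ h => add_right_cancel h)]
  refine Finset.sum_le_sum_of_subset_of_nonneg (fun x hx => ?_) fun x _ _ => hf x
  refine Finset.mem_image.2 ⟨x - k, ?_, sub_add_cancel x k⟩
  rw [mem_cube] at *
  intro i
  have h1 := hk i
  have h2 := hx i
  rw [Pi.sub_apply]
  omega

lemma sum_translate_le_sum {d m M : ℕ} (f : (Fin d → ℤ) → ℝ) (hf : ∀ x, 0 ≤ f x) {k : Fin d → ℤ}
    {K : ℕ} (hk : k ∈ cube d K) (hM : M + K ≤ m) :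
    ∑ x ∈ cube d M, f (x + k) ≤ ∑ x ∈ cube d m, f x := by
  rw [← Finset.sum_image (s := cube d M) (g := fun x => x + k) (f := f)
    (fun x _ y _ h => add_right_cancel h)]
  refine Finset.sum_le_sum_of_subset_of_nonneg (fun x hx => ?_) fun x _ _ => hf x
  obtain ⟨y, hy, rfl⟩ := Finset.mem_image.1 hx
  rw [mem_cube] at *
  intro i
  have h1 := hk i
  have h2 := hy i
  rw [Pi.add_apply]
  omega

/-- Steering vectors at sufficiently separated frequencies are almost orthonormal, whatever their
number. The sums over the cube are compared from above and from below with averages over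
translations of slightly larger and slightly smaller cubes, for which the Gram matrix has summable
rows. -/
theorem exists_abs_norm_sq_sum_steering_sub_le (d : ℕ) {δ : ℝ} (hδ : 0 < δ) (hδ1 : δ ≤ 1) :
    ∃ B : ℝ, 0 < B ∧ ∀ (m : ℕ), 1 ≤ m → ∀ {ι : Type} [Fintype ι] (t : ι → Freq d),
      (∀ j k, j ≠ k → B / m ≤ torusDist (t j) (t k)) → ∀ c : ι → ℂ,
      |‖∑ j, c j • steering m (t j)‖ ^ 2 - ∑ j, ‖c j‖ ^ 2| ≤ δ * ∑ j, ‖c j‖ ^ 2 := by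
  obtain ⟨k₀, hk₀, hup, hlow⟩ : ∃ k₀ : ℕ, 2 ≤ k₀ ∧ (1 + 1 / (k₀ : ℝ)) ^ d ≤ 1 + δ / 2 ∧
      1 - δ / 2 ≤ (1 - 1 / (k₀ : ℝ)) ^ d := by
    have h0 : Filter.Tendsto (fun k : ℕ => 1 / (k : ℝ)) Filter.atTop (nhds 0) :=
      tendsto_one_div_atTop_nhds_zero_nat
    have h1 : Filter.Tendsto (fun k : ℕ => (1 + 1 / (k : ℝ)) ^ d) Filter.atTop (nhds 1) := by
      simpa using (h0.const_add 1).pow d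
    have h2 : Filter.Tendsto (fun k : ℕ => (1 - 1 / (k : ℝ)) ^ d) Filter.atTop (nhds 1) := by
      simpa using (h0.const_sub 1).pow d
    have h3 := (h1.eventually_le_const (by linarith : (1 : ℝ) < 1 + δ / 2)).and
      ((h2.eventually_const_le (by linarith : 1 - δ / 2 < (1 : ℝ))).and
        (Filter.eventually_ge_atTop 2))
    obtain ⟨k, ha, hb, hc⟩ := h3.exists
    exact ⟨k, hc, ha, hb⟩
  have hk0 : (0 : ℝ) < k₀ := by exact_mod_cast (by omega : 0 < k₀)
  obtain ⟨B, hB, hform⟩ := exists_abs_sum_sum_norm_sq_sub_le d (ε := δ / 4) (γ := 1 / k₀)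
    (by positivity) (by positivity)
  refine ⟨B, hB, fun m hm ι _ t hsep c => ?_⟩
  have hm0 : (0 : ℝ) < m := by exact_mod_cast hm
  -- averaging over translations of size `K`, about `m / k₀`, changes the cubes by a small factor
  set K := m / k₀ with hK
  have hK1 : (K : ℝ) ≤ m / k₀ := Nat.cast_div_le
  have hK2 : (m : ℝ) / k₀ ≤ 2 * K + 1 := by
    have h : m < (K + 1) * k₀ := Nat.lt_mul_of_div_lt (Nat.lt_succ_self _) (by omega)
    have h' : (m : ℝ) < (K + 1) * k₀ := by exact_mod_cast h
    rw [div_le_iff₀ hk0]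
    nlinarith [(Nat.cast_nonneg K : (0 : ℝ) ≤ K)]
  have hKm : 2 * K ≤ m := (Nat.mul_le_mul_right K hk₀).trans (Nat.mul_div_le m k₀)
  have hk2 : (2 : ℝ) ≤ k₀ := by exact_mod_cast hk₀
  have hγ : ∀ M : ℕ, (m : ℝ) ≤ 2 * M + 1 →
      (1 / (k₀ : ℝ) * m) ^ 2 ≤ 4 * (2 * K + 1) * (2 * M + 1) := fun M hM => by
    have h1 : 1 / (k₀ : ℝ) * m = m / k₀ := by ring
    have h2 : (m : ℝ) / k₀ ≤ m := div_le_self hm0.le (by linarith)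
    rw [h1, sq]
    calc (m : ℝ) / k₀ * (m / k₀) ≤ (2 * K + 1) * (2 * M + 1) :=
          mul_le_mul hK2 (h2.trans hM) (by positivity) (by positivity)
      _ ≤ 4 * (2 * K + 1) * (2 * M + 1) := by
          have : (0 : ℝ) ≤ (2 * K + 1) * (2 * M + 1) := by positivity
          linarith
  set C := ∑ j, ‖c j‖ ^ 2 with hC
  have hC0 : 0 ≤ C := Finset.sum_nonneg fun j _ => by positivity
  have hNK := cubeSize_pos d K
  have hNm := cubeSize_pos d m
  set f : (Fin d → ℤ) → ℝ := fun x => ‖∑ j, c j * expo (t j) x‖ ^ 2 with hf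
  have hf0 : ∀ x, 0 ≤ f x := fun x => by positivity
  have hnorm : cubeSize d m * ‖∑ j, c j • steering m (t j)‖ ^ 2 = ∑ x ∈ cube d m, f x :=
    norm_sq_sum_smul_steering t c
  set X := ‖∑ j, c j • steering m (t j)‖ ^ 2 with hX
  have hconst : ∀ y : ℝ, ∑ _k ∈ cube d K, y = cubeSize d K * y := fun y => by
    rw [Finset.sum_const, nsmul_eq_mul, card_cube_eq]
  rw [abs_le]
  constructor
  · -- lower bound: smaller cubes, whose translates stay inside
    have hM : ((m - K : ℕ) : ℝ) = m - K := by
      rw [Nat.cast_sub (by omega)]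
    have h1 := (abs_le.1 (hform m K (m - K) hm (hγ _ (by
      rw [hM]; have : (2 : ℝ) * K ≤ m := by exact_mod_cast hKm
      linarith)) t hsep c)).1
    have h2 : ∑ k ∈ cube d K, ∑ x ∈ cube d (m - K), f (x + k)
        ≤ cubeSize d K * (cubeSize d m * X) := by
      rw [hnorm, ← hconst]
      exact Finset.sum_le_sum fun k hk => sum_translate_le_sum f hf0 hk (by omega)
    have h3 : (1 - δ / 2) * cubeSize d m ≤ cubeSize d (m - K) := by
      refine (mul_le_mul_of_nonneg_right hlow hNm.le).trans ?_
      rw [cubeSize, cubeSize, ← mul_pow, hM]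
      refine pow_le_pow_left₀ (mul_nonneg ?_ (by positivity)) ?_ d
      · rw [sub_nonneg, div_le_one hk0]; linarith
      · have : (1 : ℝ) / k₀ * (2 * m + 1) ≥ 2 * (m / k₀) := by
          rw [ge_iff_le, one_div, mul_comm, div_eq_mul_inv]
          nlinarith [inv_pos.2 hk0]
        nlinarith
    have h4 : cubeSize d (m - K) * ((1 - δ / 4) * C) ≤ cubeSize d m * X := by
      refine le_of_mul_le_mul_left (le_trans ?_ h2) hNK
      nlinarith [h1]
    have h5 : cubeSize d m * ((1 - δ / 2) * ((1 - δ / 4) * C)) ≤ cubeSize d m * X := by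
      refine le_trans ?_ h4
      rw [← mul_assoc, mul_comm (cubeSize d m)]
      exact mul_le_mul_of_nonneg_right h3 (mul_nonneg (by linarith) hC0)
    have h6 := le_of_mul_le_mul_left h5 hNm
    nlinarith [mul_nonneg (sq_nonneg δ) hC0, mul_nonneg hδ.le hC0]
  · -- upper bound: larger cubes, whose translates cover the given one
    have h1 := (abs_le.1 (hform m K (m + K) hm (hγ _ (by
      push_cast; nlinarith [(Nat.cast_nonneg K : (0 : ℝ) ≤ K)])) t hsep c)).2
    have h2 : cubeSize d K * (cubeSize d m * X)
        ≤ ∑ k ∈ cube d K, ∑ x ∈ cube d (m + K), f (x + k) := by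
      rw [hnorm, ← hconst]
      exact Finset.sum_le_sum fun k hk => sum_le_sum_translate f hf0 hk le_rfl
    have h3 : cubeSize d (m + K) ≤ (1 + δ / 2) * cubeSize d m := by
      refine le_trans ?_ (mul_le_mul_of_nonneg_right hup hNm.le)
      rw [cubeSize, cubeSize, ← mul_pow]
      refine pow_le_pow_left₀ (by positivity) ?_ d
      have : (1 : ℝ) / k₀ * (2 * m + 1) ≥ 2 * (m / k₀) := by
        rw [ge_iff_le, one_div, mul_comm, div_eq_mul_inv]
        nlinarith [inv_pos.2 hk0]
      push_cast
      nlinarith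
    have h4 : cubeSize d m * X ≤ cubeSize d (m + K) * ((1 + δ / 4) * C) := by
      refine le_of_mul_le_mul_left (h2.trans ?_) hNK
      nlinarith [h1]
    have h5 : cubeSize d m * X ≤ cubeSize d m * ((1 + δ / 2) * ((1 + δ / 4) * C)) := by
      refine h4.trans ?_
      rw [← mul_assoc (cubeSize d m), mul_comm (cubeSize d m)]
      exact mul_le_mul_of_nonneg_right h3 (mul_nonneg (by linarith) hC0)
    have h6 := le_of_mul_le_mul_left h5 hNm
    nlinarith [mul_nonneg (mul_nonneg hδ.le (by linarith : (0 : ℝ) ≤ 1 - δ)) hC0]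

/-! ### Perturbation of the leading singular space -/

section Perturbation

variable {V : Type*} [NormedAddCommGroup V] [InnerProductSpace ℂ V] [FiniteDimensional ℂ V]

/-- The quadratic form of `T^* T` in an orthonormal basis of its eigenvectors. -/
lemma norm_sq_map_eq_sum (T : V →ₗ[ℂ] V) (v : V) :
    ‖T v‖ ^ 2 = ∑ i : Fin (Module.finrank ℂ V), T.singularValues i ^ 2 *
      ‖inner ℂ (T.isSymmetric_adjoint_comp_self.eigenvectorBasis rfl i) v‖ ^ 2 := by
  set hS := T.isSymmetric_adjoint_comp_self
  set e := hS.eigenvectorBasis rfl with he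
  have h1 : (inner ℂ v ((LinearMap.adjoint T ∘ₗ T) v) : ℂ)
      = ∑ i : Fin (Module.finrank ℂ V), ((T.singularValues i ^ 2 * ‖inner ℂ (e i) v‖ ^ 2 : ℝ) : ℂ) := by
    rw [← e.sum_inner_mul_inner]
    refine Finset.sum_congr rfl fun i _ => ?_
    rw [← hS (e i) v, he, hS.apply_eigenvectorBasis, inner_smul_left, ← he, RCLike.conj_ofReal,
      T.sq_singularValues_fin rfl i, ← inner_conj_symm v (e i)]
    push_cast
    rw [← Complex.conj_mul']
    simp only [Complex.coe_algebraMap]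
    ring
  rw [LinearMap.comp_apply, LinearMap.adjoint_inner_right] at h1
  have h2 := congrArg Complex.re h1
  rw [← Complex.ofReal_sum, Complex.ofReal_re] at h2
  rw [← h2]
  exact (inner_self_eq_norm_sq (𝕜 := ℂ) (T v)).symm

lemma norm_sq_eq_sum_inner (T : V →ₗ[ℂ] V) (v : V) :
    ‖v‖ ^ 2 = ∑ i, ‖inner ℂ (T.isSymmetric_adjoint_comp_self.eigenvectorBasis rfl i) v‖ ^ 2 :=
  ((T.isSymmetric_adjoint_comp_self.eigenvectorBasis rfl).sum_sq_norm_inner_right v).symm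

/-- The lower half of the Courant–Fischer principle for singular values. -/
lemma le_singularValues_of_le_norm (T : V →ₗ[ℂ] V) (U : Submodule ℂ V) {A : ℝ} (hA : 0 ≤ A)
    (hU : ∀ u ∈ U, A * ‖u‖ ≤ ‖T u‖) {k : ℕ} (hk : k < Module.finrank ℂ U) :
    A ≤ T.singularValues k := by
  have hkn : k < Module.finrank ℂ V := hk.trans_le (Submodule.finrank_le U)
  set e := T.isSymmetric_adjoint_comp_self.eigenvectorBasis rfl with he
  let L : U →ₗ[ℂ] (Fin k → ℂ) :=
    LinearMap.pi fun i => (innerₛₗ ℂ (e ⟨i, i.2.trans hkn⟩)).comp U.subtype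
  have hker : LinearMap.ker L ≠ ⊥ := LinearMap.ker_ne_bot_of_finrank_lt (by simpa using hk)
  obtain ⟨u, hu, hu0⟩ := Submodule.exists_mem_ne_zero_of_ne_bot hker
  have hzero : ∀ i : Fin (Module.finrank ℂ V), (i : ℕ) < k → inner ℂ (e i) (u : V) = 0 := by
    intro i hi
    exact congrFun (LinearMap.mem_ker.1 hu) ⟨i, hi⟩
  have hupos : 0 < ‖(u : V)‖ := norm_pos_iff.2 (by simpa using hu0)
  have h1 : ‖T u‖ ^ 2 ≤ T.singularValues k ^ 2 * ‖(u : V)‖ ^ 2 := by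
    rw [norm_sq_map_eq_sum, norm_sq_eq_sum_inner T (u : V), Finset.mul_sum]
    refine Finset.sum_le_sum fun i _ => ?_
    rcases lt_or_ge (i : ℕ) k with h | h
    · rw [← he, hzero i h]; simp
    · have := T.singularValues_antitone h
      have := T.singularValues_nonneg i
      gcongr
  have h2 := hU u u.2
  have h3 : (A * ‖(u : V)‖) ^ 2 ≤ (T.singularValues k * ‖(u : V)‖) ^ 2 := by
    rw [mul_pow (T.singularValues k)]
    exact (pow_le_pow_left₀ (by positivity) h2 2).trans h1
  have h4 := le_of_sq_le_sq h3 (mul_nonneg (T.singularValues_nonneg k) hupos.le)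
  exact le_of_mul_le_mul_right h4 hupos

/-- The upper half of the Courant–Fischer principle for singular values. -/
lemma singularValues_le_of_norm_le (T : V →ₗ[ℂ] V) (U : Submodule ℂ V) {B : ℝ} (hB : 0 ≤ B)
    (hU : ∀ v ∈ Uᗮ, ‖T v‖ ≤ B * ‖v‖) {k : ℕ} (hk : Module.finrank ℂ U ≤ k) :
    T.singularValues k ≤ B := by
  refine (T.singularValues_antitone hk).trans ?_
  set s := Module.finrank ℂ U with hs
  rcases le_or_gt (Module.finrank ℂ V) s with hsn | hsn
  · rw [T.singularValues_of_finrank_le hsn]; exact hB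
  set e := T.isSymmetric_adjoint_comp_self.eigenvectorBasis rfl with he
  let F : (Fin (s + 1) → ℂ) →ₗ[ℂ] V :=
    Fintype.linearCombination ℂ fun i => e (Fin.castLE hsn i)
  let L : (Fin (s + 1) → ℂ) →ₗ[ℂ] U := U.orthogonalProjectionOnto.toLinearMap.comp F
  have hker : LinearMap.ker L ≠ ⊥ :=
    LinearMap.ker_ne_bot_of_finrank_lt (by simp [← hs])
  obtain ⟨c, hc, hc0⟩ := Submodule.exists_mem_ne_zero_of_ne_bot hker
  set v := F c with hv
  have hvU : v ∈ Uᗮ := Submodule.orthogonalProjectionOnto_eq_zero_iff.1 (LinearMap.mem_ker.1 hc)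
  have hinj : LinearIndependent ℂ fun i => e (Fin.castLE hsn i) :=
    e.orthonormal.linearIndependent.comp _ (Fin.castLE_injective hsn)
  have hv0 : 0 < ‖v‖ := by
    rw [norm_pos_iff]
    intro h
    exact hc0 (funext (Fintype.linearIndependent_iff.1 hinj c h))
  have hzero : ∀ i : Fin (Module.finrank ℂ V), s < (i : ℕ) → inner ℂ (e i) v = 0 := by
    intro i hi
    rw [hv, Fintype.linearCombination_apply, inner_sum]
    refine Finset.sum_eq_zero fun j _ => ?_
    rw [inner_smul_right, e.orthonormal.2, mul_zero]
    intro h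
    have := congrArg Fin.val h
    rw [Fin.val_castLE] at this
    omega
  have h1 : T.singularValues s ^ 2 * ‖v‖ ^ 2 ≤ ‖T v‖ ^ 2 := by
    rw [norm_sq_map_eq_sum, norm_sq_eq_sum_inner T v, Finset.mul_sum]
    refine Finset.sum_le_sum fun i _ => ?_
    rcases lt_or_ge s (i : ℕ) with h | h
    · rw [← he, hzero i h]; simp
    · have := T.singularValues_antitone h
      have := T.singularValues_nonneg s
      gcongr
  have h2 : (T.singularValues s * ‖v‖) ^ 2 ≤ (B * ‖v‖) ^ 2 := by
    rw [mul_pow]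
    exact h1.trans (pow_le_pow_left₀ (norm_nonneg _) (hU v hvU) 2)
  exact le_of_mul_le_mul_right (le_of_sq_le_sq h2 (by positivity)) hv0

/-- A nonzero eigenvalue of `T T^*` is the square of a singular value of `T`. -/
lemma exists_sq_singularValues_eq (T : V →ₗ[ℂ] V) {μ : ℝ} (hμ : μ ≠ 0) {v : V} (hv : v ≠ 0)
    (h : (T ∘ₗ LinearMap.adjoint T) v = (μ : ℂ) • v) : ∃ k, T.singularValues k ^ 2 = μ := by
  have hμ' : (μ : ℂ) ≠ 0 := by exact_mod_cast hμ
  have hne : LinearMap.adjoint T v ≠ 0 := fun h0 => by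
    rw [LinearMap.comp_apply, h0, map_zero] at h
    exact hv ((smul_eq_zero.1 h.symm).resolve_left hμ')
  have hev : Module.End.HasEigenvalue (LinearMap.adjoint T ∘ₗ T) (μ : ℂ) := by
    refine Module.End.hasEigenvalue_of_hasEigenvector (x := LinearMap.adjoint T v)
      (Module.End.hasEigenvector_iff.2 ⟨Module.End.mem_eigenspace_iff.2 ?_, hne⟩)
    rw [LinearMap.comp_apply, ← LinearMap.comp_apply T, h, map_smul]
  obtain ⟨i, hi⟩ := T.isSymmetric_adjoint_comp_self.exists_eigenvalues_eq rfl hev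
  refine ⟨i, ?_⟩
  rw [T.sq_singularValues_fin rfl i]
  exact Complex.ofReal_injective hi

end Perturbation

/-- If `H` and `H^*` are bounded below by `A` on `s`-dimensional spaces and bounded above by `B < A`
on their orthogonal complements, then the leading left singular space is well defined, and `H^*` is
bounded in the same way on it and on its complement. -/
theorem leadingSpace_of_gap {d m s : ℕ} (hs : 1 ≤ s) (H : SampleSpace d m →ₗ[ℂ] SampleSpace d m)
    (Ul Ur : Submodule ℂ (SampleSpace d m)) (hUl : Module.finrank ℂ Ul = s)
    (hUr : Module.finrank ℂ Ur = s) {A B : ℝ} (hB : 0 ≤ B) (hAB : B < A)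
    (hl : ∀ u ∈ Ul, A * ‖u‖ ≤ ‖LinearMap.adjoint H u‖)
    (hl' : ∀ v ∈ Ulᗮ, ‖LinearMap.adjoint H v‖ ≤ B * ‖v‖)
    (hr : ∀ u ∈ Ur, A * ‖u‖ ≤ ‖H u‖) (hr' : ∀ v ∈ Urᗮ, ‖H v‖ ≤ B * ‖v‖) :
    LeadingSpaceWellDefined H s ∧
    (∀ v ∈ (leadingLeftSingularSpace H s)ᗮ, ‖LinearMap.adjoint H v‖ ≤ B * ‖v‖) ∧
    ∀ v, A * ‖(leadingLeftSingularSpace H s).starProjection v‖ ≤ ‖LinearMap.adjoint H v‖ := by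
  have hA : 0 ≤ A := hB.trans hAB.le
  set W := leadingLeftSingularSpace H s with hW
  set T := LinearMap.adjoint H with hT
  have hN : LinearMap.adjoint T ∘ₗ T = H ∘ₗ LinearMap.adjoint H := by
    rw [hT, LinearMap.adjoint_adjoint]
  set f := T.isSymmetric_adjoint_comp_self.eigenvectorBasis rfl with hf
  have hfapply : ∀ i, (H ∘ₗ LinearMap.adjoint H) (f i)
      = ((T.singularValues i ^ 2 : ℝ) : ℂ) • f i := fun i => by
    rw [← hN, hf, T.isSymmetric_adjoint_comp_self.apply_eigenvectorBasis,
      T.sq_singularValues_fin rfl i]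
    rfl
  have hsig : ∀ k, 1 ≤ k → k ≤ s → A ≤ sigma H k := fun k hk1 hks =>
    le_singularValues_of_le_norm H Ur hA hr (by omega)
  have hsig' : ∀ k, s ≤ k → H.singularValues k ≤ B := fun k hk =>
    singularValues_le_of_norm_le H Ur hB hr' (by omega)
  have hTl : ∀ k, k < s → A ≤ T.singularValues k := fun k hk =>
    le_singularValues_of_le_norm T Ul hA hl (by omega)
  have hTl' : ∀ k, s ≤ k → T.singularValues k ≤ B := fun k hk =>
    singularValues_le_of_norm_le T Ul hB hl' (by omega)
  have hfW : ∀ i : Fin (Module.finrank ℂ (SampleSpace d m)), (i : ℕ) < s → f i ∈ W := by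
    intro i hi
    have hpos : 0 < T.singularValues i := (hB.trans_lt hAB).trans_le (hTl i hi)
    obtain ⟨k, hk⟩ := exists_sq_singularValues_eq H (pow_ne_zero 2 hpos.ne')
      (f.orthonormal.ne_zero i) (hfapply i)
    have hks : k < s := by
      by_contra hcon
      have h1 := hsig' k (by omega)
      have h2 := hTl i hi
      have h3 := H.singularValues_nonneg k
      nlinarith
    refine Submodule.mem_iSup_of_mem (k + 1) (Submodule.mem_iSup_of_mem
      (Finset.mem_Icc.2 ⟨by omega, by omega⟩) ?_)
    rw [Module.End.mem_eigenspace_iff, hfapply, sigma, Nat.add_sub_cancel, hk]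
  have hWf : ∀ w ∈ W, ∀ i : Fin (Module.finrank ℂ (SampleSpace d m)), s ≤ (i : ℕ) →
      inner ℂ (f i) w = 0 := by
    intro w hw i hi
    have hle : W ≤ LinearMap.ker (innerₛₗ ℂ (f i)) := by
      refine iSup₂_le fun k hk w hw => ?_
      rw [Finset.mem_Icc] at hk
      rw [Module.End.mem_eigenspace_iff] at hw
      have h1 : inner ℂ ((LinearMap.adjoint T ∘ₗ T) (f i)) w
          = inner ℂ (f i) ((LinearMap.adjoint T ∘ₗ T) w) :=
        T.isSymmetric_adjoint_comp_self (f i) w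
      rw [hN, hw, hfapply, inner_smul_left, inner_smul_right, Complex.conj_ofReal] at h1
      have h2 : ((T.singularValues i ^ 2 : ℝ) : ℂ) ≠ ((sigma H k ^ 2 : ℝ) : ℂ) := by
        intro h
        have h3 : T.singularValues i ^ 2 = sigma H k ^ 2 := by exact_mod_cast h
        have h4 := hTl' i hi
        have h5 := hsig k hk.1 hk.2
        have h6 := T.singularValues_nonneg i
        nlinarith
      rw [LinearMap.mem_ker]
      by_contra hne
      exact h2 (mul_right_cancel₀ hne h1)
    exact LinearMap.mem_ker.1 (hle hw)
  have hsn : s ≤ Module.finrank ℂ (SampleSpace d m) := hUl ▸ Submodule.finrank_le Ul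
  have hWspan : W = Submodule.span ℂ (Set.range fun i : Fin s => f (Fin.castLE hsn i)) := by
    refine le_antisymm (fun w hw => ?_) (Submodule.span_le.2 ?_)
    · rw [← f.sum_repr' w]
      refine Submodule.sum_mem _ fun i _ => ?_
      rcases lt_or_ge (i : ℕ) s with h | h
      · exact Submodule.smul_mem _ _ (Submodule.subset_span ⟨⟨i, h⟩, rfl⟩)
      · rw [hWf w hw i h, zero_smul]; exact Submodule.zero_mem _
    · rintro _ ⟨i, rfl⟩
      exact hfW _ i.2
  refine ⟨⟨?_, ?_⟩, fun v hv => ?_, fun v => ?_⟩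
  · have h1 := hsig' s le_rfl
    have h2 := hsig s hs le_rfl
    rw [sigma, Nat.add_sub_cancel]
    linarith
  · rw [← hW, hWspan, finrank_span_eq_card, Fintype.card_fin]
    exact f.orthonormal.linearIndependent.comp _ (Fin.castLE_injective hsn)
  · refine le_of_sq_le_sq ?_ (by positivity)
    rw [norm_sq_map_eq_sum, mul_pow, norm_sq_eq_sum_inner T v, Finset.mul_sum]
    refine Finset.sum_le_sum fun i _ => ?_
    rcases lt_or_ge (i : ℕ) s with h | h
    · rw [← hf, hv _ (hfW i h)]; simp
    · have := hTl' i h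
      have := T.singularValues_nonneg i
      gcongr
  · refine le_of_sq_le_sq ?_ (norm_nonneg _)
    rw [norm_sq_map_eq_sum, mul_pow, norm_sq_eq_sum_inner T (W.starProjection v), Finset.mul_sum]
    refine Finset.sum_le_sum fun i _ => ?_
    rcases lt_or_ge (i : ℕ) s with h | h
    · have h1 : inner ℂ (f i) (W.starProjection v) = inner ℂ (f i) v := by
        have h2 := Submodule.starProjection_inner_eq_zero v (f i) (hfW i h)
        rw [← sub_eq_zero, ← inner_sub_right, ← inner_conj_symm, ← neg_sub, inner_neg_left, h2]
        simp
      rw [← hf, h1]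
      have := hTl i h
      gcongr
    · rw [← hf, hWf _ (W.starProjection_apply_mem v) i h]
      simp only [norm_zero, ne_eq, OfNat.ofNat_ne_zero, not_false_eq_true, zero_pow, mul_zero]
      positivity

/-- Wedin's theorem in the form needed here: the projections onto the leading left singular spaces
of `H₀` and of `H` differ by a multiple of the norm of `H - H₀`. -/
lemma norm_inner_starProjection_sub_le {V : Type*} [NormedAddCommGroup V] [InnerProductSpace ℂ V]
    [FiniteDimensional ℂ V] (T T₀ : V →ₗ[ℂ] V) (U W : Submodule ℂ V) {A₀ A B : ℝ}
    (hA₀ : 0 < A₀) (hA : 0 < A) (hB : 0 ≤ B)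
    (hT₀ : ∀ u ∈ U, A₀ * ‖u‖ ≤ ‖T₀ u‖) (hT₀' : ∀ v ∈ Uᗮ, T₀ v = 0)
    (hTT₀ : ∀ v, ‖T v - T₀ v‖ ≤ B * ‖v‖)
    (hW : ∀ v ∈ Wᗮ, ‖T v‖ ≤ B * ‖v‖) (hW' : ∀ v, A * ‖W.starProjection v‖ ≤ ‖T v‖) (x y : V) :
    ‖inner ℂ x (U.starProjection y - W.starProjection y)‖ ≤ (2 * B / A₀ + B / A) * ‖x‖ * ‖y‖ := by
  have hdecomp : ∀ (K : Submodule ℂ V) (v : V), v - K.starProjection v ∈ Kᗮ := fun K v =>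
    K.sub_starProjection_mem_orthogonal v
  have hnorm : ∀ (K : Submodule ℂ V) (v : V), ‖v - K.starProjection v‖ ≤ ‖v‖ := fun K v => by
    rw [← Submodule.starProjection_orthogonal_val]
    exact Kᗮ.norm_starProjection_apply_le v
  have h1 : ∀ v ∈ Wᗮ, ‖U.starProjection v‖ ≤ 2 * B / A₀ * ‖v‖ := fun v hv => by
    have h2 : T₀ v = T₀ (U.starProjection v) := by
      rw [← sub_eq_zero, ← map_sub]; exact hT₀' _ (hdecomp U v)
    have h3 := hT₀ _ (U.starProjection_apply_mem v)
    have h4 : ‖T₀ v‖ ≤ ‖T v‖ + ‖T v - T₀ v‖ := by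
      calc ‖T₀ v‖ = ‖T v - (T v - T₀ v)‖ := by rw [sub_sub_cancel]
        _ ≤ _ := norm_sub_le _ _
    rw [div_mul_eq_mul_div, le_div_iff₀ hA₀]
    have h5 := hW v hv
    have h6 := hTT₀ v
    rw [← h2] at h3
    linarith
  have h2 : ∀ v ∈ Uᗮ, ‖W.starProjection v‖ ≤ B / A * ‖v‖ := fun v hv => by
    have h3 := hTT₀ v
    rw [hT₀' v hv, sub_zero] at h3
    rw [div_mul_eq_mul_div, le_div_iff₀ hA]
    linarith [hW' v]
  have hsymm : ∀ (K : Submodule ℂ V) (a b : V),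
      inner ℂ a (K.starProjection b) = inner ℂ (K.starProjection a) b := fun K a b =>
    (K.inner_starProjection_left_eq_right a b).symm
  have key : inner ℂ x (U.starProjection y - W.starProjection y)
      = inner ℂ x (U.starProjection (y - W.starProjection y))
        - inner ℂ (W.starProjection (x - U.starProjection x)) y := by
    rw [map_sub, map_sub, inner_sub_right, inner_sub_right, inner_sub_left, ← hsymm W x,
      ← hsymm W (U.starProjection x), ← hsymm U x]
    ring
  rw [key]
  calc _ ≤ ‖x‖ * ‖U.starProjection (y - W.starProjection y)‖
        + ‖W.starProjection (x - U.starProjection x)‖ * ‖y‖ :=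
        (norm_sub_le _ _).trans (add_le_add (norm_inner_le_norm _ _) (norm_inner_le_norm _ _))
    _ ≤ ‖x‖ * (2 * B / A₀ * ‖y‖) + B / A * ‖x‖ * ‖y‖ := by
        gcongr
        · exact (h1 _ (hdecomp W y)).trans (by gcongr; exact hnorm W y)
        · exact (h2 _ (hdecomp U x)).trans (by gcongr; exact hnorm U x)
    _ = _ := by ring

/-! ### The Dirichlet kernel near its peak -/

lemma sum_Icc_sq (m : ℕ) :
    ∑ k ∈ Finset.Icc (-(m : ℤ)) m, (k : ℝ) ^ 2 = (2 * m + 1) * (m * (m + 1) / 3) := by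
  induction m with
  | zero => simp
  | succ m ih => rw [sum_Icc_succ, ih]; push_cast; ring

/-- The curvature `4π² m(m+1)/3` of the normalized Dirichlet kernel at its peak. -/
noncomputable def curvature (m : ℕ) : ℝ := 4 * Real.pi ^ 2 * (m * (m + 1) / 3)

lemma pi_sq_gt : 9.869 < Real.pi ^ 2 := by nlinarith [Real.pi_gt_d4]

lemma pi_sq_lt : Real.pi ^ 2 < 9.87 := by nlinarith [Real.pi_lt_d4, Real.pi_pos]

lemma curvature_ge (m : ℕ) : 13 * (m : ℝ) ^ 2 ≤ curvature m := by
  have h : (0 : ℝ) ≤ m := Nat.cast_nonneg m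
  unfold curvature
  nlinarith [pi_sq_gt, mul_nonneg h h]

lemma curvature_le {m : ℕ} (hm : 1 ≤ m) : curvature m ≤ 8 * Real.pi ^ 2 / 3 * (m : ℝ) ^ 2 := by
  have h : (1 : ℝ) ≤ m := by exact_mod_cast hm
  unfold curvature
  have h1 : (m : ℝ) * (m + 1) ≤ 2 * (m : ℝ) ^ 2 := by nlinarith
  nlinarith [pi_sq_gt]

lemma one_sub_le_dirichlet (m : ℕ) (t : ℝ) :
    1 - curvature m * t ^ 2 / 2 ≤ dirichlet m t / (2 * m + 1) := by
  have hM : (0 : ℝ) < 2 * m + 1 := by positivity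
  rw [le_div_iff₀ hM]
  have h1 : ∑ k ∈ Finset.Icc (-(m : ℤ)) m, (1 - 2 * Real.pi ^ 2 * t ^ 2 * (k : ℝ) ^ 2)
      ≤ dirichlet m t := by
    refine Finset.sum_le_sum fun k _ => ?_
    refine le_trans (le_of_eq ?_) Real.one_sub_sq_div_two_le_cos
    ring
  rw [Finset.sum_sub_distrib, ← Finset.mul_sum, sum_Icc_sq] at h1
  have h2 : ∑ k ∈ Finset.Icc (-(m : ℤ)) m, (1 : ℝ) = 2 * m + 1 := by
    have := dirichlet_zero m
    simpa [dirichlet] using this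
  rw [h2] at h1
  refine le_trans (le_of_eq ?_) h1
  rw [curvature]; ring

lemma dirichlet_div_le_one (m : ℕ) (t : ℝ) : dirichlet m t / (2 * m + 1) ≤ 1 :=
  (div_le_one (by positivity)).2 ((le_abs_self _).trans (abs_dirichlet_le m t))

/-- Away from integers the normalized Dirichlet kernel is bounded away from `1`, quantitatively. -/
lemma abs_dirichlet_div_le {m : ℕ} (hm : 1 ≤ m) {t : ℝ} (ht : |t| ≤ 1 / 2) :
    |dirichlet m t / (2 * m + 1)| ≤ 1 - min 1 (((2 * m + 1) * t) ^ 2) / 2 := by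
  have hM : (0 : ℝ) < 2 * m + 1 := by positivity
  have hm1 : (1 : ℝ) ≤ m := by exact_mod_cast hm
  rw [abs_div, abs_of_pos hM]
  have hy : ((2 * (m : ℝ) + 1) * t) ^ 2 = ((2 * m + 1) * |t|) ^ 2 := by
    rw [mul_pow, mul_pow, sq_abs]
  rw [hy]
  set y := (2 * (m : ℝ) + 1) * |t| with hydef
  rcases le_or_gt 1 y with h | h
  · rw [min_eq_left (one_le_pow₀ h), div_le_iff₀ hM]
    have h1 := abs_dirichlet_mul_le m ht
    nlinarith [abs_nonneg (dirichlet m t)]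
  · have hy0 : 0 ≤ y := by positivity
    rw [min_eq_right (pow_le_one₀ hy0 h.le)]
    have hnonneg : 0 ≤ dirichlet m t := by
      have habs : dirichlet m t = dirichlet m |t| := by
        rcases abs_choice t with h0 | h0 <;> rw [h0]
        rw [dirichlet_neg]
      rcases eq_or_ne t 0 with h0 | h0
      · rw [h0, dirichlet_zero]; positivity
      · have h1 := dirichlet_mul_sin m |t|
        have h2 : 0 < Real.sin (Real.pi * |t|) := by
          have := abs_pos.2 h0
          refine Real.sin_pos_of_pos_of_lt_pi (by positivity) ?_
          nlinarith [Real.pi_pos]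
        have h3 : 0 ≤ Real.sin ((2 * m + 1) * (Real.pi * |t|)) := by
          refine Real.sin_nonneg_of_nonneg_of_le_pi (by positivity) ?_
          have : (2 * (m : ℝ) + 1) * (Real.pi * |t|) = Real.pi * y := by rw [hydef]; ring
          nlinarith [Real.pi_pos]
        rw [habs]
        by_contra hneg
        push Not at hneg
        nlinarith
    rw [abs_of_nonneg hnonneg, div_le_iff₀ hM]
    have h1 : dirichlet m t ≤ ∑ k ∈ Finset.Icc (-(m : ℤ)) m, (1 - 8 * t ^ 2 * (k : ℝ) ^ 2) := by
      refine Finset.sum_le_sum fun k hk => ?_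
      have hk' : |(k : ℝ)| ≤ m := by
        rw [Finset.mem_Icc] at hk
        rw [abs_le]
        exact ⟨by exact_mod_cast hk.1, by exact_mod_cast hk.2⟩
      have habs : |2 * Real.pi * (t * k)| ≤ Real.pi := by
        rw [abs_mul, abs_of_pos (by positivity : 0 < 2 * Real.pi), abs_mul]
        have : |t| * |(k : ℝ)| ≤ 1 / 2 := by
          have := mul_le_mul_of_nonneg_left hk' (abs_nonneg t)
          nlinarith [abs_nonneg t]
        nlinarith [Real.pi_pos]
      refine (Real.cos_le_one_sub_mul_cos_sq habs).trans (le_of_eq ?_)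
      have := Real.pi_pos.ne'
      field_simp
      ring
    rw [Finset.sum_sub_distrib, ← Finset.mul_sum, sum_Icc_sq] at h1
    have h2 : ∑ k ∈ Finset.Icc (-(m : ℤ)) m, (1 : ℝ) = 2 * m + 1 := by
      have := dirichlet_zero m
      simpa [dirichlet] using this
    rw [h2] at h1
    refine h1.trans ?_
    have h3 : y ^ 2 = (2 * m + 1) ^ 2 * t ^ 2 := by rw [hydef, mul_pow, sq_abs]
    rw [h3]
    have h4 : (2 * (m : ℝ) + 1) ^ 2 / 2 ≤ 8 / 3 * (m * (m + 1)) := by nlinarith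
    have h5 := mul_le_mul_of_nonneg_right h4 (mul_nonneg hM.le (sq_nonneg t))
    nlinarith

lemma hasDerivAt_dirichlet (m : ℕ) (t : ℝ) : HasDerivAt (dirichlet m)
    (-∑ k ∈ Finset.Icc (-(m : ℤ)) m, 2 * Real.pi * k * Real.sin (2 * Real.pi * (t * k))) t := by
  unfold dirichlet
  rw [← Finset.sum_neg_distrib]
  refine HasDerivAt.fun_sum fun k _ => ?_
  have h := ((((hasDerivAt_id t).mul_const (k : ℝ)).const_mul (2 * Real.pi))).cos
  refine h.congr_deriv ?_
  simp only [id_eq]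
  ring

/-- Near its peak the derivative of the normalized Dirichlet kernel is `-b t`, where `b` is close
to the curvature. -/
lemma exists_deriv_dirichlet {m : ℕ} (hm : 1 ≤ m) {t : ℝ} (ht : |t| ≤ 1 / (20 * m)) :
    ∃ b : ℝ, 0.98 * curvature m ≤ b ∧ b ≤ curvature m ∧
      HasDerivAt (fun t => dirichlet m t / (2 * m + 1)) (-(b * t)) t := by
  have hM : (0 : ℝ) < 2 * m + 1 := by positivity
  have hm0 : (0 : ℝ) < m := by exact_mod_cast hm
  set b : ℝ := (∑ k ∈ Finset.Icc (-(m : ℤ)) m,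
    (2 * Real.pi * k) ^ 2 * Real.sinc (2 * Real.pi * (t * k))) / (2 * m + 1) with hb
  have hsum : ∑ k ∈ Finset.Icc (-(m : ℤ)) m, (2 * Real.pi * (k : ℝ)) ^ 2
      = curvature m * (2 * m + 1) := by
    simp only [mul_pow]
    rw [← Finset.mul_sum, sum_Icc_sq, curvature]; ring
  have hle : b ≤ curvature m := by
    rw [hb, div_le_iff₀ hM, ← hsum]
    exact Finset.sum_le_sum fun k _ =>
      mul_le_of_le_one_right (sq_nonneg _) (Real.sinc_le_one _)
  have hge : 0.98 * curvature m ≤ b := by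
    rw [hb, le_div_iff₀ hM, mul_assoc, ← hsum, Finset.mul_sum]
    refine Finset.sum_le_sum fun k hk => ?_
    rw [mul_comm]
    refine mul_le_mul_of_nonneg_left ?_ (sq_nonneg _)
    set z := 2 * Real.pi * (t * k) with hz
    have hz1 : |z| ≤ Real.pi / 10 := by
      have hk' : |(k : ℝ)| ≤ m := by
        rw [Finset.mem_Icc] at hk
        rw [abs_le]
        exact ⟨by exact_mod_cast hk.1, by exact_mod_cast hk.2⟩
      rw [hz, abs_mul, abs_of_pos (by positivity : 0 < 2 * Real.pi), abs_mul]
      have : |t| * |(k : ℝ)| ≤ 1 / (20 * m) * m :=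
        mul_le_mul ht hk' (abs_nonneg _) (by positivity)
      have e : 1 / (20 * (m : ℝ)) * m = 1 / 20 := by field_simp
      nlinarith [Real.pi_pos]
    rcases eq_or_ne z 0 with h0 | h0
    · rw [h0, Real.sinc_zero]; norm_num
    · have hpos : 0 < |z| := abs_pos.2 h0
      have h1 := Real.sin_gt_sub_cube hpos
      have h2 : Real.sinc z = Real.sin |z| / |z| := by
        rw [← Real.sinc_of_ne_zero hpos.ne']
        rcases abs_choice z with h | h <;> rw [h]
        rw [Real.sinc_neg]
      rw [h2, le_div_iff₀ hpos]
      have h3 : |z| ^ 2 ≤ 0.12 := by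
        have := Real.pi_lt_d2
        nlinarith
      nlinarith
  refine ⟨b, hge, hle, ?_⟩
  refine ((hasDerivAt_dirichlet m t).div_const _).congr_deriv ?_
  rw [hb, div_mul_eq_mul_div, ← neg_div, Finset.sum_mul]
  congr 2
  refine Finset.sum_congr rfl fun k _ => ?_
  rcases eq_or_ne (2 * Real.pi * (t * k)) 0 with h0 | h0
  · rw [h0, Real.sin_zero]
    have : t * (k : ℝ) = 0 := by
      rcases mul_eq_zero.1 h0 with h | h
      · exact absurd h (by positivity)
      · exact h
    rcases mul_eq_zero.1 this with h | h <;> rw [h] <;> ring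
  · rw [Real.sinc_of_ne_zero h0]
    have h1 : Real.pi ≠ 0 := Real.pi_pos.ne'
    have ht0 : t ≠ 0 := by rintro rfl; simp at h0
    have hk0 : (k : ℝ) ≠ 0 := by intro h; rw [h] at h0; simp at h0
    field_simp

/-! ### The correlation of two steering vectors -/

/-- The inner product of two steering vectors at distance `t`, a product of Dirichlet kernels. -/
noncomputable def correlation {d : ℕ} (m : ℕ) (t : Freq d) : ℝ :=
  ∏ i, dirichlet m (t i) / (2 * m + 1)

lemma inner_steering_eq {d m : ℕ} (ω ω' : Freq d) :
    inner ℂ (steering m ω) (steering m ω') = (correlation m (ω' - ω) : ℂ) := inner_steering ω ω'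

lemma correlation_reduce {d : ℕ} (m : ℕ) (t : Freq d) :
    correlation m (reduce t) = correlation m t :=
  Finset.prod_congr rfl fun i _ => by rw [dirichlet_reduce]

lemma exp_neg_le_one_sub_half {x : ℝ} (h0 : 0 ≤ x) (h1 : x ≤ 1) : Real.exp (-x) ≤ 1 - x / 2 := by
  have h2 : Real.exp (-x) * (1 + x) ≤ 1 := by
    have := Real.add_one_le_exp x
    calc Real.exp (-x) * (1 + x) ≤ Real.exp (-x) * Real.exp x := by
          gcongr; linarith
      _ = 1 := by rw [← Real.exp_add]; simp
  have h3 : 1 ≤ (1 - x / 2) * (1 + x) := by nlinarith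
  exact le_of_mul_le_mul_right (h2.trans h3) (by linarith)

lemma min_one_sum_le {ι : Type*} (s : Finset ι) (f : ι → ℝ) (hf : ∀ i, 0 ≤ f i) :
    min 1 (∑ i ∈ s, f i) ≤ ∑ i ∈ s, min 1 (f i) := by
  classical
  induction s using Finset.induction_on with
  | empty => simp
  | insert a s ha ih =>
    rw [Finset.sum_insert ha, Finset.sum_insert ha]
    have h1 : 0 ≤ ∑ i ∈ s, f i := Finset.sum_nonneg fun i _ => hf i
    have h2 := hf a
    rcases min_cases 1 (f a) with h | h <;> rcases min_cases 1 (∑ i ∈ s, f i) with h' | h' <;>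
      rcases min_cases 1 (f a + ∑ i ∈ s, f i) with h'' | h'' <;> linarith

/-- Frequencies at a distance not small compared to `1/m` have visibly different steering
vectors. -/
lemma correlation_sq_le {d m : ℕ} (hm : 1 ≤ m) (t : Freq d) :
    correlation m t ^ 2 ≤ 1 - min 1 (((2 * m + 1) * ‖reduce t‖) ^ 2) / 2 := by
  rw [← correlation_reduce]
  set τ := reduce t with hτ
  set μ : Fin d → ℝ := fun i => min 1 (((2 * (m : ℝ) + 1) * τ i) ^ 2) with hμ
  have hμ0 : ∀ i, 0 ≤ μ i := fun i => le_min zero_le_one (sq_nonneg _)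
  have h1 : |correlation m τ| ≤ Real.exp (-((∑ i, μ i) / 2)) := by
    rw [correlation, Finset.abs_prod, ← neg_div, ← Finset.sum_neg_distrib, Finset.sum_div,
      Real.exp_sum]
    refine Finset.prod_le_prod (fun i _ => abs_nonneg _) fun i _ => ?_
    refine (abs_dirichlet_div_le hm (abs_reduce_le t i)).trans ?_
    rw [neg_div]
    exact Real.one_sub_le_exp_neg _
  have h2 : min 1 (((2 * (m : ℝ) + 1) * ‖τ‖) ^ 2) ≤ ∑ i, μ i := by
    have : ((2 * (m : ℝ) + 1) * ‖τ‖) ^ 2 = ∑ i, ((2 * (m : ℝ) + 1) * τ i) ^ 2 := by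
      rw [mul_pow, EuclideanSpace.norm_sq_eq, Finset.mul_sum]
      refine Finset.sum_congr rfl fun i _ => ?_
      rw [Real.norm_eq_abs, sq_abs, mul_pow]
    rw [this]
    exact min_one_sum_le _ _ fun i => sq_nonneg _
  calc correlation m τ ^ 2 = |correlation m τ| ^ 2 := (sq_abs _).symm
    _ ≤ Real.exp (-((∑ i, μ i) / 2)) ^ 2 := by gcongr
    _ = Real.exp (-∑ i, μ i) := by rw [← Real.exp_nat_mul]; congr 1; push_cast; ring
    _ ≤ Real.exp (-min 1 (((2 * (m : ℝ) + 1) * ‖τ‖) ^ 2)) := by gcongr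
    _ ≤ _ := exp_neg_le_one_sub_half (le_min zero_le_one (sq_nonneg _)) (min_le_left _ _)

lemma one_sub_sum_le_prod {ι : Type*} (s : Finset ι) (f : ι → ℝ) (h0 : ∀ i ∈ s, 0 ≤ f i)
    (h1 : ∀ i ∈ s, f i ≤ 1) : 1 - ∑ i ∈ s, (1 - f i) ≤ ∏ i ∈ s, f i := by
  classical
  induction s using Finset.induction_on with
  | empty => simp
  | insert a s ha ih =>
    rw [Finset.sum_insert ha, Finset.prod_insert ha]
    have h2 := ih (fun i hi => h0 i (Finset.mem_insert_of_mem hi))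
      fun i hi => h1 i (Finset.mem_insert_of_mem hi)
    have h3 := h0 a (Finset.mem_insert_self _ _)
    have h4 := h1 a (Finset.mem_insert_self _ _)
    have h5 : ∏ i ∈ s, f i ≤ 1 := Finset.prod_le_one
      (fun i hi => h0 i (Finset.mem_insert_of_mem hi)) fun i hi =>
        h1 i (Finset.mem_insert_of_mem hi)
    nlinarith

lemma norm_sq_eq_sum_sq {d : ℕ} (t : Freq d) : ‖t‖ ^ 2 = ∑ i, t i ^ 2 := by
  rw [EuclideanSpace.norm_sq_eq]
  exact Finset.sum_congr rfl fun i _ => by rw [Real.norm_eq_abs, sq_abs]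

lemma abs_apply_le_norm {d : ℕ} (t : Freq d) (i : Fin d) : |t i| ≤ ‖t‖ := PiLp.norm_apply_le t i

lemma dirichlet_div_nonneg {m : ℕ} (hm : 1 ≤ m) {t : ℝ} (ht : |t| ≤ 1 / (20 * m)) :
    0 ≤ dirichlet m t / (2 * m + 1) := by
  have hm0 : (0 : ℝ) < m := by exact_mod_cast hm
  refine le_trans ?_ (one_sub_le_dirichlet m t)
  have h1 : t ^ 2 ≤ (1 / (20 * m)) ^ 2 := by rw [← sq_abs]; gcongr
  have h2 := curvature_le hm
  have h3 : curvature m * t ^ 2 ≤ 8 * Real.pi ^ 2 / 3 * (m : ℝ) ^ 2 * (1 / (20 * m)) ^ 2 := by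
    gcongr
  have h4 : 8 * Real.pi ^ 2 / 3 * (m : ℝ) ^ 2 * (1 / (20 * m)) ^ 2 = 8 * Real.pi ^ 2 / 3 / 400 := by
    field_simp; norm_num
  rw [h4] at h3
  nlinarith [pi_sq_lt]

/-- Partial products of the correlation are close to `1` near the origin. -/
lemma one_sub_le_prod_dirichlet {d m : ℕ} (hm : 1 ≤ m) {t : Freq d} (ht : ‖t‖ ≤ 1 / (20 * m))
    (s : Finset (Fin d)) :
    1 - curvature m * ‖t‖ ^ 2 / 2 ≤ ∏ i ∈ s, dirichlet m (t i) / (2 * m + 1) := by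
  refine le_trans ?_ (one_sub_sum_le_prod s _
    (fun i _ => dirichlet_div_nonneg hm ((abs_apply_le_norm t i).trans ht))
    fun i _ => dirichlet_div_le_one m _)
  have hc : 0 ≤ curvature m := by unfold curvature; positivity
  have h1 : ∑ i ∈ s, (1 - dirichlet m (t i) / (2 * m + 1))
      ≤ ∑ i, curvature m * t i ^ 2 / 2 := by
    refine le_trans (Finset.sum_le_sum fun i _ => ?_)
      (Finset.sum_le_sum_of_subset_of_nonneg (Finset.subset_univ s) fun i _ _ => by positivity)
    linarith [one_sub_le_dirichlet m (t i)]
  rw [← Finset.sum_div, ← Finset.mul_sum, ← norm_sq_eq_sum_sq] at h1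
  linarith

lemma prod_dirichlet_le_one {d m : ℕ} (hm : 1 ≤ m) {t : Freq d} (ht : ‖t‖ ≤ 1 / (20 * m))
    (s : Finset (Fin d)) : ∏ i ∈ s, dirichlet m (t i) / (2 * m + 1) ≤ 1 :=
  Finset.prod_le_one
    (fun i _ => dirichlet_div_nonneg hm ((abs_apply_le_norm t i).trans ht))
    fun _ _ => dirichlet_div_le_one m _

lemma one_sub_correlation_sq_le {d m : ℕ} (hm : 1 ≤ m) {t : Freq d} (ht : ‖t‖ ≤ 1 / (20 * m)) :
    1 - correlation m t ^ 2 ≤ 27 * (m * ‖t‖) ^ 2 := by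
  have h1 := one_sub_le_prod_dirichlet hm ht Finset.univ
  have h2 := prod_dirichlet_le_one hm ht Finset.univ
  have h3 := curvature_le hm
  rw [← correlation] at h1 h2
  have h4 : curvature m * ‖t‖ ^ 2 ≤ 27 * (m * ‖t‖) ^ 2 := by
    rw [mul_pow, ← mul_assoc]
    refine mul_le_mul_of_nonneg_right (h3.trans ?_) (sq_nonneg _)
    nlinarith [pi_sq_lt, sq_nonneg (m : ℝ)]
  nlinarith [sq_nonneg (1 - correlation m t)]

/-- Near the origin, the gradient of `1 - correlation²` is a positive multiple of the position in
each coordinate, so that the Hessian need not be considered. -/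
lemma exists_hasDerivAt_correlation {d m : ℕ} (hm : 1 ≤ m) {t : Freq d}
    (ht : ‖t‖ ≤ 1 / (20 * m)) :
    ∃ b : Fin d → ℝ, (∀ i, curvature m ≤ b i) ∧ (∀ i, b i ≤ 2 * curvature m) ∧
      ∀ u : Freq d, ∃ D : ℝ, HasDerivAt (fun x : ℝ => correlation m (t + x • u)) D 0 ∧
        -2 * correlation m t * D = ∑ i, b i * t i * u i := by
  have hm0 : (0 : ℝ) < m := by exact_mod_cast hm
  choose c hc1 hc2 hc3 using fun i => exists_deriv_dirichlet hm ((abs_apply_le_norm t i).trans ht)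
  have hcurv : 0 ≤ curvature m := by unfold curvature; positivity
  set p : Fin d → ℝ := fun i => ∏ j ∈ Finset.univ.erase i, dirichlet m (t j) / (2 * m + 1) with hp
  -- all factors of the correlation are within `0.033` of `1` in the ball of radius `1 / (20 m)`,
  -- which keeps the coefficients between `1` and `2` times the curvature
  have hsmall : curvature m * ‖t‖ ^ 2 / 2 ≤ 0.033 := by
    have h1 : ‖t‖ ^ 2 ≤ (1 / (20 * m)) ^ 2 := by gcongr
    have h2 := curvature_le hm
    have h3 : curvature m * ‖t‖ ^ 2 ≤ 8 * Real.pi ^ 2 / 3 * (m : ℝ) ^ 2 * (1 / (20 * m)) ^ 2 := by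
      gcongr
    have h4 : 8 * Real.pi ^ 2 / 3 * (m : ℝ) ^ 2 * (1 / (20 * m)) ^ 2
        = 8 * Real.pi ^ 2 / 3 / 400 := by field_simp; norm_num
    rw [h4] at h3
    nlinarith [pi_sq_lt]
  have hp1 : ∀ i, 0.967 ≤ p i := fun i => by
    have := one_sub_le_prod_dirichlet hm ht (Finset.univ.erase i)
    rw [hp]; linarith
  have hp2 : ∀ i, p i ≤ 1 := fun i => prod_dirichlet_le_one hm ht _
  have hf1 : 0.967 ≤ correlation m t := by
    have := one_sub_le_prod_dirichlet hm ht Finset.univ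
    rw [correlation]; linarith
  have hf2 : correlation m t ≤ 1 := prod_dirichlet_le_one hm ht _
  have hfp1 : ∀ i, 0.93 ≤ correlation m t * p i := fun i => by nlinarith [hp1 i]
  have hfp2 : ∀ i, correlation m t * p i ≤ 1 := fun i =>
    mul_le_one₀ hf2 (by linarith [hp1 i]) (hp2 i)
  refine ⟨fun i => 2 * (correlation m t * p i) * c i, fun i => ?_, fun i => ?_, fun u => ?_⟩
  · have h1 := mul_le_mul (hfp1 i) (hc1 i) (by positivity) (by linarith [hfp1 i])
    nlinarith
  · have h1 := mul_le_mul (hfp2 i) (hc2 i) (by linarith [hc1 i]) zero_le_one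
    nlinarith
  · have hd : ∀ i ∈ Finset.univ, HasDerivAt
        (fun x : ℝ => dirichlet m ((t + x • u) i) / (2 * m + 1)) (-(c i * t i) * u i) 0 := by
      intro i _
      have hlin : HasDerivAt (fun x : ℝ => (t + x • u) i) (u i) 0 := by
        have := ((hasDerivAt_id (0 : ℝ)).mul_const (u i)).const_add (t i)
        simpa using this
      have h0 : (t + (0 : ℝ) • u) i = t i := by simp
      have h1 := hc3 i
      rw [← h0] at h1
      have h2 := HasDerivAt.comp (0 : ℝ) h1 hlin
      rw [h0] at h2
      exact h2
    have hprod := HasDerivAt.fun_finsetProd hd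
    refine ⟨_, hprod, ?_⟩
    rw [Finset.mul_sum]
    refine Finset.sum_congr rfl fun i _ => ?_
    simp only [zero_smul, add_zero, smul_eq_mul, hp]
    ring

/-! ### Calculus of steering vectors and of the MUSIC function -/

/-- The derivative of the steering vector at `ω` in the direction `u`. -/
noncomputable def steerDeriv {d : ℕ} (m : ℕ) (ω : Freq d) : Freq d →ₗ[ℝ] SampleSpace d m where
  toFun u := WithLp.toLp 2 fun x =>
    (((2 * Real.pi * ∑ i, u i * (x.1 i : ℝ) : ℝ) : ℂ) * Complex.I) * steering m ω x
  map_add' u v := by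
    ext x
    simp only [PiLp.add_apply, add_mul, Finset.sum_add_distrib, mul_add, Complex.ofReal_add]
  map_smul' c u := by
    ext x
    simp only [PiLp.smul_apply, smul_eq_mul, mul_assoc, ← Finset.mul_sum, RingHom.id_apply,
      Complex.real_smul, Complex.ofReal_mul]
    push_cast
    ring

lemma steerDeriv_apply {d m : ℕ} (ω u : Freq d) (x : cube d m) :
    steerDeriv m ω u x
      = (((2 * Real.pi * ∑ i, u i * (x.1 i : ℝ) : ℝ) : ℂ) * Complex.I) * steering m ω x := rfl

lemma norm_le_mul_of_apply_le {d m : ℕ} {v w : SampleSpace d m} {C : ℝ} (hC : 0 ≤ C)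
    (h : ∀ x, ‖v x‖ ≤ C * ‖w x‖) : ‖v‖ ≤ C * ‖w‖ := by
  refine le_of_sq_le_sq ?_ (by positivity)
  rw [mul_pow, norm_sq_sampleSpace, norm_sq_sampleSpace, Finset.mul_sum]
  refine Finset.sum_le_sum fun x _ => ?_
  rw [← mul_pow]
  exact pow_le_pow_left₀ (norm_nonneg _) (h x) 2

lemma abs_sum_mul_le {d m : ℕ} (u : Freq d) {x : Fin d → ℤ} (hx : x ∈ cube d m) :
    |∑ i, u i * (x i : ℝ)| ≤ √d * m * ‖u‖ := by
  have h1 : inner ℝ (latticePoint x) u = ∑ i, u i * (x i : ℝ) := by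
    rw [PiLp.inner_apply]
    rfl
  rw [← h1]
  refine (abs_real_inner_le_norm _ _).trans ?_
  gcongr
  refine norm_le_sqrt_mul (Nat.cast_nonneg m) fun i => ?_
  have h2 : ((-(m : ℤ) : ℤ) : ℝ) ≤ (x i : ℝ) := Int.cast_le.2 (mem_cube.1 hx i).1
  have h3 : (x i : ℝ) ≤ ((m : ℤ) : ℝ) := Int.cast_le.2 (mem_cube.1 hx i).2
  push_cast at h2 h3
  exact abs_le.2 ⟨h2, h3⟩

lemma sum_cube_mul_eq {d : ℕ} (m : ℕ) (i j : Fin d) :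
    ∑ x ∈ cube d m, (x i : ℝ) * (x j : ℝ)
      = if i = j then cubeSize d m * (m * (m + 1) / 3) else 0 := by
  have h1 : ∀ x : Fin d → ℤ, (x i : ℝ) * (x j : ℝ)
      = ∏ l, ((if l = i then (x l : ℝ) else 1) * (if l = j then (x l : ℝ) else 1)) := fun x => by
    rw [Finset.prod_mul_distrib, Finset.prod_ite_eq' Finset.univ i, Finset.prod_ite_eq']
    simp
  have h0 : ∑ k ∈ Finset.Icc (-(m : ℤ)) m, (1 : ℝ) = 2 * m + 1 := by
    have := dirichlet_zero m
    simpa [dirichlet] using this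
  simp only [h1]
  rw [cube, ← Finset.prod_univ_sum (fun _ => Finset.Icc (-(m : ℤ)) (m : ℤ))
    (fun l k => (if l = i then (k : ℝ) else 1) * (if l = j then (k : ℝ) else 1))]
  split_ifs with hij
  · subst hij
    have hd : d ≠ 0 := by rintro rfl; exact i.elim0
    rw [← Finset.mul_prod_erase _ _ (Finset.mem_univ i),
      Finset.prod_congr rfl (g := fun _ => 2 * (m : ℝ) + 1) fun l hl => ?_]
    · simp only [if_true, ← sq]
      rw [sum_Icc_sq, Finset.prod_const, Finset.card_erase_of_mem (Finset.mem_univ i),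
        Finset.card_univ, Fintype.card_fin, cubeSize,
        show (2 * (m : ℝ) + 1) ^ d = (2 * m + 1) ^ (d - 1) * (2 * m + 1) by
          rw [← pow_succ, Nat.sub_add_cancel (Nat.pos_of_ne_zero hd)]]
      ring
    · simp only [Finset.ne_of_mem_erase hl, if_false, mul_one]
      exact h0
  · refine Finset.prod_eq_zero (Finset.mem_univ i) ?_
    simp only [if_true, hij, if_false, mul_one]
    exact sum_Icc_odd m fun k => by push_cast; ring

/-- The coordinates of a uniformly distributed point of the cube are uncorrelated. -/
lemma sum_cube_sq {d : ℕ} (m : ℕ) (u : Freq d) :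
    ∑ x ∈ cube d m, (∑ i, u i * (x i : ℝ)) ^ 2 = cubeSize d m * (m * (m + 1) / 3) * ‖u‖ ^ 2 := by
  have h1 : ∀ x : Fin d → ℤ, (∑ i, u i * (x i : ℝ)) ^ 2
      = ∑ i, ∑ j, u i * u j * ((x i : ℝ) * (x j : ℝ)) := fun x => by
    rw [sq, Finset.sum_mul_sum]
    exact Finset.sum_congr rfl fun i _ => Finset.sum_congr rfl fun j _ => by ring
  simp only [h1]
  rw [Finset.sum_comm, norm_sq_eq_sum_sq, Finset.mul_sum]
  refine Finset.sum_congr rfl fun i _ => ?_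
  rw [Finset.sum_comm]
  simp only [← Finset.mul_sum, sum_cube_mul_eq]
  simp only [mul_ite, mul_zero, Finset.sum_ite_eq, Finset.mem_univ, if_true]
  ring

/-- The derivative of the steering vectors is bounded independently of the dimension. -/
lemma norm_steerDeriv_sq {d m : ℕ} (ω u : Freq d) :
    ‖steerDeriv m ω u‖ ^ 2 = curvature m * ‖u‖ ^ 2 := by
  have hpos := cubeSize_pos d m
  have h1 : ∀ x : cube d m, ‖steerDeriv m ω u x‖ ^ 2
      = 4 * Real.pi ^ 2 / cubeSize d m * (∑ i, u i * (x.1 i : ℝ)) ^ 2 := fun x => by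
    rw [steerDeriv_apply, steering_apply, norm_mul, norm_mul, norm_mul, norm_expo, Complex.norm_I,
      Complex.norm_real, Complex.norm_real, mul_one, mul_one, mul_pow, Real.norm_eq_abs,
      Real.norm_eq_abs, sq_abs, sq_abs, div_pow, one_pow, Real.sq_sqrt hpos.le]
    ring
  rw [norm_sq_sampleSpace]
  simp only [h1]
  rw [← Finset.mul_sum, Finset.sum_coe_sort (cube d m) (fun x => (∑ i, u i * (x i : ℝ)) ^ 2),
    sum_cube_sq, curvature]
  field_simp

lemma norm_steerDeriv_le {d m : ℕ} (hm : 1 ≤ m) (ω u : Freq d) :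
    ‖steerDeriv m ω u‖ ≤ 11 / 2 * m * ‖u‖ := by
  refine le_of_sq_le_sq ?_ (by positivity)
  rw [norm_steerDeriv_sq, mul_pow]
  refine mul_le_mul_of_nonneg_right ((curvature_le hm).trans ?_) (sq_nonneg _)
  rw [mul_pow]
  refine mul_le_mul_of_nonneg_right ?_ (sq_nonneg _)
  nlinarith [pi_sq_lt]

lemma steering_add {d m : ℕ} (ω u : Freq d) (x : cube d m) :
    steering m (ω + u) x
      = Complex.exp (((2 * Real.pi * ∑ i, u i * (x.1 i : ℝ) : ℝ) : ℂ) * Complex.I)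
        * steering m ω x := by
  rw [steering_apply, steering_apply, expo_add_left, expo.eq_1 u]
  rw [show (2 * (Real.pi : ℂ) * Complex.I * ((∑ i, u i * (x.1 i : ℝ) : ℝ) : ℂ))
    = ((2 * Real.pi * ∑ i, u i * (x.1 i : ℝ) : ℝ) : ℂ) * Complex.I by push_cast; ring]
  ring

lemma norm_exp_I_sub_le (z : ℝ) : ‖Complex.exp (z * Complex.I) - 1‖ ≤ |z| := by
  rw [mul_comm]; exact Real.norm_exp_I_mul_ofReal_sub_one_le

lemma norm_exp_I_sub_sub_le (z : ℝ) :
    ‖Complex.exp (z * Complex.I) - 1 - z * Complex.I‖ ≤ 3 * z ^ 2 := by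
  have hz : ‖(z : ℂ) * Complex.I‖ = |z| := by
    rw [norm_mul, Complex.norm_I, mul_one, Complex.norm_real, Real.norm_eq_abs]
  rcases le_or_gt |z| 1 with h | h
  · refine (Complex.norm_exp_sub_one_sub_id_le (hz.le.trans h)).trans ?_
    rw [hz, sq_abs]; nlinarith [sq_nonneg z]
  · refine (norm_sub_le _ _).trans ?_
    rw [hz]
    have := norm_exp_I_sub_le z
    rw [← sq_abs]
    nlinarith

lemma norm_steering_add_sub_le {d m : ℕ} (ω u : Freq d) :
    ‖steering m (ω + u) - steering m ω‖ ≤ 2 * Real.pi * (√d * m * ‖u‖) := by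
  have h := norm_le_mul_of_apply_le (v := steering m (ω + u) - steering m ω) (w := steering m ω)
    (C := 2 * Real.pi * (√d * m * ‖u‖)) (by positivity) fun x => by
      rw [PiLp.sub_apply, steering_add, ← sub_one_mul, norm_mul]
      refine mul_le_mul_of_nonneg_right ((norm_exp_I_sub_le _).trans ?_) (norm_nonneg _)
      rw [abs_mul, abs_of_pos Real.two_pi_pos]
      gcongr
      exact abs_sum_mul_le u x.2
  rwa [norm_steering, mul_one] at h

/-- The second order Taylor remainder of the steering vectors. -/
lemma norm_steering_taylor_le {d m : ℕ} (ω u : Freq d) :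
    ‖steering m (ω + u) - steering m ω - steerDeriv m ω u‖ ≤ 120 * d * m ^ 2 * ‖u‖ ^ 2 := by
  have h := norm_le_mul_of_apply_le
    (v := steering m (ω + u) - steering m ω - steerDeriv m ω u) (w := steering m ω)
    (C := 120 * d * m ^ 2 * ‖u‖ ^ 2) (by positivity) fun x => by
      rw [PiLp.sub_apply, PiLp.sub_apply, steering_add, steerDeriv_apply, ← sub_one_mul, ← sub_mul,
        norm_mul]
      refine mul_le_mul_of_nonneg_right ((norm_exp_I_sub_sub_le _).trans ?_) (norm_nonneg _)
      have h1 : (∑ i, u i * (x.1 i : ℝ)) ^ 2 ≤ (√d * m * ‖u‖) ^ 2 := by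
        rw [← sq_abs]
        exact pow_le_pow_left₀ (abs_nonneg _) (abs_sum_mul_le u x.2) 2
      rw [mul_pow, mul_pow, Real.sq_sqrt (Nat.cast_nonneg d)] at h1
      calc 3 * (2 * Real.pi * ∑ i, u i * (x.1 i : ℝ)) ^ 2
          = 12 * Real.pi ^ 2 * (∑ i, u i * (x.1 i : ℝ)) ^ 2 := by ring
        _ ≤ 120 * (d * m ^ 2 * ‖u‖ ^ 2) :=
          mul_le_mul (by nlinarith [pi_sq_lt]) h1 (sq_nonneg _) (by norm_num)
        _ = _ := by ring
  rwa [norm_steering, mul_one] at h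

lemma hasFDerivAt_of_quadratic {E F : Type*} [NormedAddCommGroup E] [NormedSpace ℝ E]
    [NormedAddCommGroup F] [NormedSpace ℝ F] {f : E → F} {L : E →L[ℝ] F} {x : E} {C : ℝ}
    (h : ∀ u, ‖f (x + u) - f x - L u‖ ≤ C * ‖u‖ ^ 2) : HasFDerivAt f L x := by
  rw [hasFDerivAt_iff_isLittleO_nhds_zero]
  have h1 : (fun u => f (x + u) - f x - L u) =O[nhds 0] fun u => ‖u‖ ^ 2 :=
    Asymptotics.IsBigO.of_bound C (Filter.Eventually.of_forall fun u => by
      rw [Real.norm_of_nonneg (sq_nonneg _)]; exact h u)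
  exact h1.trans_isLittleO (Asymptotics.isLittleO_norm_pow_id one_lt_two)

lemma hasFDerivAt_steering {d m : ℕ} (ω : Freq d) :
    HasFDerivAt (steering m) (LinearMap.toContinuousLinearMap (steerDeriv m ω)) ω :=
  hasFDerivAt_of_quadratic (norm_steering_taylor_le ω)

lemma hasDerivAt_steering {d m : ℕ} (ω u : Freq d) (s : ℝ) :
    HasDerivAt (fun s : ℝ => steering m (ω + s • u)) (steerDeriv m (ω + s • u) u) s := by
  have hlin : HasDerivAt (fun s : ℝ => ω + s • u) u s := by
    simpa using ((hasDerivAt_id s).smul_const u).const_add ω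
  exact (hasFDerivAt_steering (m := m) (ω + s • u)).comp_hasDerivAt s hlin

section Music

variable {d m : ℕ} (W : Submodule ℂ (SampleSpace d m))

lemma inner_starProjection_self (v : SampleSpace d m) :
    inner ℂ v (W.starProjection v) = ((‖W.starProjection v‖ ^ 2 : ℝ) : ℂ) := by
  have h1 := Submodule.starProjection_inner_eq_zero v (W.starProjection v)
    (W.starProjection_apply_mem v)
  rw [inner_sub_left, sub_eq_zero] at h1
  rw [h1, inner_self_eq_norm_sq_to_K]
  norm_cast

lemma music_eq (ω : Freq d) : music W ω = 1 - ‖W.starProjection (steering m ω)‖ ^ 2 := by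
  rw [music, inner_sub_right, inner_starProjection_self, Complex.sub_re, Complex.ofReal_re]
  congr 1
  have h := inner_self_eq_norm_sq (𝕜 := ℂ) (steering m ω)
  rw [norm_steering, one_pow] at h
  exact h

lemma music_add_latticePoint (ω : Freq d) (n : Fin d → ℤ) :
    music W (ω + latticePoint n) = music W ω := by
  rw [music, music, steering_add_latticePoint]

/-- The linearization of the MUSIC function, with a quadratic bound for the remainder. -/
lemma abs_music_add_sub_le (ω u : Freq d) :
    |music W (ω + u) - music W ω
      - -2 * (inner ℂ (steerDeriv m ω u) (W.starProjection (steering m ω))).re|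
      ≤ 280 * d * m ^ 2 * ‖u‖ ^ 2 := by
  set a := steering m ω with ha
  set b := steering m (ω + u) with hb
  set v := steerDeriv m ω u with hv
  have hP : ∀ w : SampleSpace d m, ‖W.starProjection w‖ ≤ ‖w‖ := fun w =>
    W.norm_starProjection_apply_le w
  have hre : ∀ w : SampleSpace d m, ‖W.starProjection w‖ ^ 2
      = (inner ℂ w (W.starProjection w)).re := fun w => by
    rw [inner_starProjection_self, Complex.ofReal_re]
  have hsymm : ∀ x y : SampleSpace d m, (inner ℂ x (W.starProjection y)).re
      = (inner ℂ y (W.starProjection x)).re := fun x y => by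
    rw [← Submodule.inner_starProjection_left_eq_right, ← inner_conj_symm, Complex.conj_re]
  have key : music W (ω + u) - music W ω - -2 * (inner ℂ v (W.starProjection a)).re
      = -(2 * (inner ℂ (b - a - v) (W.starProjection a)).re
        + (inner ℂ (b - a) (W.starProjection (b - a))).re) := by
    rw [music_eq, music_eq, ← ha, ← hb, hre, hre]
    simp only [map_sub, inner_sub_left, inner_sub_right, Complex.sub_re]
    rw [hsymm a b]
    ring
  rw [key, abs_neg]
  have h1 : |(inner ℂ (b - a - v) (W.starProjection a)).re| ≤ 120 * d * m ^ 2 * ‖u‖ ^ 2 := by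
    refine (Complex.abs_re_le_norm _).trans ((norm_inner_le_norm _ _).trans ?_)
    have h2 : ‖W.starProjection a‖ ≤ 1 := (hP a).trans (norm_steering ω).le
    exact (mul_le_of_le_one_right (norm_nonneg _) h2).trans (norm_steering_taylor_le ω u)
  have h3 : |(inner ℂ (b - a) (W.starProjection (b - a))).re| ≤ 40 * d * m ^ 2 * ‖u‖ ^ 2 := by
    rw [← hre, abs_of_nonneg (sq_nonneg _)]
    have h4 : ‖W.starProjection (b - a)‖ ≤ 2 * Real.pi * (√d * m * ‖u‖) :=
      (hP _).trans (norm_steering_add_sub_le ω u)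
    refine (pow_le_pow_left₀ (norm_nonneg _) h4 2).trans ?_
    rw [mul_pow, mul_pow, mul_pow, mul_pow, Real.sq_sqrt (Nat.cast_nonneg d)]
    have h5 : (0 : ℝ) ≤ d * m ^ 2 * ‖u‖ ^ 2 := by positivity
    nlinarith [pi_sq_lt]
  rw [abs_le] at *
  constructor <;> nlinarith

lemma inner_gradient_music (ω u : Freq d) :
    inner ℝ (gradient (music W) ω) u
      = -2 * (inner ℂ (steerDeriv m ω u) (W.starProjection (steering m ω))).re := by
  let L : Freq d →ₗ[ℝ] ℝ :=
    { toFun := fun u => -2 * (inner ℂ (steerDeriv m ω u) (W.starProjection (steering m ω))).re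
      map_add' := fun u v => by
        rw [map_add, inner_add_left, Complex.add_re, mul_add]
      map_smul' := fun c u => by
        rw [map_smul, RCLike.real_smul_eq_coe_smul (K := ℂ), inner_smul_left, RingHom.id_apply,
          smul_eq_mul]
        simp only [Complex.coe_algebraMap, Complex.conj_ofReal, Complex.re_ofReal_mul]
        ring }
  have h : HasFDerivAt (music W) (LinearMap.toContinuousLinearMap L) ω :=
    hasFDerivAt_of_quadratic (abs_music_add_sub_le W ω)
  rw [inner_gradient_left, h.fderiv]
  rfl

/-- The quadratic upper bound for the MUSIC function along its gradient. -/
lemma music_add_le (ω u : Freq d) :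
    music W (ω + u) ≤ music W ω + inner ℝ (gradient (music W) ω) u
      + 280 * d * m ^ 2 * ‖u‖ ^ 2 := by
  rw [inner_gradient_music]
  linarith [(abs_le.1 (abs_music_add_sub_le W ω u)).2]

end Music

lemma gradient_add_latticePoint {d m : ℕ} (W : Submodule ℂ (SampleSpace d m)) (ω : Freq d)
    (n : Fin d → ℤ) : gradient (music W) (ω + latticePoint n) = gradient (music W) ω := by
  refine ext_inner_right ℝ fun u => ?_
  have h : steerDeriv m (ω + latticePoint n) u = steerDeriv m ω u := by
    ext x; rw [steerDeriv_apply, steerDeriv_apply, steering_add_latticePoint]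
  rw [inner_gradient_music, inner_gradient_music, steering_add_latticePoint, h]

/-! ### Nearly orthonormal families -/

section NearlyOrthonormal

variable {V : Type*} [NormedAddCommGroup V] [InnerProductSpace ℂ V] {ι : Type*} [Fintype ι]

/-- The family `φ` has a Gram matrix within `δ` of the identity in operator norm. -/
def NearlyOrthonormal (δ : ℝ) (φ : ι → V) : Prop :=
  ∀ c : ι → ℂ, |‖∑ j, c j • φ j‖ ^ 2 - ∑ j, ‖c j‖ ^ 2| ≤ δ * ∑ j, ‖c j‖ ^ 2

variable {δ : ℝ} {φ : ι → V}

lemma NearlyOrthonormal.le_norm_sq (h : NearlyOrthonormal δ φ) (c : ι → ℂ) :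
    (1 - δ) * ∑ j, ‖c j‖ ^ 2 ≤ ‖∑ j, c j • φ j‖ ^ 2 := by
  linarith [(abs_le.1 (h c)).1]

lemma NearlyOrthonormal.linearIndependent (h : NearlyOrthonormal δ φ) (hδ : δ < 1) :
    LinearIndependent ℂ φ := by
  rw [Fintype.linearIndependent_iff]
  intro c hc j
  have h1 := h.le_norm_sq c
  rw [hc, norm_zero] at h1
  have h2 : ‖c j‖ ^ 2 ≤ ∑ j, ‖c j‖ ^ 2 :=
    Finset.single_le_sum (f := fun j => ‖c j‖ ^ 2) (fun j _ => sq_nonneg _) (Finset.mem_univ j)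
  have h3 : ‖c j‖ ^ 2 ≤ 0 := by nlinarith
  exact norm_eq_zero.1 (pow_eq_zero_iff two_ne_zero |>.1 (le_antisymm h3 (sq_nonneg _)))

/-- A unit vector of the family is almost orthogonal to the combinations of the other ones. -/
lemma NearlyOrthonormal.norm_inner_le [DecidableEq ι] (h : NearlyOrthonormal δ φ) (hδ : 0 ≤ δ)
    {l : ι} (hl : ‖φ l‖ = 1) {c : ι → ℂ} (hc : c l = 0) :
    ‖inner ℂ (φ l) (∑ j, c j • φ j)‖ ≤ 2 * δ * √(∑ j, ‖c j‖ ^ 2) := by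
  set v := ∑ j, c j • φ j with hv
  set z : ℂ := inner ℂ (φ l) v with hz
  set S := ∑ j, ‖c j‖ ^ 2 with hS
  have hS0 : 0 ≤ S := Finset.sum_nonneg fun j _ => sq_nonneg _
  -- polarization, with a coefficient of modulus `√S` and of the phase of the inner product
  have hpol : ∀ w : ℂ, ‖w‖ ^ 2 = S → 2 * (starRingEnd ℂ w * z).re ≤ 3 * δ * S := fun w hw => by
    have h1 := h c
    have h2 := h (Function.update c l w)
    have e1 : ∑ j, Function.update c l w j • φ j = v + w • φ l := by
      rw [hv, ← Finset.add_sum_erase _ _ (Finset.mem_univ l),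
        ← Finset.add_sum_erase _ (fun j => c j • φ j) (Finset.mem_univ l), hc, zero_smul, zero_add,
        Function.update_self, add_comm]
      congr 1
      exact Finset.sum_congr rfl fun j hj => by
        rw [Function.update_of_ne (Finset.ne_of_mem_erase hj)]
    have e2 : ∑ j, ‖Function.update c l w j‖ ^ 2 = S + S := by
      rw [hS, ← Finset.add_sum_erase _ _ (Finset.mem_univ l), Function.update_self, hw, hS]
      congr 1
      rw [← Finset.add_sum_erase Finset.univ (fun j => ‖c j‖ ^ 2) (Finset.mem_univ l), hc, norm_zero]
      rw [zero_pow two_ne_zero, zero_add]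
      exact Finset.sum_congr rfl fun j hj => by
        rw [Function.update_of_ne (Finset.ne_of_mem_erase hj)]
    have e3 : ‖v + w • φ l‖ ^ 2 = ‖v‖ ^ 2 + 2 * (starRingEnd ℂ w * z).re + S := by
      rw [norm_add_sq (𝕜 := ℂ), norm_smul, hl, mul_one, hw, hz]
      congr 3
      rw [inner_smul_right, ← inner_conj_symm v, RCLike.re_eq_complex_re, ← Complex.conj_re,
        map_mul, Complex.conj_conj]
    rw [e1, e2, e3] at h2
    have h3 := (abs_le.1 h1).1
    have h4 := (abs_le.1 h2).2
    linarith
  rcases eq_or_ne z 0 with h0 | h0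
  · rw [h0, norm_zero]; positivity
  · have hz0 : (0 : ℝ) < ‖z‖ := norm_pos_iff.2 h0
    have h1 := hpol ((√S / ‖z‖ : ℝ) * z) (by
      rw [norm_mul, Complex.norm_real, Real.norm_eq_abs, abs_of_nonneg (by positivity),
        div_mul_cancel₀ _ hz0.ne', Real.sq_sqrt hS0])
    rw [map_mul, Complex.conj_ofReal, mul_assoc, Complex.conj_mul', ← Complex.ofReal_pow,
      ← Complex.ofReal_mul, Complex.ofReal_re] at h1
    have h2 : √S / ‖z‖ * ‖z‖ ^ 2 = √S * ‖z‖ := by field_simp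
    rw [h2] at h1
    rcases eq_or_lt_of_le (Real.sqrt_nonneg S) with h3 | h3
    · exfalso
      have hS00 : S = 0 := by rw [← Real.sq_sqrt hS0, ← h3]; ring
      have hcz : ∀ j, c j = 0 := fun j => by
        have h4 : ‖c j‖ ^ 2 ≤ S :=
          Finset.single_le_sum (f := fun j => ‖c j‖ ^ 2) (fun j _ => sq_nonneg _)
            (Finset.mem_univ j)
        rw [hS00] at h4
        exact norm_eq_zero.1 (pow_eq_zero_iff two_ne_zero |>.1 (le_antisymm h4 (sq_nonneg _)))
      apply h0
      rw [hz, hv]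
      simp [hcz]
    · have h4 : √S * (2 * ‖z‖) ≤ √S * (3 * δ * √S) := by
        have : √S * √S = S := Real.mul_self_sqrt hS0
        nlinarith
      have h5 := le_of_mul_le_mul_left h4 h3
      have h6 : 0 ≤ δ * √S := by positivity
      linarith

/-- The analysis operator of a nearly orthonormal family is bounded below on its span. -/
lemma NearlyOrthonormal.le_sum_norm_inner_sq (h : NearlyOrthonormal δ φ) (hδ : δ < 1) {u : V}
    (hu : u ∈ Submodule.span ℂ (Set.range φ)) :
    (1 - δ) * ‖u‖ ^ 2 ≤ ∑ j, ‖inner ℂ (φ j) u‖ ^ 2 := by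
  obtain ⟨c, rfl⟩ := (Submodule.mem_span_range_iff_exists_fun ℂ).1 hu
  set u := ∑ j, c j • φ j with hu'
  set S := ∑ j, ‖c j‖ ^ 2 with hS
  set R := ∑ j, ‖inner ℂ (φ j) u‖ ^ 2 with hR
  have hR0 : 0 ≤ R := Finset.sum_nonneg fun j _ => sq_nonneg _
  have hS0 : 0 ≤ S := Finset.sum_nonneg fun j _ => sq_nonneg _
  have h1 : ‖u‖ ^ 2 ≤ ∑ j, ‖c j‖ * ‖inner ℂ (φ j) u‖ := by
    have h2 : ((‖u‖ ^ 2 : ℝ) : ℂ) = ∑ j, starRingEnd ℂ (c j) * inner ℂ (φ j) u := by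
      have h3 : inner ℂ u u = ∑ j, starRingEnd ℂ (c j) * inner ℂ (φ j) u := by
        conv_lhs => rw [hu', sum_inner]
        exact Finset.sum_congr rfl fun j _ => inner_smul_left _ _ _
      rw [← h3, inner_self_eq_norm_sq_to_K]
      norm_cast
    have h3 : ‖u‖ ^ 2 = ‖((‖u‖ ^ 2 : ℝ) : ℂ)‖ := by
      rw [Complex.norm_real, Real.norm_of_nonneg (sq_nonneg _)]
    rw [h3, h2]
    refine (norm_sum_le _ _).trans (Finset.sum_le_sum fun j _ => ?_)
    rw [norm_mul, RCLike.norm_conj]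
  have h2 : (∑ j, ‖c j‖ * ‖inner ℂ (φ j) u‖) ^ 2 ≤ S * R :=
    Finset.sum_mul_sq_le_sq_mul_sq _ _ _
  have h3 := h.le_norm_sq c
  rw [← hu', ← hS] at h3
  rcases eq_or_ne (‖u‖) 0 with h0 | h0
  · rw [h0]; simpa using hR0
  · have hu0 : 0 < ‖u‖ ^ 2 := by positivity
    have h4 : (‖u‖ ^ 2) ^ 2 ≤ S * R := (pow_le_pow_left₀ (sq_nonneg _) h1 2).trans h2
    refine le_of_mul_le_mul_right ?_ hu0
    calc (1 - δ) * ‖u‖ ^ 2 * ‖u‖ ^ 2 = (1 - δ) * (‖u‖ ^ 2) ^ 2 := by ring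
      _ ≤ (1 - δ) * (S * R) := mul_le_mul_of_nonneg_left h4 (by linarith)
      _ = ((1 - δ) * S) * R := by ring
      _ ≤ ‖u‖ ^ 2 * R := mul_le_mul_of_nonneg_right h3 hR0
      _ = R * ‖u‖ ^ 2 := mul_comm _ _

/-- The operator `∑ b_j ⟨φ_j, ·⟩ ψ_j` is bounded below on the span of the `φ_j`. -/
lemma NearlyOrthonormal.le_norm_sum {ψ : ι → V} (hφ : NearlyOrthonormal δ φ)
    (hψ : NearlyOrthonormal δ ψ) (hδ : δ < 1) {b : ι → ℂ} {N : ℝ} (hN : 0 ≤ N)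
    (hb : ∀ j, N ≤ ‖b j‖) {u : V} (hu : u ∈ Submodule.span ℂ (Set.range φ)) :
    N * (1 - δ) * ‖u‖ ≤ ‖∑ j, (b j * inner ℂ (φ j) u) • ψ j‖ := by
  refine le_of_sq_le_sq ?_ (norm_nonneg _)
  refine le_trans ?_ (hψ.le_norm_sq _)
  calc (N * (1 - δ) * ‖u‖) ^ 2 = (1 - δ) * (N ^ 2 * ((1 - δ) * ‖u‖ ^ 2)) := by ring
    _ ≤ (1 - δ) * (N ^ 2 * ∑ j, ‖inner ℂ (φ j) u‖ ^ 2) := by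
        have := hφ.le_sum_norm_inner_sq hδ hu
        have h1 : 0 ≤ 1 - δ := by linarith
        gcongr
    _ ≤ _ := by
        refine mul_le_mul_of_nonneg_left ?_ (by linarith)
        rw [Finset.mul_sum]
        refine Finset.sum_le_sum fun j _ => ?_
        rw [norm_mul, mul_pow]
        have := hb j
        gcongr

end NearlyOrthonormal

/-! ### The part of the projection that belongs to the other frequencies -/

section Residual

variable {V : Type*} [NormedAddCommGroup V] [InnerProductSpace ℂ V] [FiniteDimensional ℂ V]

/-- The projection onto `U` minus the projection onto the line of the unit vector `φ`; for `φ ∈ U`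
this is the projection onto the orthogonal complement of `φ` in `U`. -/
noncomputable def residual (U : Submodule ℂ V) (φ : V) : V →L[ℂ] V :=
  U.starProjection - (innerSL ℂ φ).smulRight φ

variable (U : Submodule ℂ V) {φ : V}

lemma residual_apply (w : V) : residual U φ w = U.starProjection w - inner ℂ φ w • φ := rfl

variable {U}

lemma residual_self (hφ : φ ∈ U) (h1 : ‖φ‖ = 1) : residual U φ φ = 0 := by
  rw [residual_apply, Submodule.starProjection_eq_self_iff.2 hφ, inner_self_eq_norm_sq_to_K, h1]
  simp

lemma inner_starProjection_of_mem (hφ : φ ∈ U) (w : V) :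
    inner ℂ φ (U.starProjection w) = inner ℂ φ w := by
  rw [← Submodule.inner_starProjection_left_eq_right, Submodule.starProjection_eq_self_iff.2 hφ]

lemma inner_residual (hφ : φ ∈ U) (h1 : ‖φ‖ = 1) (w : V) : inner ℂ φ (residual U φ w) = 0 := by
  rw [residual_apply, inner_sub_right, inner_smul_right, inner_self_eq_norm_sq_to_K, h1,
    inner_starProjection_of_mem hφ]
  simp

lemma residual_mem (hφ : φ ∈ U) (w : V) : residual U φ w ∈ U :=
  U.sub_mem (U.starProjection_apply_mem w) (U.smul_mem _ hφ)

/-- The splitting of the projection onto `U` into the projection onto `φ` and the residual. -/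
lemma inner_starProjection_eq_add (hφ : φ ∈ U) (h1 : ‖φ‖ = 1) (x y : V) :
    inner ℂ x (U.starProjection y)
      = inner ℂ x φ * inner ℂ φ y + inner ℂ (residual U φ x) (residual U φ y) := by
  have h2 : inner ℂ (residual U φ x) (residual U φ y) = inner ℂ x (residual U φ y) := by
    conv_lhs => rw [residual_apply, inner_sub_left, inner_smul_left, inner_residual hφ h1, mul_zero,
      sub_zero, Submodule.inner_starProjection_left_eq_right,
      Submodule.starProjection_eq_self_iff.2 (residual_mem hφ y)]
  rw [h2, residual_apply, inner_sub_right, inner_smul_right]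
  ring

lemma norm_residual_le (hφ : φ ∈ U) (h1 : ‖φ‖ = 1) (w : V) : ‖residual U φ w‖ ≤ ‖w‖ := by
  have h2 := inner_starProjection_eq_add hφ h1 w w
  have h3 : ‖residual U φ w‖ ^ 2 = (inner ℂ (residual U φ w) (residual U φ w)).re :=
    (inner_self_eq_norm_sq (𝕜 := ℂ) _).symm
  have h4 : (inner ℂ w φ * inner ℂ φ w).re = ‖inner ℂ φ w‖ ^ 2 := by
    rw [← inner_conj_symm, Complex.conj_mul', ← Complex.ofReal_pow, Complex.ofReal_re]
  have h5 : (inner ℂ w (U.starProjection w)).re ≤ ‖w‖ ^ 2 := by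
    refine (Complex.re_le_norm _).trans ((norm_inner_le_norm _ _).trans ?_)
    rw [sq]
    exact mul_le_mul_of_nonneg_left (U.norm_starProjection_apply_le w) (norm_nonneg _)
  refine le_of_sq_le_sq ?_ (norm_nonneg _)
  have h6 := congrArg Complex.re h2
  rw [Complex.add_re, h4, ← h3] at h6
  nlinarith [sq_nonneg ‖inner ℂ φ w‖]

/-- The residual is small at a unit vector `ψ` that can replace `φ_l` in the family without
spoiling its near orthonormality. -/
lemma norm_residual_le_of_update {ι : Type*} [Fintype ι] [DecidableEq ι] {δ : ℝ} {φ : ι → V}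
    (hδ : 0 ≤ δ) (hδ2 : δ ≤ 1 / 2) (hφ : NearlyOrthonormal δ φ) (h1 : ∀ j, ‖φ j‖ = 1) (l : ι)
    {ψ : V} (hψ1 : ‖ψ‖ = 1) (hψ : NearlyOrthonormal δ (Function.update φ l ψ)) :
    ‖residual (Submodule.span ℂ (Set.range φ)) (φ l) ψ‖ ≤ 6 * δ := by
  set U := Submodule.span ℂ (Set.range φ) with hU
  have hmem : φ l ∈ U := Submodule.subset_span ⟨l, rfl⟩
  set v := residual U (φ l) ψ with hv
  obtain ⟨c, hc⟩ := (Submodule.mem_span_range_iff_exists_fun ℂ).1 (residual_mem hmem ψ)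
  rw [← hv] at hc
  set c' := Function.update c l 0 with hc'
  have hc'l : c' l = 0 := Function.update_self _ _ _
  have hc'j : ∀ j, j ≠ l → c' j = c j := fun j hj => Function.update_of_ne hj _ _
  have hsplit : v = c l • φ l + ∑ j, c' j • φ j := by
    rw [← hc, ← Finset.add_sum_erase _ _ (Finset.mem_univ l),
      ← Finset.add_sum_erase _ (fun j => c' j • φ j) (Finset.mem_univ l), hc'l, zero_smul, zero_add]
    congr 1
    exact Finset.sum_congr rfl fun j hj => by rw [hc'j j (Finset.ne_of_mem_erase hj)]
  have hupd : ∑ j, c' j • φ j = ∑ j, c' j • Function.update φ l ψ j := by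
    refine Finset.sum_congr rfl fun j _ => ?_
    rcases eq_or_ne j l with rfl | hj
    · rw [hc'l, zero_smul, zero_smul]
    · rw [Function.update_of_ne hj]
  set S := ∑ j, ‖c j‖ ^ 2 with hS
  have hS' : ∑ j, ‖c' j‖ ^ 2 ≤ S := Finset.sum_le_sum fun j _ => by
    rcases eq_or_ne j l with rfl | hj
    · rw [hc'l, norm_zero, zero_pow two_ne_zero]; exact sq_nonneg _
    · rw [hc'j j hj]
  have hcl : ‖c l‖ ≤ 2 * δ * √S := by
    have h2 := inner_residual hmem (h1 l) ψ
    rw [← hv, hsplit, inner_add_right, inner_smul_right, inner_self_eq_norm_sq_to_K, h1 l] at h2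
    have h3 : c l = -inner ℂ (φ l) (∑ j, c' j • φ j) := by
      rw [eq_neg_iff_add_eq_zero, ← h2, RCLike.ofReal_one, one_pow, mul_one]
    rw [h3, norm_neg]
    refine (hφ.norm_inner_le hδ (h1 l) hc'l).trans ?_
    gcongr
  have hpsi : ‖inner ℂ ψ (∑ j, c' j • φ j)‖ ≤ 2 * δ * √S := by
    have h2 := hψ.norm_inner_le hδ (l := l) (by rw [Function.update_self, hψ1]) hc'l
    rw [Function.update_self, ← hupd] at h2
    refine h2.trans ?_
    gcongr
  have hvv : ‖v‖ ^ 2 ≤ 4 * δ * √S := by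
    have h2 : ((‖v‖ ^ 2 : ℝ) : ℂ) = inner ℂ ψ v := by
      have h3 := inner_starProjection_eq_add hmem (h1 l) ψ ψ
      have h4 : inner ℂ v v = ((‖v‖ ^ 2 : ℝ) : ℂ) := by
        rw [inner_self_eq_norm_sq_to_K]; norm_cast
      rw [← hv, h4] at h3
      have h5 : inner ℂ ψ v
          = inner ℂ ψ (U.starProjection ψ) - inner ℂ (φ l) ψ * inner ℂ ψ (φ l) := by
        rw [hv, residual_apply, inner_sub_right, inner_smul_right]
      rw [h5, h3]
      ring
    have h3 : ‖v‖ ^ 2 = ‖((‖v‖ ^ 2 : ℝ) : ℂ)‖ := by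
      rw [Complex.norm_real, Real.norm_of_nonneg (sq_nonneg _)]
    rw [h3, h2, hsplit, inner_add_right, inner_smul_right]
    refine (norm_add_le _ _).trans ?_
    rw [norm_mul]
    have h4 : ‖inner ℂ ψ (φ l)‖ ≤ 1 := by
      refine (norm_inner_le_norm _ _).trans ?_
      rw [hψ1, h1 l, one_mul]
    have h5 : ‖c l‖ * ‖inner ℂ ψ (φ l)‖ ≤ ‖c l‖ := mul_le_of_le_one_right (norm_nonneg _) h4
    linarith
  have hSv : √S ≤ 3 / 2 * ‖v‖ := by
    rw [Real.sqrt_le_left (by positivity)]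
    have h2 := hφ.le_norm_sq c
    rw [hc, ← hS] at h2
    have hS0 : 0 ≤ S := Finset.sum_nonneg fun j _ => sq_nonneg _
    nlinarith [sq_nonneg ‖v‖]
  rcases eq_or_lt_of_le (norm_nonneg v) with h0 | h0
  · rw [← h0]; positivity
  · refine le_of_mul_le_mul_right ?_ h0
    nlinarith

end Residual

/-! ### The landscape of the MUSIC function -/

/-- The signal space, spanned by the steering vectors of the frequencies. -/
noncomputable def signalSpace {d s : ℕ} (m : ℕ) (θ : Fin s → Freq d) :
    Submodule ℂ (SampleSpace d m) :=
  Submodule.span ℂ (Set.range fun l => steering m (θ l))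

lemma steering_mem_signalSpace {d m s : ℕ} (θ : Fin s → Freq d) (l : Fin s) :
    steering m (θ l) ∈ signalSpace m θ := Submodule.subset_span ⟨l, rfl⟩

/-- The consequences of the separation of the frequencies on which the analysis of the landscape
rests: near `θ_l`, the projection onto the signal space is almost the projection onto the steering
vector of `θ_l`, and every frequency has such a partner `θ_l`. -/
structure WellSeparated {d s : ℕ} (m : ℕ) (θ : Fin s → Freq d) : Prop where
  near : ∀ l ω, ‖ω - θ l‖ ≤ 2 / m →
    ‖residual (signalSpace m θ) (steering m (θ l)) (steering m ω)‖ ≤ 1 / (3840 * d)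
  cover : ∀ ω, ∃ l,
    ‖residual (signalSpace m θ) (steering m (θ l)) (steering m ω)‖ ≤ 1 / (3840 * d)

lemma torusDist_neg {d : ℕ} (a b : Freq d) : torusDist (-a) (-b) = torusDist a b := by
  have key : ∀ a b : Freq d, torusDist (-a) (-b) ≤ torusDist a b := fun a b => by
    obtain ⟨n, hn⟩ := exists_torusDist_eq a b
    have h := torusDist_le (-a) (-b) (-n)
    rwa [latticePoint_neg, show -a - -b + -latticePoint n = -(a - b + latticePoint n) by abel,
      norm_neg, ← hn] at h
  refine le_antisymm (key a b) ?_
  simpa using key (-a) (-b)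

/-- A separation of order `1/m` suffices for all the properties of the frequencies that are used.
The signs `-θ_l` occur because the right singular vectors of the Hankel matrix of the signal are
the conjugates of the left ones. -/
theorem exists_separation {d : ℕ} (hd : 1 ≤ d) : ∃ β : ℝ, 8 ≤ β ∧
    ∀ {m s : ℕ}, 1 ≤ m → 1 ≤ s → ∀ θ : Fin s → Freq d,
      (∀ j k, j ≠ k → β / m ≤ torusDist (θ j) (θ k)) →
      WellSeparated m θ ∧ NearlyOrthonormal (1 / 4) (fun l => steering m (θ l)) ∧
        NearlyOrthonormal (1 / 4) fun l => steering m (-θ l) := by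
  have hd0 : (1 : ℝ) ≤ d := by exact_mod_cast hd
  set δ : ℝ := 1 / (23040 * d) with hδ
  have hδ0 : 0 < δ := by positivity
  have hδ4 : δ ≤ 1 / 4 := by
    rw [hδ, div_le_div_iff₀ (by positivity) (by norm_num)]; linarith
  obtain ⟨B, hB, hgram⟩ := exists_abs_norm_sq_sum_steering_sub_le d hδ0 (by linarith)
  -- half of the separation `(2 B + 8) / m` still exceeds `B / m`, so that a frequency which
  -- replaces its nearest `θ_l` leaves the family separated
  refine ⟨2 * B + 8, by linarith, fun {m s} hm hs θ hsep => ?_⟩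
  have hm0 : (0 : ℝ) < m := by exact_mod_cast hm
  have hB1 : B / m ≤ (2 * B + 8) / m := by gcongr; linarith
  have hB2 : (2 * B + 8) / m = 2 * (B / m) + 8 / m := by ring
  have hθ : NearlyOrthonormal δ fun l => steering m (θ l) :=
    hgram m hm θ fun j k hjk => hB1.trans (hsep j k hjk)
  have hmono : ∀ φ : Fin s → SampleSpace d m, NearlyOrthonormal δ φ →
      NearlyOrthonormal (1 / 4) φ := fun φ h c =>
    (h c).trans (mul_le_mul_of_nonneg_right hδ4 (Finset.sum_nonneg fun j _ => sq_nonneg _))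
  have hfar : ∀ l ω, (∀ k, k ≠ l → B / m ≤ torusDist ω (θ k)) →
      ‖residual (signalSpace m θ) (steering m (θ l)) (steering m ω)‖ ≤ 1 / (3840 * d) := by
    intro l ω hω
    have h1 : NearlyOrthonormal δ
        (Function.update (fun l => steering m (θ l)) l (steering m ω)) := by
      have h2 : NearlyOrthonormal δ fun j => steering m (Function.update θ l ω j) := by
        refine hgram m hm _ fun j k hjk => ?_
        rcases eq_or_ne j l with rfl | hj
        · rw [Function.update_self, Function.update_of_ne hjk.symm]
          exact hω k hjk.symm
        · rcases eq_or_ne k l with rfl | hk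
          · rw [Function.update_self, Function.update_of_ne hj, torusDist_comm]
            exact hω j hj
          · rw [Function.update_of_ne hj, Function.update_of_ne hk]
            exact hB1.trans (hsep j k hjk)
      have h3 : (fun j => steering m (Function.update θ l ω j))
          = Function.update (fun l => steering m (θ l)) l (steering m ω) :=
        funext fun j => by
          rcases eq_or_ne j l with rfl | hj
          · rw [Function.update_self, Function.update_self]
          · rw [Function.update_of_ne hj, Function.update_of_ne hj]
      rwa [h3] at h2
    refine (norm_residual_le_of_update hδ0.le (by linarith) hθ (fun j => norm_steering _) l
      (norm_steering ω) h1).trans (le_of_eq ?_)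
    rw [hδ]; field_simp; norm_num
  refine ⟨⟨fun l ω hω => hfar l ω fun k hk => ?_, fun ω => ?_⟩, hmono _ hθ, hmono _ ?_⟩
  · have h1 := hsep l k hk.symm
    have h2 := torusDist_triangle (θ l) ω (θ k)
    have h3 := (torusDist_comm (θ l) ω).le.trans (torusDist_le_norm ω (θ l))
    have h4 : (0 : ℝ) < B / m := by positivity
    have h5 : (2 : ℝ) / m ≤ 8 / m := by gcongr; norm_num
    linarith
  · have : Nonempty (Fin s) := ⟨⟨0, hs⟩⟩
    obtain ⟨l, hl⟩ := Finite.exists_min fun l => torusDist ω (θ l)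
    refine ⟨l, hfar l ω fun k hk => ?_⟩
    -- the nearest frequency is `θ_l`, so the distance to `θ_k` is at least half the separation
    have h1 := hsep l k hk.symm
    have h2 := torusDist_triangle (θ l) ω (θ k)
    rw [torusDist_comm (θ l) ω] at h2
    have h3 := hl k
    have h4 : (0 : ℝ) < 8 / m := by positivity
    linarith
  · exact hgram m hm _ fun j k hjk => by
      rw [torusDist_neg]; exact hB1.trans (hsep j k hjk)

section Landscape

variable {d m s : ℕ} {θ : Fin s → Freq d}

lemma norm_residual_steerDeriv_le (hd : 1 ≤ d) (hm : 1 ≤ m) (hθ : WellSeparated m θ) {l : Fin s}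
    {ω : Freq d} (hω : ‖ω - θ l‖ ≤ 1 / m) (u : Freq d) :
    ‖residual (signalSpace m θ) (steering m (θ l)) (steerDeriv m ω u)‖ ≤ 1 / 2 * m * ‖u‖ := by
  have hd0 : (1 : ℝ) ≤ d := by exact_mod_cast hd
  have hm0 : (0 : ℝ) < m := by exact_mod_cast hm
  set Q := residual (signalSpace m θ) (steering m (θ l)) with hQ
  rcases eq_or_ne u 0 with rfl | hu
  · simp
  have hu0 : 0 < ‖u‖ := norm_pos_iff.2 hu
  -- a difference quotient with step `1 / (480 d m)` balances the two error terms
  set σ : ℝ := 1 / (480 * d * m * ‖u‖) with hσ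
  have hσ0 : 0 < σ := by positivity
  have hσu : ‖σ • u‖ = 1 / (480 * d * m) := by
    rw [norm_smul, Real.norm_of_nonneg hσ0.le, hσ]; field_simp
  have h1 : Q (steerDeriv m ω (σ • u)) = Q (steering m (ω + σ • u)) - Q (steering m ω)
      - Q (steering m (ω + σ • u) - steering m ω - steerDeriv m ω (σ • u)) := by
    simp only [map_sub]; abel
  have h2 : ‖Q (steering m (ω + σ • u))‖ ≤ 1 / (3840 * d) := by
    refine hθ.near l _ ?_
    rw [add_sub_right_comm]
    refine (norm_add_le _ _).trans ?_
    rw [hσu]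
    have : 1 / (480 * d * m) ≤ 1 / (m : ℝ) := by
      gcongr
      nlinarith
    have e : (2 : ℝ) / m = 1 / m + 1 / m := by ring
    linarith
  have h3 : ‖Q (steering m ω)‖ ≤ 1 / (3840 * d) := by
    refine hθ.near l _ (hω.trans ?_)
    gcongr; norm_num
  have h4 : ‖Q (steering m (ω + σ • u) - steering m ω - steerDeriv m ω (σ • u))‖
      ≤ 120 * d * m ^ 2 * (1 / (480 * d * m)) ^ 2 := by
    refine (norm_residual_le (steering_mem_signalSpace θ l) (norm_steering _) _).trans ?_
    rw [← hσu]
    exact norm_steering_taylor_le _ _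
  have h5 : σ * ‖Q (steerDeriv m ω u)‖ ≤ 1 / (960 * d) := by
    have h6 : ‖Q (steerDeriv m ω (σ • u))‖ = σ * ‖Q (steerDeriv m ω u)‖ := by
      rw [map_smul, ContinuousLinearMap.map_smul_of_tower, norm_smul, Real.norm_of_nonneg hσ0.le]
    rw [← h6, h1]
    refine (norm_sub_le _ _).trans ((add_le_add_left (norm_sub_le _ _) _).trans ?_)
    have e1 : 120 * (d : ℝ) * m ^ 2 * (1 / (480 * d * m)) ^ 2 = 1 / (1920 * d) := by
      field_simp; norm_num
    have e2 : 1 / (960 * (d : ℝ)) = 1 / (3840 * d) + 1 / (3840 * d) + 1 / (1920 * d) := by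
      field_simp; norm_num
    rw [e1] at h4
    linarith
  have h6 : σ * ‖Q (steerDeriv m ω u)‖ ≤ σ * (1 / 2 * m * ‖u‖) := by
    refine h5.trans (le_of_eq ?_)
    rw [hσ]; field_simp; norm_num
  exact le_of_mul_le_mul_left h6 hσ0

lemma norm_residual_steering_le (hd : 1 ≤ d) (hm : 1 ≤ m) (hθ : WellSeparated m θ) {l : Fin s}
    {ω : Freq d} (hω : ‖ω - θ l‖ ≤ 1 / m) :
    ‖residual (signalSpace m θ) (steering m (θ l)) (steering m ω)‖ ≤ 1 / 2 * m * ‖ω - θ l‖ := by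
  set Q := residual (signalSpace m θ) (steering m (θ l)) with hQ
  set t := ω - θ l with ht
  have hder : ∀ x ∈ Set.Icc (0 : ℝ) 1, HasDerivWithinAt
      (fun x : ℝ => Q (steering m (θ l + x • t))) (Q (steerDeriv m (θ l + x • t) t))
      (Set.Icc 0 1) x := fun x _ => by
    have h := ((Q.restrictScalars ℝ).hasFDerivAt.comp_hasDerivAt x
      (hasDerivAt_steering (m := m) (θ l) t x))
    exact h.hasDerivWithinAt
  have h := norm_image_sub_le_of_norm_deriv_le_segment_01' hder
    (C := 1 / 2 * m * ‖t‖) fun x hx => norm_residual_steerDeriv_le hd hm hθ (by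
      rw [add_sub_cancel_left, norm_smul, Real.norm_of_nonneg hx.1]
      exact (mul_le_of_le_one_left (norm_nonneg _) hx.2.le).trans hω) t
  have h0 : Q (steering m (θ l)) = 0 :=
    residual_self (steering_mem_signalSpace θ l) (norm_steering _)
  simp only [one_smul, zero_smul, add_zero, h0, sub_zero] at h
  rwa [show θ l + t = ω by rw [ht]; abel] at h

lemma music_signalSpace_eq (l : Fin s) (ω : Freq d) :
    music (signalSpace m θ) ω = 1 - correlation m (ω - θ l) ^ 2
      - ‖residual (signalSpace m θ) (steering m (θ l)) (steering m ω)‖ ^ 2 := by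
  have h1 := inner_starProjection_eq_add (steering_mem_signalSpace (m := m) θ l) (norm_steering _)
    (steering m ω) (steering m ω)
  have h2 := congrArg Complex.re h1
  rw [inner_starProjection_self, Complex.ofReal_re, Complex.add_re] at h2
  have h3 := inner_self_eq_norm_sq (𝕜 := ℂ)
    (residual (signalSpace m θ) (steering m (θ l)) (steering m ω))
  rw [RCLike.re_eq_complex_re] at h3
  have h4 : (inner ℂ (steering m ω) (steering m (θ l)) * inner ℂ (steering m (θ l)) (steering m ω)
      : ℂ).re = correlation m (ω - θ l) ^ 2 := by
    rw [← inner_conj_symm (steering m ω), inner_steering_eq, Complex.conj_ofReal,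
      ← Complex.ofReal_mul, Complex.ofReal_re, sq]
  rw [music_eq, h2, h3, h4]
  ring

variable {W : Submodule ℂ (SampleSpace d m)} {ε : ℝ}

/-- The projections onto `U` and onto `W` are within `ε` of each other. -/
def ProjectionsClose (U W : Submodule ℂ (SampleSpace d m)) (ε : ℝ) : Prop :=
  ∀ x y, ‖inner ℂ x (U.starProjection y - W.starProjection y)‖ ≤ ε * ‖x‖ * ‖y‖

lemma abs_music_sub_le {U : Submodule ℂ (SampleSpace d m)} (hW : ProjectionsClose U W ε)
    (ω : Freq d) : |music W ω - music U ω| ≤ ε := by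
  have h := hW (steering m ω) (steering m ω)
  rw [norm_steering, mul_one, mul_one] at h
  have h1 : music W ω - music U ω
      = (inner ℂ (steering m ω)
        (U.starProjection (steering m ω) - W.starProjection (steering m ω))).re := by
    rw [music, music, inner_sub_right, inner_sub_right, inner_sub_right, Complex.sub_re,
      Complex.sub_re, Complex.sub_re]
    ring
  rw [h1]
  exact (Complex.abs_re_le_norm _).trans h

/-- Near `θ_l` the gradient of the perturbed MUSIC function is a positive diagonal matrix applied to
`ω - θ_l`, up to small errors. -/
lemma exists_gradient_music (hd : 1 ≤ d) (hm : 1 ≤ m) (hθ : WellSeparated m θ) (hε : 0 ≤ ε)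
    (hW : ProjectionsClose (signalSpace m θ) W ε) {l : Fin s} {ω : Freq d}
    (hω : ‖ω - θ l‖ ≤ 1 / (20 * m)) :
    ∃ b : Fin d → ℝ, (∀ i, curvature m ≤ b i) ∧ (∀ i, b i ≤ 2 * curvature m) ∧
      ∀ u : Freq d, |inner ℝ (gradient (music W) ω) u - ∑ i, b i * (ω - θ l) i * u i|
        ≤ (1 / 2 * m ^ 2 * ‖ω - θ l‖ + 11 * m * ε) * ‖u‖ := by
  have hm0 : (0 : ℝ) < m := by exact_mod_cast hm
  obtain ⟨b, hb1, hb2, hb⟩ := exists_hasDerivAt_correlation hm hω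
  refine ⟨b, hb1, hb2, fun u => ?_⟩
  have hω1 : ‖ω - θ l‖ ≤ 1 / m := hω.trans (by gcongr; linarith)
  obtain ⟨D, hD, hDb⟩ := hb u
  set U := signalSpace m θ with hU
  set φ := steering m (θ l) with hφ
  set v := steerDeriv m ω u with hv
  have hinner : inner ℂ φ v = (D : ℂ) := by
    have h1 : HasDerivAt (fun x : ℝ => inner ℂ φ (steering m (ω + x • u))) (inner ℂ φ v) 0 := by
      have h2 := (((innerSL ℂ φ).restrictScalars ℝ).hasFDerivAt.comp_hasDerivAt (0 : ℝ)
        (hasDerivAt_steering (m := m) ω u 0))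
      rw [zero_smul, add_zero] at h2
      exact h2
    have h3 : HasDerivAt (fun x : ℝ => inner ℂ φ (steering m (ω + x • u))) (D : ℂ) 0 := by
      have h4 := hD.ofReal_comp
      refine h4.congr_of_eventuallyEq (Filter.Eventually.of_forall fun x => ?_)
      simp only [hφ, inner_steering_eq, add_sub_right_comm]
    exact h1.unique h3
  have hmain : -2 * (inner ℂ v (U.starProjection (steering m ω))).re
      = ∑ i, b i * (ω - θ l) i * u i
        + -2 * (inner ℂ (residual U φ v) (residual U φ (steering m ω))).re := by
    rw [inner_starProjection_eq_add (steering_mem_signalSpace θ l) (norm_steering _),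
      Complex.add_re, ← inner_conj_symm v, hinner, Complex.conj_ofReal, inner_steering_eq,
      ← Complex.ofReal_mul, Complex.ofReal_re, ← hDb]
    ring
  have hres : |(inner ℂ (residual U φ v) (residual U φ (steering m ω))).re|
      ≤ (1 / 2 * m * ‖u‖) * (1 / 2 * m * ‖ω - θ l‖) := by
    refine (Complex.abs_re_le_norm _).trans ((norm_inner_le_norm _ _).trans ?_)
    exact mul_le_mul (norm_residual_steerDeriv_le hd hm hθ hω1 u)
      (norm_residual_steering_le hd hm hθ hω1) (norm_nonneg _) (by positivity)
  have hnoise : |(inner ℂ v (U.starProjection (steering m ω) -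
      W.starProjection (steering m ω))).re| ≤ ε * (11 / 2 * m * ‖u‖) := by
    refine (Complex.abs_re_le_norm _).trans ((hW _ _).trans ?_)
    rw [norm_steering, mul_one]
    exact mul_le_mul_of_nonneg_left (norm_steerDeriv_le hm ω u) hε
  rw [inner_gradient_music]
  rw [inner_sub_right, Complex.sub_re] at hnoise
  rw [abs_le] at *
  constructor <;> nlinarith

/-- One step of gradient descent contracts the distance to the frequency, up to the noise. -/
lemma norm_gradStep_sub_le (hd : 1 ≤ d) (hm : 1 ≤ m) (hθ : WellSeparated m θ) (hε : 0 ≤ ε)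
    (hW : ProjectionsClose (signalSpace m θ) W ε) {l : Fin s} {ω : Freq d}
    (hω : ‖ω - θ l‖ ≤ 1 / (20 * m)) {h : ℝ} (hh1 : 3 / (32 * Real.pi ^ 2) / (m : ℝ) ^ 2 ≤ h)
    (hh2 : h ≤ 3 / (16 * Real.pi ^ 2) / (m : ℝ) ^ 2) :
    ‖gradStep (music W) h ω - θ l‖ ≤ 15 / 16 * ‖ω - θ l‖ + 11 / 50 * (ε / m) := by
  have hm0 : (0 : ℝ) < m := by exact_mod_cast hm
  have hπ := pi_sq_gt
  obtain ⟨b, hb1, hb2, hb⟩ := exists_gradient_music hd hm hθ hε hW hω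
  have hh0 : 0 ≤ h := le_trans (by positivity) hh1
  set t := ω - θ l with ht
  set w₁ : Freq d := WithLp.toLp 2 fun i => (1 - h * b i) * t i with hw₁
  have hcurv0 : 0 ≤ curvature m := by unfold curvature; positivity
  -- the coefficients `b i` lie between `4π²m²/3` and `16π²m²/3`, so `1/8 ≤ h b i ≤ 1`
  have hhb : ∀ i, |1 - h * b i| ≤ 7 / 8 := fun i => by
    have h1 : h * b i ≤ 1 := by
      have h2 : b i ≤ 2 * (8 * Real.pi ^ 2 / 3 * (m : ℝ) ^ 2) :=
        (hb2 i).trans (by linarith [curvature_le hm])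
      calc h * b i ≤ 3 / (16 * Real.pi ^ 2) / (m : ℝ) ^ 2
            * (2 * (8 * Real.pi ^ 2 / 3 * (m : ℝ) ^ 2)) :=
            mul_le_mul hh2 h2 (hcurv0.trans (hb1 i)) (by positivity)
        _ = 1 := by field_simp; norm_num
    have h3 : 1 / 8 ≤ h * b i := by
      have h4 : 4 * Real.pi ^ 2 / 3 * (m : ℝ) ^ 2 ≤ b i := by
        refine le_trans ?_ (hb1 i)
        unfold curvature
        nlinarith
      calc (1 : ℝ) / 8 = 3 / (32 * Real.pi ^ 2) / (m : ℝ) ^ 2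
            * (4 * Real.pi ^ 2 / 3 * (m : ℝ) ^ 2) := by field_simp; norm_num
        _ ≤ h * b i := mul_le_mul hh1 h4 (by positivity) hh0
    rw [abs_le]; constructor <;> linarith
  have hw₁n : ‖w₁‖ ≤ 7 / 8 * ‖t‖ := by
    refine le_of_sq_le_sq ?_ (by positivity)
    rw [mul_pow, norm_sq_eq_sum_sq, norm_sq_eq_sum_sq, Finset.mul_sum]
    refine Finset.sum_le_sum fun i _ => ?_
    have : w₁ i = (1 - h * b i) * t i := rfl
    rw [this, mul_pow, ← sq_abs (1 - h * b i)]
    have := hhb i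
    gcongr
  set w := gradStep (music W) h ω - θ l with hw
  set K := 1 / 2 * (m : ℝ) ^ 2 * ‖t‖ + 11 * m * ε with hK
  have hdiff : ‖w - w₁‖ ≤ h * K := by
    have h1 : ∀ u : Freq d, inner ℝ (w - w₁) u
        = -h * (inner ℝ (gradient (music W) ω) u - ∑ i, b i * t i * u i) := fun u => by
      have h2 : w = t - h • gradient (music W) ω := by rw [hw, gradStep, ht]; abel
      have h3 : inner ℝ t u - inner ℝ w₁ u = h * ∑ i, b i * t i * u i := by
        rw [PiLp.inner_apply, PiLp.inner_apply, ← Finset.sum_sub_distrib, Finset.mul_sum]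
        refine Finset.sum_congr rfl fun i _ => ?_
        have : w₁ i = (1 - h * b i) * t i := rfl
        rw [this]
        simp only [RCLike.inner_apply, conj_trivial]
        ring
      rw [h2, inner_sub_left, inner_sub_left, real_inner_smul_left]
      linarith
    rcases eq_or_lt_of_le (norm_nonneg (w - w₁)) with h0 | h0
    · rw [← h0]; positivity
    · refine le_of_mul_le_mul_right ?_ h0
      rw [← sq, ← real_inner_self_eq_norm_sq, h1]
      refine (le_abs_self _).trans ?_
      rw [abs_mul, abs_neg, abs_of_nonneg hh0, mul_assoc]
      exact mul_le_mul_of_nonneg_left (hb _) hh0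
  have hhK : h * K ≤ 1 / 50 * (1 / 2 * ‖t‖ + 11 * (ε / m)) := by
    have h1 : h ≤ 1 / 50 / (m : ℝ) ^ 2 := by
      refine hh2.trans (div_le_div_of_nonneg_right ?_ (sq_nonneg _))
      rw [div_le_div_iff₀ (by positivity) (by norm_num)]
      nlinarith
    have h2 : K = (m : ℝ) ^ 2 * (1 / 2 * ‖t‖ + 11 * (ε / m)) := by rw [hK]; field_simp
    rw [h2]
    calc h * ((m : ℝ) ^ 2 * (1 / 2 * ‖t‖ + 11 * (ε / m)))
        ≤ 1 / 50 / (m : ℝ) ^ 2 * ((m : ℝ) ^ 2 * (1 / 2 * ‖t‖ + 11 * (ε / m))) := by gcongr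
      _ = _ := by field_simp
  have h3 : ‖w‖ ≤ ‖w₁‖ + ‖w - w₁‖ := by
    calc ‖w‖ = ‖w₁ + (w - w₁)‖ := by congr 1; abel
      _ ≤ _ := norm_add_le _ _
  have h4 : 0 ≤ ‖t‖ := norm_nonneg t
  linarith

lemma norm_gradient_music_ge (hd : 1 ≤ d) (hm : 1 ≤ m) (hθ : WellSeparated m θ) (hε : 0 ≤ ε)
    (hW : ProjectionsClose (signalSpace m θ) W ε) {l : Fin s} {ω : Freq d}
    (hω : ‖ω - θ l‖ ≤ 1 / (20 * m)) :
    12 * m ^ 2 * ‖ω - θ l‖ - 11 * m * ε ≤ ‖gradient (music W) ω‖ := by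
  obtain ⟨b, hb1, -, hb⟩ := exists_gradient_music hd hm hθ hε hW hω
  set t := ω - θ l with ht
  have h1 : 13 * (m : ℝ) ^ 2 * ‖t‖ ^ 2 ≤ ∑ i, b i * t i * t i := by
    rw [norm_sq_eq_sum_sq, Finset.mul_sum]
    refine Finset.sum_le_sum fun i _ => ?_
    have := (curvature_ge m).trans (hb1 i)
    nlinarith [sq_nonneg (t i)]
  have h2 := (abs_le.1 (hb t)).1
  have h3 := real_inner_le_norm (gradient (music W) ω) t
  rcases eq_or_lt_of_le (norm_nonneg t) with h0 | h0
  · rw [← h0, mul_zero, zero_sub]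
    have : 0 ≤ 11 * m * ε := by positivity
    linarith [norm_nonneg (gradient (music W) ω)]
  · refine le_of_mul_le_mul_right ?_ h0
    nlinarith [mul_nonneg (sq_nonneg (m : ℝ)) (sq_nonneg ‖t‖)]

lemma music_le_near (hm : 1 ≤ m) (hW : ProjectionsClose (signalSpace m θ) W ε) {l : Fin s}
    {ω : Freq d} (hω : ‖ω - θ l‖ ≤ 1 / (20 * m)) :
    music W ω ≤ 27 * (m * ‖ω - θ l‖) ^ 2 + ε := by
  have h1 := (abs_le.1 (abs_music_sub_le hW ω)).2
  have h2 := music_signalSpace_eq (m := m) (θ := θ) l ω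
  have h3 := one_sub_correlation_sq_le hm hω
  nlinarith [sq_nonneg ‖residual (signalSpace m θ) (steering m (θ l)) (steering m ω)‖]

/-- The sublevel sets of the perturbed MUSIC function lie near the frequencies. -/
lemma exists_torusDist_le_of_music_le (hd : 1 ≤ d) (hm : 1 ≤ m) (hθ : WellSeparated m θ)
    (hε : ε ≤ 1 / 2000) (hW : ProjectionsClose (signalSpace m θ) W ε) {ω : Freq d}
    (hω : music W ω ≤ 1 / 400) : ∃ l, torusDist ω (θ l) ≤ 1 / (20 * m) := by
  have hd0 : (1 : ℝ) ≤ d := by exact_mod_cast hd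
  have hm0 : (0 : ℝ) < m := by exact_mod_cast hm
  obtain ⟨l, hl⟩ := hθ.cover ω
  refine ⟨l, ?_⟩
  by_contra hcon
  push Not at hcon
  have h1 := (abs_le.1 (abs_music_sub_le hW ω)).1
  have h2 := music_signalSpace_eq (m := m) (θ := θ) l ω
  have h3 := correlation_sq_le hm (ω - θ l)
  rw [← torusDist_eq] at h3
  have h4 : ‖residual (signalSpace m θ) (steering m (θ l)) (steering m ω)‖ ^ 2
      ≤ (1 / 3840) ^ 2 := by
    refine pow_le_pow_left₀ (norm_nonneg _) (hl.trans ?_) 2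
    gcongr
    linarith
  have h5 : 1 / 100 ≤ min 1 (((2 * (m : ℝ) + 1) * torusDist ω (θ l)) ^ 2) := by
    refine le_min (by norm_num) ?_
    have h6 : 1 / 10 ≤ (2 * (m : ℝ) + 1) * torusDist ω (θ l) := by
      calc (1 : ℝ) / 10 = 2 * m * (1 / (20 * m)) := by field_simp; norm_num
        _ ≤ _ := by gcongr; linarith
    nlinarith
  linarith

end Landscape

/-! ### Gradient descent -/

section Descent

variable {d m s : ℕ} {θ : Fin s → Freq d} {W : Submodule ℂ (SampleSpace d m)} {ε : ℝ}

lemma gradStep_iterate_add_latticePoint (h : ℝ) (n : ℕ) (ω : Freq d) (k : Fin d → ℤ) :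
    (gradStep (music W) h)^[n] (ω + latticePoint k)
      = (gradStep (music W) h)^[n] ω + latticePoint k := by
  induction n generalizing ω with
  | zero => rfl
  | succ n ih =>
    rw [Function.iterate_succ_apply, Function.iterate_succ_apply, ← ih]
    congr 1
    rw [gradStep, gradStep, gradient_add_latticePoint]; abel

/-- A representative of the class of `g` at the torus distance from `ω`. -/
lemma exists_lift (g ω : Freq d) : ∃ k : Fin d → ℤ, ‖g + latticePoint k - ω‖ = torusDist g ω := by
  obtain ⟨k, hk⟩ := exists_torusDist_eq g ω
  exact ⟨k, by rw [hk]; congr 1; abel⟩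

/-- Gradient descent from any point within `1 / (20 m)` of a frequency. The limit accuracy `4 ε / m`
exceeds the fixed point `88/25 · ε / m` of the recursion with rate `15/16` and increment
`11/50 · ε / m`. -/
theorem torusDist_gradStep_iterate_le (hd : 1 ≤ d) (hm : 1 ≤ m) (hθ : WellSeparated m θ)
    (hε : 0 ≤ ε) (hε1 : ε ≤ 1 / 2000) (hW : ProjectionsClose (signalSpace m θ) W ε) {l : Fin s}
    {ω : Freq d} (hω : torusDist ω (θ l) ≤ 1 / (20 * m)) {h : ℝ}
    (hh1 : 3 / (32 * Real.pi ^ 2) / (m : ℝ) ^ 2 ≤ h)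
    (hh2 : h ≤ 3 / (16 * Real.pi ^ 2) / (m : ℝ) ^ 2) (n : ℕ) :
    torusDist (θ l) ((gradStep (music W) h)^[n] ω) ≤ ((15 / 16) ^ n + 4 * ε) / m := by
  have hm0 : (0 : ℝ) < m := by exact_mod_cast hm
  obtain ⟨k, hk⟩ := exists_lift ω (θ l)
  rw [← hk] at hω
  rw [torusDist_comm, ← torusDist_add_latticePoint_left _ _ k, ← gradStep_iterate_add_latticePoint]
  refine (torusDist_le_norm _ _).trans ?_
  set x := ω + latticePoint k with hx
  have hpow : ∀ n : ℕ, (0 : ℝ) ≤ (15 / 16 : ℝ) ^ n ∧ (15 / 16 : ℝ) ^ n ≤ 1 := fun n =>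
    ⟨by positivity, pow_le_one₀ (by norm_num) (by norm_num)⟩
  have hmε : m * (ε / m) = ε := by field_simp
  have hm20 : m * (1 / (20 * (m : ℝ))) = 1 / 20 := by field_simp
  -- the iterates stay in the ball where the contraction estimate holds
  have key : ∀ n, m * ‖(gradStep (music W) h)^[n] x - θ l‖
      ≤ (15 / 16) ^ n * (1 / 20) + 88 / 25 * ε * (1 - (15 / 16) ^ n) := by
    intro n
    induction n with
    | zero =>
      simp only [Function.iterate_zero_apply, pow_zero, sub_self, mul_zero, one_mul, add_zero]
      calc m * ‖x - θ l‖ ≤ m * (1 / (20 * (m : ℝ))) := by gcongr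
        _ = 1 / 20 := hm20
    | succ n ih =>
      rw [Function.iterate_succ_apply']
      set y := (gradStep (music W) h)^[n] x with hy
      have hy1 : ‖y - θ l‖ ≤ 1 / (20 * m) := by
        refine le_of_mul_le_mul_left (ih.trans ?_) hm0
        rw [hm20]
        have := hpow n
        nlinarith
      have h1 := mul_le_mul_of_nonneg_left
        (norm_gradStep_sub_le hd hm hθ hε hW hy1 hh1 hh2) hm0.le
      rw [pow_succ]
      nlinarith
  rw [le_div_iff₀ hm0, mul_comm]
  refine (key n).trans ?_
  have := hpow n
  nlinarith

/-! ### Clusters of the thresholded grid -/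

lemma exists_gap (S : Finset ℝ) (c : ℝ) : ∃ e : ℝ, 0 < e ∧ ∀ x ∈ S, x ≤ c + e → x ≤ c := by
  classical
  induction S using Finset.induction_on with
  | empty => exact ⟨1, one_pos, by simp⟩
  | insert a S ha ih =>
    obtain ⟨e, he, h⟩ := ih
    rcases le_or_gt a c with hac | hac
    · refine ⟨e, he, fun x hx hxe => ?_⟩
      rcases Finset.mem_insert.1 hx with rfl | hx
      · exact hac
      · exact h x hx hxe
    · refine ⟨min e ((a - c) / 2), lt_min he (by linarith), fun x hx hxe => ?_⟩
      rcases Finset.mem_insert.1 hx with rfl | hx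
      · have := min_le_right e ((x - c) / 2)
        linarith
      · have := min_le_left e ((a - c) / 2)
        exact h x hx (by linarith)

/-- Walks in a finite set along which a function strictly decreases end at a point from which no
further step is needed. -/
lemma exists_reflTransGen_of_descent {α : Type*} (G : Finset α) (f : α → ℝ) (P Done : α → Prop)
    (R : α → α → Prop)
    (hstep : ∀ g ∈ G, P g → Done g ∨ ∃ g' ∈ G, P g' ∧ f g' < f g ∧ R g g') :
    ∀ g ∈ G, P g → ∃ g' ∈ G, P g' ∧ Done g' ∧ Relation.ReflTransGen R g g' := by
  classical
  have key : ∀ n : ℕ, ∀ g ∈ G, P g → (G.filter fun x => f x < f g).card ≤ n →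
      ∃ g' ∈ G, P g' ∧ Done g' ∧ Relation.ReflTransGen R g g' := by
    intro n
    induction n with
    | zero =>
      intro g hg hP hcard
      rcases hstep g hg hP with h | ⟨g', hg', -, hlt, -⟩
      · exact ⟨g, hg, hP, h, .refl⟩
      · have h0 := Finset.card_eq_zero.1 (Nat.le_zero.1 hcard)
        exact absurd (Finset.mem_filter.2 ⟨hg', hlt⟩) (by rw [h0]; simp)
    | succ n ih =>
      intro g hg hP hcard
      rcases hstep g hg hP with h | ⟨g', hg', hP', hlt, hR⟩
      · exact ⟨g, hg, hP, h, .refl⟩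
      · have hsub : (G.filter fun x => f x < f g') ⊂ G.filter fun x => f x < f g := by
          refine Finset.ssubset_iff_of_subset (fun x hx => ?_) |>.2 ⟨g', ?_, ?_⟩
          · rw [Finset.mem_filter] at hx ⊢
            exact ⟨hx.1, hx.2.trans hlt⟩
          · exact Finset.mem_filter.2 ⟨hg', hlt⟩
          · simp
        obtain ⟨g'', h1, h2, h3, h4⟩ := ih g' hg' hP'
          (by have := Finset.card_lt_card hsub; omega)
        exact ⟨g'', h1, h2, h3, .head hR h4⟩
  exact fun g hg hP => key _ g hg hP le_rfl

/-- A grid point near a point at distance `μ + e` from `x` in the direction of `-ν`: it lies in the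
ball of radius `μ` that touches, up to `e`, the hyperplane through `x` orthogonal to `ν`. -/
lemma exists_mem_grid_toward {G : Finset (Freq d)} (hG : G.Nonempty) {e : ℝ} (he : 0 < e)
    (x : Freq d) {ν : Freq d} (hν : ‖ν‖ = 1) :
    ∃ g ∈ G, ∃ k : Fin d → ℤ, ∃ v : Freq d, g + latticePoint k = x + v ∧ v ≠ 0 ∧
      ‖v‖ ≤ 2 * mesh G + e ∧ ‖v + (mesh G + e) • ν‖ ≤ mesh G := by
  have hμ := mesh_nonneg hG
  obtain ⟨g, hg, hgd⟩ := exists_mem_torusDist_le_mesh hG (x - (mesh G + e) • ν)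
  obtain ⟨k, hk⟩ := exists_lift g (x - (mesh G + e) • ν)
  rw [torusDist_comm, hk.symm] at hgd
  have h1 : ‖(mesh G + e) • ν‖ = mesh G + e := by
    rw [norm_smul, hν, mul_one, Real.norm_of_nonneg (by linarith)]
  have h2 : ‖(g + latticePoint k - x) + (mesh G + e) • ν‖ ≤ mesh G := by
    convert hgd using 2; abel
  refine ⟨g, hg, k, g + latticePoint k - x, by abel, fun h0 => ?_, ?_, h2⟩
  · rw [h0, zero_add, h1] at h2; linarith
  · calc ‖g + latticePoint k - x‖
        = ‖(g + latticePoint k - x + (mesh G + e) • ν) - (mesh G + e) • ν‖ := by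
          rw [add_sub_cancel_right]
      _ ≤ mesh G + (mesh G + e) := (norm_sub_le _ _).trans (add_le_add h2 h1.le)
      _ = _ := by ring

/-- Away from the frequency, some grid point within twice the mesh norm has a smaller value: the
ball of radius `mesh G` about the point at distance `mesh G + e` from `g` down the gradient contains
a grid point, and it lies in the sublevel set because its curvature exceeds that of the level set.
A descent over such small steps is possible since the gradient is at least `m / 200` here. -/
lemma exists_lower_neighbor (hd : 1 ≤ d) (hm : 1 ≤ m) (hθ : WellSeparated m θ) (hε : 0 ≤ ε)
    (hε1 : ε ≤ 1 / 2000) (hW : ProjectionsClose (signalSpace m θ) W ε) {G : Finset (Freq d)}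
    (hG : G.Nonempty) {e : ℝ} (he : 0 < e) (hmesh : mesh G + e ≤ 1 / (125000 * d) / m)
    {l : Fin s} {g : Freq d} (hg : torusDist g (θ l) ≤ 1 / (20 * m))
    (hg' : 1 / (1000 * m) < torusDist g (θ l)) :
    ∃ g' ∈ G, music W g' < music W g ∧ torusDist g g' ≤ 2 * mesh G + e := by
  have hd0 : (1 : ℝ) ≤ d := by exact_mod_cast hd
  have hm0 : (0 : ℝ) < m := by exact_mod_cast hm
  have hμ := mesh_nonneg hG
  obtain ⟨k, hk⟩ := exists_lift g (θ l)
  set x := g + latticePoint k with hx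
  rw [← hk] at hg hg'
  have hgrad := norm_gradient_music_ge hd hm hθ hε hW hg
  set D := gradient (music W) x with hD
  have hD1 : m / 200 ≤ ‖D‖ := by
    refine le_trans ?_ hgrad
    have h1 : (m : ℝ) / 1000 ≤ m ^ 2 * ‖x - θ l‖ := by
      calc (m : ℝ) / 1000 = m ^ 2 * (1 / (1000 * m)) := by field_simp
        _ ≤ _ := by gcongr
    nlinarith
  have hD0 : 0 < ‖D‖ := lt_of_lt_of_le (by positivity) hD1
  set ν := ‖D‖⁻¹ • D with hν
  have hν1 : ‖ν‖ = 1 := by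
    rw [hν, norm_smul, norm_inv, norm_norm, inv_mul_cancel₀ hD0.ne']
  obtain ⟨g', hgG, k', v, hv, hv0, hvn, hvν⟩ := exists_mem_grid_toward hG he x hν1
  refine ⟨g', hgG, ?_, ?_⟩
  · have h1 := music_add_le W x v
    rw [← hv, music_add_latticePoint, hx, music_add_latticePoint, ← hx, ← hD] at h1
    set R := mesh G + e with hR
    have hR0 : 0 < R := by linarith
    have hvpos : 0 < ‖v‖ ^ 2 := by have := norm_pos_iff.2 hv0; positivity
    have h2 : ‖v‖ ^ 2 + 2 * R * inner ℝ ν v ≤ 0 := by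
      have h3 := pow_le_pow_left₀ (norm_nonneg _) hvν 2
      rw [norm_add_sq_real, norm_smul, hν1, mul_one, Real.norm_of_nonneg hR0.le,
        real_inner_smul_right, real_inner_comm] at h3
      nlinarith
    have h4 : inner ℝ D v = ‖D‖ * inner ℝ ν v := by
      rw [hν, real_inner_smul_left, ← mul_assoc, mul_inv_cancel₀ hD0.ne', one_mul]
    have h5 : 560 * d * m ^ 2 * R < ‖D‖ := by
      refine lt_of_lt_of_le ?_ hD1
      calc 560 * (d : ℝ) * (m : ℝ) ^ 2 * R
          ≤ 560 * d * (m : ℝ) ^ 2 * (1 / (125000 * d) / m) := by gcongr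
        _ = 560 / 125000 * (m : ℝ) := by field_simp
        _ < m / 200 := by linarith
    rw [h4] at h1
    have h6 : 2 * R * (‖D‖ * inner ℝ ν v + 280 * d * m ^ 2 * ‖v‖ ^ 2)
        ≤ -‖D‖ * ‖v‖ ^ 2 + 560 * d * m ^ 2 * R * ‖v‖ ^ 2 := by
      nlinarith [mul_le_mul_of_nonneg_left h2 hD0.le]
    have h7 : 560 * d * m ^ 2 * R * ‖v‖ ^ 2 < ‖D‖ * ‖v‖ ^ 2 := mul_lt_mul_of_pos_right h5 hvpos
    have h8 : ‖D‖ * inner ℝ ν v + 280 * d * m ^ 2 * ‖v‖ ^ 2 < 0 := by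
      by_contra hcon
      push Not at hcon
      have := mul_nonneg (by linarith : (0 : ℝ) ≤ 2 * R) hcon
      linarith
    linarith
  · rw [← torusDist_add_latticePoint_left g g' k, ← torusDist_add_latticePoint_right _ g' k', hv,
      ← hx]
    refine (torusDist_le_norm _ _).trans ?_
    rw [sub_add_cancel_left, norm_neg]
    exact hvn

/-- Some grid point within twice the mesh norm is closer to `ω`. -/
lemma exists_closer_neighbor {G : Finset (Freq d)} (hG : G.Nonempty) {e : ℝ} (he : 0 < e)
    {ω g : Freq d} (hg : mesh G + e ≤ torusDist g ω) :
    ∃ g' ∈ G, torusDist g' ω < torusDist g ω ∧ torusDist g g' ≤ 2 * mesh G + e := by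
  have hμ := mesh_nonneg hG
  obtain ⟨k, hk⟩ := exists_lift g ω
  set x := g + latticePoint k with hx
  rw [← hk] at hg ⊢
  have hx0 : 0 < ‖x - ω‖ := by linarith
  set ν := ‖x - ω‖⁻¹ • (x - ω) with hν
  have hν1 : ‖ν‖ = 1 := by
    rw [hν, norm_smul, norm_inv, norm_norm, inv_mul_cancel₀ hx0.ne']
  have hxν : x - ω = ‖x - ω‖ • ν := by rw [hν, smul_inv_smul₀ hx0.ne']
  obtain ⟨g', hgG, k', v, hv, -, hvn, hvν⟩ := exists_mem_grid_toward hG he x hν1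
  refine ⟨g', hgG, ?_, ?_⟩
  · rw [← torusDist_add_latticePoint_left _ _ k', hv]
    refine (torusDist_le_norm _ _).trans_lt ?_
    have h1 : x + v - ω = (v + (mesh G + e) • ν) + (‖x - ω‖ - (mesh G + e)) • ν := by
      rw [sub_smul, ← hxν]; abel
    rw [h1]
    refine (norm_add_le _ _).trans_lt ?_
    rw [norm_smul (‖x - ω‖ - (mesh G + e)), hν1, mul_one, Real.norm_of_nonneg (by linarith)]
    linarith
  · rw [← torusDist_add_latticePoint_left g g' k, ← torusDist_add_latticePoint_right _ g' k', hv,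
      ← hx]
    refine (torusDist_le_norm _ _).trans ?_
    rw [sub_add_cancel_left, norm_neg]
    exact hvn

lemma sameCluster_symm {S : Set (Freq d)} {r : ℝ} {g g' : Freq d} (h : SameCluster S r g g') :
    SameCluster S r g' g := by
  induction h with
  | refl => exact .refl
  | tail _ hstep ih =>
    exact .head ⟨hstep.2.1, hstep.1, by rw [torusDist_comm]; exact hstep.2.2⟩ ih

/-- If the noise moves the projection by at most `ε`, then Gradient-MUSIC converges to the
frequencies at a linear rate, up to an error of order `ε/m`. -/
theorem recovers_of_projectionsClose (hd : 1 ≤ d) (hm : 1 ≤ m) (hθ : WellSeparated m θ) {β : ℝ}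
    (hβ : 8 ≤ β) (hsep : ∀ j k, j ≠ k → β / m ≤ torusDist (θ j) (θ k)) (hε : 0 ≤ ε)
    (hε1 : ε ≤ 1 / 2000) (hW : ProjectionsClose (signalSpace m θ) W ε) {G : Finset (Freq d)}
    (hG : G.Nonempty) (hmesh : mesh G ≤ 1 / (250000 * d) / m) {r α h : ℝ} (hr : 2 * mesh G ≤ r)
    (hr' : r ≤ 1 / m) (hα : 1 / 800 ≤ α) (hα' : α ≤ 1 / 400)
    (hh1 : 3 / (32 * Real.pi ^ 2) / (m : ℝ) ^ 2 ≤ h)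
    (hh2 : h ≤ 3 / (16 * Real.pi ^ 2) / (m : ℝ) ^ 2) (n : ℕ) :
    Recovers θ (music W) G α r h n (((15 / 16) ^ n + 4 * ε) / m) := by
  have hd0 : (1 : ℝ) ≤ d := by exact_mod_cast hd
  have hm0 : (0 : ℝ) < m := by exact_mod_cast hm
  have hμ := mesh_nonneg hG
  set q := music W with hq
  set S := thresholded q G α with hS
  have hμsmall : mesh G ≤ 1 / (1000 * m) := by
    refine hmesh.trans ?_
    rw [div_div]
    gcongr
    linarith
  -- every point of the thresholded grid is near exactly one frequency
  have hlabel : ∀ g ∈ S, ∃ l, torusDist g (θ l) ≤ 1 / (20 * m) := fun g hg =>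
    exists_torusDist_le_of_music_le hd hm hθ hε1 hW (hg.2.trans hα')
  have huniq : ∀ g g' l l', torusDist g (θ l) ≤ 1 / (20 * m) → torusDist g' (θ l') ≤ 1 / (20 * m) →
      torusDist g g' ≤ 1 / m → l = l' := by
    intro g g' l l' h1 h2 h3
    by_contra hne
    have h4 := hsep l l' hne
    have h5 := torusDist_triangle (θ l) g (θ l')
    have h6 := torusDist_triangle g g' (θ l')
    rw [torusDist_comm (θ l) g] at h5
    have h7 : (8 : ℝ) / m ≤ β / m := by gcongr
    have h8 : (8 : ℝ) / m = 8 * (1 / m) := by ring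
    have h9 : 1 / (20 * (m : ℝ)) = 1 / 20 * (1 / m) := by field_simp
    have h10 : 0 < 1 / (m : ℝ) := by positivity
    linarith
  have hself : ∀ g : Freq d, torusDist g g ≤ 1 / m := fun g => by
    refine (torusDist_le_norm g g).trans ?_
    rw [sub_self, norm_zero]; positivity
  have hnear : ∀ g ∈ G, ∀ l, torusDist g (θ l) ≤ 1 / (1000 * m) → g ∈ S := by
    intro g hg l hgl
    refine ⟨hg, ?_⟩
    obtain ⟨k, hk⟩ := exists_lift g (θ l)
    have h1 : ‖g + latticePoint k - θ l‖ ≤ 1 / (20 * m) := by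
      rw [hk]; refine hgl.trans ?_; gcongr; norm_num
    have h2 := music_le_near hm hW h1
    rw [hk, music_add_latticePoint] at h2
    have h3 : m * torusDist g (θ l) ≤ 1 / 1000 := by
      calc m * torusDist g (θ l) ≤ m * (1 / (1000 * m)) := by gcongr
        _ = 1 / 1000 := by field_simp
    have h4 : 0 ≤ m * torusDist g (θ l) := mul_nonneg hm0.le (torusDist_nonneg _ _)
    rw [hq]
    nlinarith
  -- a margin that does not create new pairs of grid points within `2 mesh G`
  obtain ⟨e₁, he₁, hgap₁⟩ := exists_gap ((G ×ˢ G).image fun p => torusDist p.1 p.2) (2 * mesh G)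
  have hgap₁' : ∀ g ∈ G, ∀ g' ∈ G, torusDist g g' ≤ 2 * mesh G + e₁ → torusDist g g' ≤ 2 * mesh G :=
    fun g hg g' hg' => hgap₁ _ (Finset.mem_image.2 ⟨(g, g'), Finset.mk_mem_product hg hg', rfl⟩)
  obtain ⟨e₂, he₂, hgap₂⟩ := exists_gap
    ((G ×ˢ Finset.univ).image fun p : Freq d × Fin s => torusDist p.1 (θ p.2)) (mesh G)
  have hgap₂' : ∀ g ∈ G, ∀ l, torusDist g (θ l) ≤ mesh G + e₂ → torusDist g (θ l) ≤ mesh G :=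
    fun g hg l => hgap₂ _
      (Finset.mem_image.2 ⟨(g, l), Finset.mk_mem_product hg (Finset.mem_univ l), rfl⟩)
  set e := min (min e₁ e₂) (1 / (250000 * d) / m) with he
  have he0 : 0 < e := lt_min (lt_min he₁ he₂) (by positivity)
  have hee₁ : e ≤ e₁ := (min_le_left _ _).trans (min_le_left _ _)
  have hee₂ : e ≤ e₂ := (min_le_left _ _).trans (min_le_right _ _)
  have hmeshe : mesh G + e ≤ 1 / (125000 * d) / m := by
    have h1 : e ≤ 1 / (250000 * d) / m := min_le_right _ _
    have h2 : 1 / (125000 * (d : ℝ)) / m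
        = 1 / (250000 * d) / m + 1 / (250000 * d) / m := by field_simp; norm_num
    linarith
  -- descent along the MUSIC function to the vicinity of the frequency
  have hdesc₁ : ∀ l, ∀ g ∈ G, (g ∈ S ∧ torusDist g (θ l) ≤ 1 / (20 * m)) →
      ∃ g' ∈ G, (g' ∈ S ∧ torusDist g' (θ l) ≤ 1 / (20 * m)) ∧
        torusDist g' (θ l) ≤ 1 / (1000 * m) ∧ SameCluster S r g g' := fun l =>
    exists_reflTransGen_of_descent G q (fun g => g ∈ S ∧ torusDist g (θ l) ≤ 1 / (20 * m))
      (fun g => torusDist g (θ l) ≤ 1 / (1000 * m)) _ fun g hg hP => by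
        rcases le_or_gt (torusDist g (θ l)) (1 / (1000 * m)) with hdone | hdone
        · exact Or.inl hdone
        · obtain ⟨g', hg', hlt, hdist⟩ :=
            exists_lower_neighbor hd hm hθ hε hε1 hW hG he0 hmeshe hP.2 hdone
          have h1 := hgap₁' g hg g' hg' (hdist.trans (by linarith))
          have h2 : g' ∈ S := ⟨hg', hlt.le.trans hP.1.2⟩
          obtain ⟨l', hl'⟩ := hlabel g' h2
          have h3 := huniq g g' l l' hP.2 hl' ((h1.trans hr).trans hr')
          exact Or.inr ⟨g', hg', ⟨h2, h3 ▸ hl'⟩, hlt, hP.1, h2, h1.trans hr⟩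
  -- and from there along the distance to the frequency
  have hdesc₂ : ∀ l, ∀ g ∈ G, torusDist g (θ l) ≤ 1 / (1000 * m) →
      ∃ g' ∈ G, torusDist g' (θ l) ≤ 1 / (1000 * m) ∧
        torusDist g' (θ l) ≤ mesh G ∧ SameCluster S r g g' := fun l =>
    exists_reflTransGen_of_descent G (fun g => torusDist g (θ l))
      (fun g => torusDist g (θ l) ≤ 1 / (1000 * m)) (fun g => torusDist g (θ l) ≤ mesh G) _
      fun g hg hP => by
        rcases le_or_gt (torusDist g (θ l)) (mesh G + e) with hdone | hdone
        · exact Or.inl (hgap₂' g hg l (hdone.trans (by linarith)))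
        · obtain ⟨g', hg', hlt, hdist⟩ := exists_closer_neighbor hG he0 hdone.le
          have h1 := hgap₁' g hg g' hg' (hdist.trans (by linarith))
          exact Or.inr ⟨g', hg', hlt.le.trans hP, hlt, hnear g hg l hP,
            hnear g' hg' l (hlt.le.trans hP), h1.trans hr⟩
  have hconn : ∀ l, ∀ g ∈ S, ∀ g' ∈ S, torusDist g (θ l) ≤ 1 / (20 * m) →
      torusDist g' (θ l) ≤ 1 / (20 * m) → SameCluster S r g g' := by
    intro l
    have hto : ∀ g ∈ S, torusDist g (θ l) ≤ 1 / (20 * m) →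
        ∃ c ∈ S, torusDist c (θ l) ≤ mesh G ∧ SameCluster S r g c := fun g hg hgl => by
      obtain ⟨a, haG, -, ha, hga⟩ := hdesc₁ l g hg.1 ⟨hg, hgl⟩
      obtain ⟨c, hcG, hc, hc', hac⟩ := hdesc₂ l a haG ha
      exact ⟨c, hnear c hcG l hc, hc', hga.trans hac⟩
    intro g hg g' hg' hgl hgl'
    obtain ⟨c, hcS, hc, hgc⟩ := hto g hg hgl
    obtain ⟨c', hcS', hc', hgc'⟩ := hto g' hg' hgl'
    have h1 : torusDist c c' ≤ r := by
      have h2 := torusDist_triangle c (θ l) c'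
      rw [torusDist_comm (θ l) c'] at h2
      linarith
    exact (hgc.trans (.single ⟨hcS, hcS', h1⟩)).trans (sameCluster_symm hgc')
  have hkeep : ∀ l g g', SameCluster S r g g' → torusDist g (θ l) ≤ 1 / (20 * m) →
      torusDist g' (θ l) ≤ 1 / (20 * m) := by
    intro l g g' hgg' hgl
    induction hgg' with
    | refl => exact hgl
    | tail _ hstep ih =>
      obtain ⟨l', hl'⟩ := hlabel _ hstep.2.1
      exact (huniq _ _ l l' ih hl' (hstep.2.2.trans hr')) ▸ hl'
  constructor
  · choose init hinitG hinit using fun l => exists_mem_torusDist_le_mesh hG (θ l)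
    have hinit' : ∀ l, torusDist (init l) (θ l) ≤ 1 / (1000 * m) := fun l => by
      rw [torusDist_comm]; exact (hinit l).trans hμsmall
    have h20 : 1 / (1000 * (m : ℝ)) ≤ 1 / (20 * m) := by gcongr; norm_num
    refine ⟨_, init, fun l => hnear _ (hinitG l) l (hinit' l), fun g hg => ?_, fun l => rfl⟩
    obtain ⟨l, hl⟩ := hlabel g hg
    refine ⟨l, hconn l g hg _ (hnear _ (hinitG l) l (hinit' l)) hl ((hinit' l).trans h20),
      fun l' hl' => ?_⟩
    exact (huniq _ _ l l' (hkeep l _ _ hl' hl) ((hinit' l').trans h20) (hself _)).symm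
  · rintro out ⟨init, hinit, hclus, hout⟩
    choose lab hlab using fun l => hlabel (init l) (hinit l)
    have hinj : Function.Injective lab := fun l l' hll' => by
      have h1 : SameCluster S r (init l) (init l') :=
        hconn (lab l) _ (hinit l) _ (hinit l') (hlab l) (by rw [hll']; exact hlab l')
      exact (hclus (init l) (hinit l)).unique Relation.ReflTransGen.refl h1
    set σ := Equiv.ofBijective lab (Finite.injective_iff_bijective.1 hinj) with hσ
    refine ⟨σ.symm, fun l => ?_⟩
    have h1 : lab (σ.symm l) = l := σ.apply_symm_apply l
    have h2 := hlab (σ.symm l)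
    rw [h1] at h2
    rw [hout]
    exact torusDist_gradStep_iterate_le hd hm hθ hε hε1 hW h2 hh1 hh2 n

end Descent

/-! ### Hankel matrices of signals -/

section Hankel

variable {d m s : ℕ}

lemma hankel_apply (z : (Fin d → ℤ) → ℂ) (v : SampleSpace d m) (x : cube d m) :
    hankel m z v x = ∑ x' : cube d m, z (x.1 + x'.1) * v x' := by
  simp [hankel, hankelMatrix, Matrix.mulVec, dotProduct]

lemma hankel_add_apply (y z : (Fin d → ℤ) → ℂ) (v : SampleSpace d m) :
    hankel m (y + z) v = hankel m y v + hankel m z v := by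
  ext x
  simp only [PiLp.add_apply, hankel_apply, Pi.add_apply, add_mul, Finset.sum_add_distrib]

lemma adjoint_hankel (z : (Fin d → ℤ) → ℂ) :
    LinearMap.adjoint (hankel m z) = hankel m fun x => (starRingEnd ℂ) (z x) := by
  rw [hankel, hankel, ← Matrix.toEuclideanLin_conjTranspose_eq_adjoint]
  congr 1
  ext x x'
  simp [hankelMatrix, Matrix.conjTranspose_apply, add_comm]

lemma conj_signal (θ : Fin s → Freq d) (a : Fin s → ℂ) :
    (fun x => (starRingEnd ℂ) (signal θ a x))
      = signal (fun l => -θ l) fun l => (starRingEnd ℂ) (a l) := by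
  funext x
  simp only [signal, map_sum, map_mul, conj_expo]

/-- The Vandermonde factorization of the Hankel matrix of a signal. -/
lemma hankel_signal_apply (θ : Fin s → Freq d) (a : Fin s → ℂ) (v : SampleSpace d m) :
    hankel m (signal θ a) v
      = ∑ l, (((cubeSize d m : ℝ) : ℂ) * a l * inner ℂ (steering m (-θ l)) v) •
        steering m (θ l) := by
  ext x
  have h0 := cubeSize_pos d m
  have h1 : ((cubeSize d m : ℝ) : ℂ) * ((1 / √(cubeSize d m) : ℝ) : ℂ)
      * ((1 / √(cubeSize d m) : ℝ) : ℂ) = 1 := by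
    rw [← Complex.ofReal_mul, ← Complex.ofReal_mul, mul_assoc, div_mul_div_comm,
      Real.mul_self_sqrt h0.le, one_mul, mul_one_div_cancel h0.ne', Complex.ofReal_one]
  rw [hankel_apply]
  simp only [WithLp.ofLp_sum, Finset.sum_apply, PiLp.smul_apply, smul_eq_mul, signal,
    Finset.sum_mul, inner_sampleSpace, Finset.mul_sum]
  rw [Finset.sum_comm]
  refine Finset.sum_congr rfl fun l _ => Finset.sum_congr rfl fun x' _ => ?_
  rw [steering_apply, steering_apply, map_mul, Complex.conj_ofReal, conj_expo, neg_neg,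
    expo_add_right]
  linear_combination (-(a l * expo (θ l) x * expo (θ l) x' * v x')) * h1

lemma hankel_signal_eq_zero (θ : Fin s → Freq d) (a : Fin s → ℂ) {v : SampleSpace d m}
    (hv : v ∈ (signalSpace m fun l => -θ l)ᗮ) : hankel m (signal θ a) v = 0 := by
  rw [hankel_signal_apply]
  refine Finset.sum_eq_zero fun l _ => ?_
  rw [(Submodule.mem_orthogonal _ _).1 hv _ (steering_mem_signalSpace (fun l => -θ l) l), mul_zero,
    zero_smul]

lemma le_norm_hankel_signal {θ : Fin s → Freq d} {a : Fin s → ℂ}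
    (hθ : NearlyOrthonormal (1 / 4) fun l => steering m (θ l))
    (hθ' : NearlyOrthonormal (1 / 4) fun l => steering m (-θ l)) (ha : ∀ l, 1 ≤ ‖a l‖)
    {u : SampleSpace d m} (hu : u ∈ signalSpace m fun l => -θ l) :
    3 / 4 * cubeSize d m * ‖u‖ ≤ ‖hankel m (signal θ a) u‖ := by
  have h0 := cubeSize_pos d m
  have h := hθ'.le_norm_sum hθ (by norm_num) h0.le
    (b := fun l => ((cubeSize d m : ℝ) : ℂ) * a l) (fun l => by
      rw [norm_mul, Complex.norm_real, Real.norm_of_nonneg h0.le]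
      nlinarith [ha l]) hu
  rw [hankel_signal_apply]
  refine le_trans (le_of_eq ?_) h
  ring

lemma norm_adjoint_apply_le {V : Type*} [NormedAddCommGroup V] [InnerProductSpace ℂ V]
    [FiniteDimensional ℂ V] {T : V →ₗ[ℂ] V} {B : ℝ} (hT : ∀ v, ‖T v‖ ≤ B * ‖v‖) (v : V) :
    ‖LinearMap.adjoint T v‖ ≤ B * ‖v‖ := by
  rcases eq_or_ne (LinearMap.adjoint T v) 0 with h0 | h0
  · rw [h0, norm_zero]
    exact (norm_nonneg _).trans (hT v)
  have h1 : ‖LinearMap.adjoint T v‖ * ‖LinearMap.adjoint T v‖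
      ≤ B * ‖v‖ * ‖LinearMap.adjoint T v‖ := by
    have h2 : ‖(inner ℂ (LinearMap.adjoint T v) (LinearMap.adjoint T v) : ℂ)‖
        = ‖LinearMap.adjoint T v‖ * ‖LinearMap.adjoint T v‖ := by
      rw [inner_self_eq_norm_sq_to_K]
      simp [pow_two]
    rw [← h2, LinearMap.adjoint_inner_left]
    calc ‖(inner ℂ v (T (LinearMap.adjoint T v)) : ℂ)‖
        ≤ ‖v‖ * ‖T (LinearMap.adjoint T v)‖ := norm_inner_le_norm _ _
      _ ≤ ‖v‖ * (B * ‖LinearMap.adjoint T v‖) := by gcongr; exact hT _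
      _ = B * ‖v‖ * ‖LinearMap.adjoint T v‖ := by ring
  exact le_of_mul_le_mul_right h1 (norm_pos_iff.2 h0)

lemma finrank_signalSpace {θ : Fin s → Freq d}
    (hθ : NearlyOrthonormal (1 / 4) fun l => steering m (θ l)) :
    Module.finrank ℂ (signalSpace m θ) = s := by
  rw [signalSpace, finrank_span_eq_card (hθ.linearIndependent (by norm_num)), Fintype.card_fin]

/-- Noise whose Hankel matrix is small compared with `(2m+1)^d` leaves the leading left singular
space well defined and close to the signal space. -/
theorem leadingSpace_of_noise (hs : 1 ≤ s) {θ : Fin s → Freq d} {a : Fin s → ℂ}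
    (hθ : NearlyOrthonormal (1 / 4) fun l => steering m (θ l))
    (hθ' : NearlyOrthonormal (1 / 4) fun l => steering m (-θ l)) (ha : ∀ l, 1 ≤ ‖a l‖)
    {η : (Fin d → ℤ) → ℂ} {ν : ℝ} (hν : 0 ≤ ν) (hν' : ν ≤ 1 / 12000)
    (hη : ∀ v, ‖hankel m η v‖ ≤ ν * cubeSize d m * ‖v‖) :
    LeadingSpaceWellDefined (hankel m (signal θ a + η)) s ∧
      ProjectionsClose (signalSpace m θ)
        (leadingLeftSingularSpace (hankel m (signal θ a + η)) s) (6 * ν) := by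
  set N := cubeSize d m with hN
  have h0 : 0 < N := cubeSize_pos d m
  have hadj : LinearMap.adjoint (hankel m (signal θ a + η))
      = hankel m (signal (fun l => -θ l) fun l => (starRingEnd ℂ) (a l))
        + LinearMap.adjoint (hankel m η) := by
    ext1 v
    rw [LinearMap.add_apply, adjoint_hankel, adjoint_hankel, ← hankel_add_apply, ← conj_signal]
    congr 2
    funext x
    simp
  have hη' := norm_adjoint_apply_le hη
  have ha' : ∀ l, 1 ≤ ‖(starRingEnd ℂ) (a l)‖ := fun l => by
    rw [RCLike.norm_conj]; exact ha l
  have hneg : (fun l => steering m (- -θ l)) = fun l => steering m (θ l) := by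
    simp only [neg_neg]
  have hnegS : (signalSpace m fun l => - -θ l) = signalSpace m θ := by simp only [neg_neg]
  have lowL : ∀ u ∈ signalSpace m θ, 3 / 4 * N * ‖u‖
      ≤ ‖hankel m (signal (fun l => -θ l) fun l => (starRingEnd ℂ) (a l)) u‖ := fun u hu =>
    le_norm_hankel_signal (θ := fun l => -θ l) hθ' (by rwa [hneg]) ha' (by rwa [hnegS])
  have zeroL : ∀ v ∈ (signalSpace m θ)ᗮ,
      hankel m (signal (fun l => -θ l) fun l => (starRingEnd ℂ) (a l)) v = 0 := fun v hv =>
    hankel_signal_eq_zero (fun l => -θ l) _ (by rwa [hnegS])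
  obtain ⟨hwell, hW, hW'⟩ := leadingSpace_of_gap (A := (3 / 4 - ν) * N) (B := ν * N) hs
    (hankel m (signal θ a + η)) (signalSpace m θ) (signalSpace m fun l => -θ l)
    (finrank_signalSpace hθ) (finrank_signalSpace hθ') (by positivity) (by nlinarith)
    (fun u hu => by
      have h1 := lowL u hu
      have h2 := hη' u
      rw [hadj, LinearMap.add_apply]
      have h3 := norm_sub_le_norm_add (hankel m (signal (fun l => -θ l)
        fun l => (starRingEnd ℂ) (a l)) u) (LinearMap.adjoint (hankel m η) u)
      linarith)
    (fun v hv => by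
      rw [hadj, LinearMap.add_apply, zeroL v hv, zero_add]
      exact hη' v)
    (fun u hu => by
      have h1 := le_norm_hankel_signal hθ hθ' ha hu
      have h2 := hη u
      rw [hankel_add_apply]
      have h3 := norm_sub_le_norm_add (hankel m (signal θ a) u) (hankel m η u)
      linarith)
    (fun v hv => by
      rw [hankel_add_apply, hankel_signal_eq_zero θ a hv, zero_add]
      exact hη v)
  refine ⟨hwell, fun x y => ?_⟩
  refine (norm_inner_starProjection_sub_le (LinearMap.adjoint (hankel m (signal θ a + η)))
    (hankel m (signal (fun l => -θ l) fun l => (starRingEnd ℂ) (a l))) (signalSpace m θ)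
    (leadingLeftSingularSpace (hankel m (signal θ a + η)) s) (A₀ := 3 / 4 * N)
    (A := (3 / 4 - ν) * N) (B := ν * N) (by positivity) (mul_pos (by linarith) h0) (by positivity)
    lowL zeroL (fun v => ?_) hW hW' x y).trans ?_
  · rw [hadj, LinearMap.add_apply, add_sub_cancel_left]
    exact hη' v
  · gcongr
    -- `8/3 + 3 ≤ 6`
    have e1 : 2 * (ν * N) / (3 / 4 * N) = 8 / 3 * ν := by field_simp; ring
    have e2 : ν * N / ((3 / 4 - ν) * N) ≤ 3 * ν := by
      rw [mul_div_mul_right _ _ h0.ne', div_le_iff₀ (by linarith)]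
      nlinarith
    rw [e1]; linarith

end Hankel

/-! ### Deterministic bounds for the Hankel matrix of the noise -/

lemma lpNormOn_nonneg {ι F : Type*} [NormedAddCommGroup F] {p : ℝ≥0∞} (hp : 1 ≤ p) (S : Finset ι)
    (f : ι → F) : 0 ≤ lpNormOn p S f := by
  have : Fact (1 ≤ p) := ⟨hp⟩
  exact norm_nonneg _

/-- Hölder's inequality against the indicator of a set of indices. -/
lemma sum_norm_le_lpNormOn {ι κ F : Type*} [NormedAddCommGroup F] {p : ℝ≥0∞} (hp : 1 ≤ p)
    (S : Finset ι) (f : ι → F) (T : Finset κ) (e : κ → ι) (he : Set.InjOn e T)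
    (heS : ∀ t ∈ T, e t ∈ S) :
    ∑ t ∈ T, ‖f (e t)‖ ≤ (T.card : ℝ) ^ (1 - p⁻¹.toReal) * lpNormOn p S f := by
  have hfact : Fact (1 ≤ p) := ⟨hp⟩
  rcases eq_or_ne p ∞ with rfl | hp'
  · rw [ENNReal.inv_top, ENNReal.toReal_zero, sub_zero, Real.rpow_one, ← nsmul_eq_mul]
    refine Finset.sum_le_card_nsmul _ _ _ fun t ht => ?_
    exact PiLp.norm_apply_le
      (WithLp.toLp ∞ (fun x : S => f x) : PiLp ∞ fun _ : S => F) ⟨e t, heS t ht⟩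
  set q := p.toReal with hq
  have hq1 : 1 ≤ q := by
    rw [hq, ← ENNReal.toReal_one]
    exact ENNReal.toReal_mono hp' hp
  have hq0 : 0 < q := by linarith
  have hn : (0 : ℝ) ≤ T.card := Nat.cast_nonneg _
  have h1 : lpNormOn p S f = (∑ x ∈ S, ‖f x‖ ^ q) ^ (1 / q) := by
    rw [lpNormOn, PiLp.norm_eq_sum hq0, ← Finset.sum_coe_sort S fun x => ‖f x‖ ^ q]
  have h2 : ∑ t ∈ T, ‖f (e t)‖ ^ q ≤ ∑ x ∈ S, ‖f x‖ ^ q := by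
    classical
    rw [← Finset.sum_image (f := fun x => ‖f x‖ ^ q) he]
    exact Finset.sum_le_sum_of_subset_of_nonneg (Finset.image_subset_iff.2 heS)
      fun _ _ _ => by positivity
  have h3 : (∑ t ∈ T, ‖f (e t)‖) ^ q ≤ (T.card : ℝ) ^ (q - 1) * ∑ x ∈ S, ‖f x‖ ^ q := by
    have h := Real.rpow_sum_le_const_mul_sum_rpow T (fun t => ‖f (e t)‖) hq1
    simp only [abs_norm] at h
    exact h.trans (by gcongr)
  have h0 : 0 ≤ ∑ t ∈ T, ‖f (e t)‖ := Finset.sum_nonneg fun _ _ => norm_nonneg _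
  have h4 : 0 ≤ ∑ x ∈ S, ‖f x‖ ^ q := Finset.sum_nonneg fun _ _ => by positivity
  calc ∑ t ∈ T, ‖f (e t)‖ = ((∑ t ∈ T, ‖f (e t)‖) ^ q) ^ (1 / q) := by
        rw [← Real.rpow_mul h0, mul_one_div_cancel hq0.ne', Real.rpow_one]
    _ ≤ ((T.card : ℝ) ^ (q - 1) * ∑ x ∈ S, ‖f x‖ ^ q) ^ (1 / q) := by gcongr
    _ = (T.card : ℝ) ^ (1 - p⁻¹.toReal) * lpNormOn p S f := by
        rw [Real.mul_rpow (by positivity) h4, ← Real.rpow_mul hn, h1, ENNReal.toReal_inv, ← hq]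
        congr 2
        field_simp

lemma lpNormOn_two_sq {ι F : Type*} [NormedAddCommGroup F] (S : Finset ι) (f : ι → F) :
    lpNormOn 2 S f ^ 2 = ∑ x ∈ S, ‖f x‖ ^ 2 := by
  rw [lpNormOn, PiLp.norm_sq_eq_of_L2, ← Finset.sum_coe_sort S fun x => ‖f x‖ ^ 2]

section Hankel

variable {d m : ℕ}

lemma add_mem_cube {x x' : Fin d → ℤ} (hx : x ∈ cube d m) (hx' : x' ∈ cube d m) :
    x + x' ∈ cube d (2 * m) := by
  rw [mem_cube] at hx hx' ⊢
  intro i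
  have h1 := hx i
  have h2 := hx' i
  rw [Pi.add_apply]
  push_cast
  omega

/-- The Schur test for the symmetric matrix `z(x + x')`. -/
lemma norm_hankel_le_of_sum_le {z : (Fin d → ℤ) → ℂ} {R : ℝ} (hR : 0 ≤ R)
    (h : ∀ x : cube d m, ∑ x' : cube d m, ‖z (x.1 + x'.1)‖ ≤ R) (v : SampleSpace d m) :
    ‖hankel m z v‖ ≤ R * ‖v‖ := by
  refine le_of_sq_le_sq ?_ (by positivity)
  rw [norm_sq_sampleSpace, mul_pow, norm_sq_sampleSpace]
  have h1 : ∀ x : cube d m, ‖hankel m z v x‖ ^ 2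
      ≤ R * ∑ x' : cube d m, ‖z (x.1 + x'.1)‖ * ‖v x'‖ ^ 2 := fun x => by
    calc ‖hankel m z v x‖ ^ 2 ≤ (∑ x' : cube d m, ‖z (x.1 + x'.1)‖ * ‖v x'‖) ^ 2 := by
          rw [hankel_apply]
          gcongr
          exact (norm_sum_le _ _).trans (le_of_eq (by simp only [norm_mul]))
      _ ≤ (∑ x' : cube d m, ‖z (x.1 + x'.1)‖)
          * ∑ x' : cube d m, ‖z (x.1 + x'.1)‖ * ‖v x'‖ ^ 2 :=
          Finset.sum_sq_le_sum_mul_sum_of_sq_le_mul _ (fun _ _ => norm_nonneg _)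
            (fun _ _ => by positivity) fun _ _ => le_of_eq (by ring)
      _ ≤ _ := by
          gcongr
          exact h x
  calc ∑ x, ‖hankel m z v x‖ ^ 2
      ≤ ∑ x : cube d m, R * ∑ x' : cube d m, ‖z (x.1 + x'.1)‖ * ‖v x'‖ ^ 2 :=
        Finset.sum_le_sum fun x _ => h1 x
    _ = R * ∑ x' : cube d m, (∑ x : cube d m, ‖z (x'.1 + x.1)‖) * ‖v x'‖ ^ 2 := by
        rw [← Finset.mul_sum, Finset.sum_comm]
        simp only [Finset.sum_mul, add_comm]
    _ ≤ R * ∑ x' : cube d m, R * ‖v x'‖ ^ 2 := by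
        gcongr with x' _
        exact h x'
    _ = R ^ 2 * ∑ x' : cube d m, ‖v x'‖ ^ 2 := by
        rw [← Finset.mul_sum]; ring

lemma pow_le_cubeSize (d m : ℕ) : (m : ℝ) ^ d ≤ cubeSize d m := by
  rw [cubeSize]
  gcongr
  linarith [Nat.cast_nonneg (α := ℝ) m]

theorem norm_hankel_le_lpNormOn (hm : 1 ≤ m) {p : ℝ≥0∞} (hp : 1 ≤ p) (η : (Fin d → ℤ) → ℂ)
    (v : SampleSpace d m) :
    ‖hankel m η v‖ ≤ lpNormOn p (cube d (2 * m)) η / (m : ℝ) ^ ((d : ℝ) * p⁻¹.toReal)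
      * cubeSize d m * ‖v‖ := by
  have hm0 : (0 : ℝ) < m := by exact_mod_cast hm
  have hN := cubeSize_pos d m
  have hη := lpNormOn_nonneg hp (cube d (2 * m)) η
  refine norm_hankel_le_of_sum_le (by positivity) (fun x => ?_) v
  have h1 := sum_norm_le_lpNormOn hp (cube d (2 * m)) η (Finset.univ : Finset (cube d m))
    (fun x' => x.1 + x'.1) (fun a _ b _ hab => Subtype.ext (add_left_cancel hab))
    fun x' _ => add_mem_cube x.2 x'.2
  rw [Finset.card_univ, Fintype.card_coe, card_cube_eq] at h1
  refine h1.trans ?_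
  rw [Real.rpow_sub hN, Real.rpow_one, div_mul_eq_mul_div, div_mul_eq_mul_div, mul_comm]
  have h2 : (m : ℝ) ^ ((d : ℝ) * p⁻¹.toReal) ≤ cubeSize d m ^ p⁻¹.toReal := by
    rw [Real.rpow_mul hm0.le, Real.rpow_natCast]
    have := pow_le_cubeSize d m
    gcongr
  gcongr

/-! ### Discrete Fourier transform -/

/-- The nodes of the discrete Fourier transform of length `4m + 1` in every variable. -/
noncomputable def fourierNode (m : ℕ) (k : Fin d → ℤ) : Freq d :=
  (1 / (4 * (m : ℝ) + 1)) • latticePoint k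

/-- The discrete Fourier coefficient at the node `k/(4m+1)` of the restriction of `z` to
`{-2m, …, 2m}^d`. -/
noncomputable def fourierCoeff (m : ℕ) (z : (Fin d → ℤ) → ℂ) (k : Fin d → ℤ) : ℂ :=
  ∑ x ∈ cube d (2 * m), z x * expo (-fourierNode m k) x

lemma expo_fourierNode_comm (k x : Fin d → ℤ) :
    expo (fourierNode m k) x = expo (fourierNode m x) k := by
  rw [expo, expo]
  congr 3
  refine Finset.sum_congr rfl fun i _ => ?_
  simp only [fourierNode, PiLp.smul_apply, latticePoint_apply, smul_eq_mul]
  ring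

lemma dirichlet_fourier_eq_zero {u : ℤ} (hu : u ≠ 0) (hu' : |u| ≤ 4 * m) :
    dirichlet (2 * m) (1 / (4 * (m : ℝ) + 1) * u) = 0 := by
  have hL : (0 : ℝ) < 4 * m + 1 := by positivity
  have h1 := dirichlet_mul_sin (2 * m) (1 / (4 * (m : ℝ) + 1) * u)
  have h2 : (2 * ((2 * m : ℕ) : ℝ) + 1) * (Real.pi * (1 / (4 * (m : ℝ) + 1) * u)) = u * Real.pi := by
    push_cast
    field_simp
    ring
  rw [h2, Real.sin_int_mul_pi] at h1
  refine (mul_eq_zero.1 h1).resolve_right fun h3 => ?_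
  obtain ⟨n, hn⟩ := Real.sin_eq_zero_iff.1 h3
  have h4 : (n : ℝ) * (4 * m + 1) = u := by
    have : (n : ℝ) = 1 / (4 * (m : ℝ) + 1) * u := by
      have h5 := Real.pi_pos.ne'
      apply mul_right_cancel₀ h5
      linarith
    rw [this]; field_simp
  have h5 : n * (4 * m + 1) = u := by exact_mod_cast h4
  rcases eq_or_ne n 0 with rfl | hn0
  · exact hu (by rw [← h5, zero_mul])
  · have h6 : 1 ≤ |n| := Int.one_le_abs hn0
    rw [← h5, abs_mul, abs_of_nonneg (by positivity : (0 : ℤ) ≤ 4 * m + 1)] at hu'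
    nlinarith

lemma sum_expo_fourierNode {u : Fin d → ℤ} (hu : ∀ i, |u i| ≤ 4 * m) :
    ∑ k ∈ cube d (2 * m), expo (fourierNode m k) u
      = if u = 0 then ((cubeSize d (2 * m) : ℝ) : ℂ) else 0 := by
  simp only [expo_fourierNode_comm _ u]
  rw [sum_cube_expo]
  split_ifs with h
  · subst h
    rw [cubeSize, Finset.prod_congr rfl fun i _ => show dirichlet (2 * m)
      ((fourierNode m (0 : Fin d → ℤ)) i) = 2 * ((2 * m : ℕ) : ℝ) + 1 by
        rw [← dirichlet_zero]; congr 1; simp [fourierNode]]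
    simp
  · obtain ⟨i, hi⟩ := Function.ne_iff.1 h
    rw [Finset.prod_eq_zero (Finset.mem_univ i) (dirichlet_fourier_eq_zero hi (hu i)),
      Complex.ofReal_zero]

lemma abs_sub_le_of_mem_cube {n : ℕ} {x y : Fin d → ℤ} (hx : x ∈ cube d n) (hy : y ∈ cube d n)
    (i : Fin d) : |(x - y) i| ≤ 2 * n := by
  rw [mem_cube] at hx hy
  have h1 := hx i
  have h2 := hy i
  rw [Pi.sub_apply, abs_le]
  constructor <;> linarith

lemma expo_sub_right (ω : Freq d) (x y : Fin d → ℤ) :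
    expo ω (x - y) = expo ω x * expo (-ω) y := by
  rw [sub_eq_add_neg, expo_add_right, expo_neg_right]

/-- Fourier inversion on `{-2m, …, 2m}^d`. -/
lemma sum_fourierCoeff_mul_expo (z : (Fin d → ℤ) → ℂ) {u : Fin d → ℤ} (hu : u ∈ cube d (2 * m)) :
    ∑ k ∈ cube d (2 * m), fourierCoeff m z k * expo (fourierNode m k) u
      = ((cubeSize d (2 * m) : ℝ) : ℂ) * z u := by
  simp only [fourierCoeff, Finset.sum_mul]
  rw [Finset.sum_comm]
  have h1 : ∀ x ∈ cube d (2 * m),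
      ∑ k ∈ cube d (2 * m), z x * expo (-fourierNode m k) x * expo (fourierNode m k) u
        = z x * if u - x = 0 then ((cubeSize d (2 * m) : ℝ) : ℂ) else 0 := fun x hx => by
    rw [← sum_expo_fourierNode (m := m) fun i => by
      have := abs_sub_le_of_mem_cube hu hx i
      push_cast at this
      linarith, Finset.mul_sum]
    refine Finset.sum_congr rfl fun k _ => ?_
    rw [expo_sub_right]
    ring
  rw [Finset.sum_congr rfl h1]
  simp only [sub_eq_zero, mul_ite, mul_zero]
  rw [Finset.sum_ite_eq, if_pos hu, mul_comm]

/-- Parseval's identity for vectors supported in `{-m, …, m}^d`. -/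
lemma sum_norm_sq_expo_fourierNode (v : SampleSpace d m) :
    ∑ k ∈ cube d (2 * m), ‖∑ x : cube d m, expo (fourierNode m k) x.1 * v x‖ ^ 2
      = cubeSize d (2 * m) * ‖v‖ ^ 2 := by
  have h1 : ∀ k : Fin d → ℤ,
      ((‖∑ x : cube d m, expo (fourierNode m k) x.1 * v x‖ ^ 2 : ℝ) : ℂ)
        = ∑ x : cube d m, ∑ y : cube d m,
          v x * (starRingEnd ℂ) (v y) * expo (fourierNode m k) (x.1 - y.1) := fun k => by
    rw [Complex.ofReal_pow, ← Complex.mul_conj', map_sum, Finset.sum_mul_sum]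
    refine Finset.sum_congr rfl fun x _ => Finset.sum_congr rfl fun y _ => ?_
    rw [map_mul, conj_expo, expo_sub_right]
    ring
  have h2 : ∀ x y : cube d m,
      ∑ k ∈ cube d (2 * m), v x * (starRingEnd ℂ) (v y) * expo (fourierNode m k) (x.1 - y.1)
        = if x = y then v x * (starRingEnd ℂ) (v y) * ((cubeSize d (2 * m) : ℝ) : ℂ) else 0 :=
    fun x y => by
      rw [← Finset.mul_sum, sum_expo_fourierNode fun i => by
        have := abs_sub_le_of_mem_cube x.2 y.2 i
        have hm : (0 : ℤ) ≤ m := by positivity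
        linarith]
      simp only [sub_eq_zero, Subtype.ext_iff, mul_ite, mul_zero]
  have h3 : ((∑ k ∈ cube d (2 * m),
      ‖∑ x : cube d m, expo (fourierNode m k) x.1 * v x‖ ^ 2 : ℝ) : ℂ)
      = ((cubeSize d (2 * m) * ‖v‖ ^ 2 : ℝ) : ℂ) := by
    rw [Complex.ofReal_sum, Finset.sum_congr rfl fun k _ => h1 k, Finset.sum_comm]
    rw [Finset.sum_congr rfl fun x _ => Finset.sum_comm]
    simp only [h2, Finset.sum_ite_eq, Finset.mem_univ, if_true]
    rw [norm_sq_sampleSpace, Complex.ofReal_mul, Complex.ofReal_sum, Finset.mul_sum]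
    refine Finset.sum_congr rfl fun x _ => ?_
    rw [Complex.mul_conj', Complex.ofReal_pow, mul_comm]
  exact_mod_cast h3

/-- The norm of a Hankel matrix is at most the maximum of the discrete Fourier transform of its
symbol. -/
theorem norm_hankel_le_of_fourierCoeff_le {z : (Fin d → ℤ) → ℂ} {M : ℝ} (hM : 0 ≤ M)
    (h : ∀ k ∈ cube d (2 * m), ‖fourierCoeff m z k‖ ≤ M) (v : SampleSpace d m) :
    ‖hankel m z v‖ ≤ M * ‖v‖ := by
  set L := cubeSize d (2 * m) with hL
  have hL0 : 0 < L := cubeSize_pos _ _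
  set S : SampleSpace d m → (Fin d → ℤ) → ℂ := fun v k =>
    ∑ x : cube d m, expo (fourierNode m k) x.1 * v x with hS
  set w := hankel m z v with hw
  -- `w'` is the complex conjugate of `w`
  set w' : SampleSpace d m := WithLp.toLp 2 fun x => (starRingEnd ℂ) (w x) with hw'
  have hnorm : ‖w'‖ ^ 2 = ‖w‖ ^ 2 := by
    rw [norm_sq_sampleSpace, norm_sq_sampleSpace]
    exact Finset.sum_congr rfl fun x _ => by rw [hw']; simp only [RCLike.norm_conj]
  have h1 : (L : ℂ) * inner ℂ w w = ∑ k ∈ cube d (2 * m), fourierCoeff m z k * S w' k * S v k := by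
    have e1 : ∀ k, fourierCoeff m z k * S w' k * S v k = ∑ x : cube d m, ∑ x' : cube d m,
        fourierCoeff m z k * expo (fourierNode m k) (x.1 + x'.1)
          * ((starRingEnd ℂ) (w x) * v x') := fun k => by
      rw [hS, mul_assoc, Finset.sum_mul_sum, Finset.mul_sum]
      refine Finset.sum_congr rfl fun x _ => ?_
      rw [Finset.mul_sum]
      refine Finset.sum_congr rfl fun x' _ => ?_
      rw [expo_add_right, hw']
      ring
    have e2 : ∀ x, (starRingEnd ℂ) (w x) * w x
        = ∑ x' : cube d m, (starRingEnd ℂ) (w x) * (z (x.1 + x'.1) * v x') := fun x =>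
      (congrArg ((starRingEnd ℂ) (w x) * ·) (hankel_apply z v x)).trans (Finset.mul_sum _ _ _)
    rw [inner_sampleSpace, Finset.sum_congr rfl fun k _ => e1 k, Finset.sum_comm, Finset.mul_sum]
    refine Finset.sum_congr rfl fun x _ => ?_
    rw [e2, Finset.sum_comm, Finset.mul_sum]
    refine Finset.sum_congr rfl fun x' _ => ?_
    rw [← Finset.sum_mul, sum_fourierCoeff_mul_expo z (add_mem_cube x.2 x'.2)]
    ring
  have h2 : L * ‖w‖ ^ 2 ≤ M * ∑ k ∈ cube d (2 * m), ‖S w' k‖ * ‖S v k‖ := by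
    calc L * ‖w‖ ^ 2 = ‖(L : ℂ) * inner ℂ w w‖ := by
          rw [norm_mul, Complex.norm_real, Real.norm_of_nonneg hL0.le,
            inner_self_eq_norm_sq_to_K]
          simp
      _ ≤ ∑ k ∈ cube d (2 * m), M * (‖S w' k‖ * ‖S v k‖) := by
          rw [h1]
          refine (norm_sum_le _ _).trans (Finset.sum_le_sum fun k hk => ?_)
          rw [norm_mul, norm_mul, mul_assoc]
          have := h k hk
          gcongr
      _ = _ := by rw [Finset.mul_sum]
  have h3 : ∑ k ∈ cube d (2 * m), ‖S w' k‖ * ‖S v k‖ ≤ L * (‖w‖ * ‖v‖) := by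
    refine le_of_sq_le_sq ((Finset.sum_mul_sq_le_sq_mul_sq _ _ _).trans (le_of_eq ?_))
      (by positivity)
    rw [sum_norm_sq_expo_fourierNode, sum_norm_sq_expo_fourierNode, hnorm]
    ring
  have h4 : L * ‖w‖ ^ 2 ≤ M * (L * (‖w‖ * ‖v‖)) := h2.trans (by gcongr)
  rcases eq_or_ne w 0 with h0 | h0
  · rw [h0, norm_zero]; positivity
  have h5 : 0 < ‖w‖ := norm_pos_iff.2 h0
  have h6 : (L * ‖w‖) * ‖w‖ ≤ (L * ‖w‖) * (M * ‖v‖) := by nlinarith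
  exact le_of_mul_le_mul_left h6 (by positivity)

end Hankel

/-! ### Random noise -/

/-- Every real linear functional `Re (c ·)` of a standard complex normal variable is sub-Gaussian
with variance proxy `|c|²/2`. -/
lemma hasSubgaussianMGF_stdComplexNormal (c : ℂ) :
    HasSubgaussianMGF (fun z : ℂ => (c * z).re) (‖c‖₊ ^ 2 / 2) stdComplexNormal := by
  have hmeas : Measurable Complex.measurableEquivRealProd.symm :=
    Complex.measurableEquivRealProd.symm.measurable
  have hcont : ∀ t : ℝ, Continuous fun z : ℂ => Real.exp (t * (c * z).re) := fun t => by fun_prop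
  have hsplit : ∀ t : ℝ, (fun p : ℝ × ℝ =>
      Real.exp (t * (c * Complex.measurableEquivRealProd.symm p).re))
      = fun p : ℝ × ℝ => Real.exp (t * c.re * p.1) * Real.exp (-(t * c.im) * p.2) := fun t => by
    funext p
    rw [← Real.exp_add]
    congr 1
    rw [Complex.mul_re, Complex.measurableEquivRealProd_symm_apply]
    ring
  refine ⟨fun t => ?_, fun t => ?_⟩
  · rw [stdComplexNormal, integrable_map_measure (hcont t).aestronglyMeasurable hmeas.aemeasurable,
      Function.comp_def, hsplit]
    exact (integrable_exp_mul_gaussianReal _).mul_prod (integrable_exp_mul_gaussianReal _)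
  · have hg : ∀ a : ℝ, ∫ x, Real.exp (a * x) ∂gaussianReal 0 (1 / 2)
        = Real.exp (a ^ 2 / 4) := fun a => by
      have h := congrFun (mgf_id_gaussianReal (μ := 0) (v := 1 / 2)) a
      rw [mgf] at h
      simp only [id] at h
      rw [h]
      congr 1
      push_cast
      ring
    rw [mgf, stdComplexNormal, integral_map hmeas.aemeasurable (hcont t).aestronglyMeasurable,
      hsplit, integral_prod_mul (fun x : ℝ => Real.exp (t * c.re * x))
        (fun y : ℝ => Real.exp (-(t * c.im) * y)), hg, hg, ← Real.exp_add]
    refine Real.exp_le_exp.2 (le_of_eq ?_)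
    push_cast
    rw [Complex.sq_norm, Complex.normSq_apply]
    ring

section Tail

variable {Ω : Type*} [MeasurableSpace Ω] {P : Measure Ω}

lemma measureReal_re_sum_ge_le {ι : Type*} [Fintype ι] {g : ι → Ω → ℂ}
    (hg : ∀ i, HasLaw (g i) stdComplexNormal P) (hind : iIndepFun g P) (c : ι → ℂ) {t : ℝ}
    (ht : 0 ≤ t) :
    P.real {ω | t ≤ (∑ i, c i * g i ω).re} ≤ Real.exp (-t ^ 2 / ∑ i, ‖c i‖ ^ 2) := by
  have h1 : iIndepFun (fun i ω => (c i * g i ω).re) P :=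
    hind.comp (fun i z => (c i * z).re) fun i => by fun_prop
  have h2 : ∀ i, HasSubgaussianMGF (fun ω => (c i * g i ω).re) (‖c i‖₊ ^ 2 / 2) P := fun i =>
    HasSubgaussianMGF.of_map (X := fun z : ℂ => (c i * z).re) (hg i).aemeasurable
      (by rw [(hg i).map_eq]; exact hasSubgaussianMGF_stdComplexNormal (c i))
  have h3 := HasSubgaussianMGF.measure_sum_ge_le_of_iIndepFun h1 (s := Finset.univ)
    (fun i _ => h2 i) ht
  simp only [Complex.re_sum]
  refine h3.trans (le_of_eq ?_)
  congr 2
  push_cast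
  rw [← Finset.sum_div]
  ring

lemma norm_lt_of_re_lt {z : ℂ} {t : ℝ} (h1 : z.re < t) (h2 : (-1 * z).re < t)
    (h3 : (Complex.I * z).re < t) (h4 : (-Complex.I * z).re < t) : ‖z‖ ≤ 2 * t := by
  simp at h1 h2 h3 h4
  refine (Complex.norm_le_abs_re_add_abs_im z).trans ?_
  have h5 : |z.re| ≤ t := abs_le.2 ⟨by linarith, h1.le⟩
  have h6 : |z.im| ≤ t := abs_le.2 ⟨by linarith, h4.le⟩
  linarith

/-- The four units whose real functionals control the modulus of a complex number. -/
noncomputable def quarterTurn : Fin 4 → ℂ := ![1, -1, Complex.I, -Complex.I]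

lemma norm_quarterTurn (j : Fin 4) : ‖quarterTurn j‖ = 1 := by
  fin_cases j <;> simp [quarterTurn]

variable {d m : ℕ} {g : (Fin d → ℤ) → Ω → ℂ} {σ : (Fin d → ℤ) → ℝ}

/-- The union bound over the Fourier nodes and the four directions. -/
lemma measureReal_exists_fourierCoeff_ge_le
    (hg : ∀ x ∈ cube d (2 * m), HasLaw (g x) stdComplexNormal P)
    (hind : iIndepFun (fun x : cube d (2 * m) => g x) P) {t : ℝ} (ht : 0 ≤ t) :
    P.real {ω | ∃ k ∈ cube d (2 * m), ∃ j : Fin 4,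
        t ≤ (quarterTurn j * fourierCoeff m (fun x => (σ x : ℂ) * g x ω) k).re}
      ≤ 4 * cubeSize d (2 * m) * Real.exp (-t ^ 2 / lpNormOn 2 (cube d (2 * m)) σ ^ 2) := by
  have h1 : ∀ (k : Fin d → ℤ) (j : Fin 4),
      P.real {ω | t ≤ (quarterTurn j * fourierCoeff m (fun x => (σ x : ℂ) * g x ω) k).re}
        ≤ Real.exp (-t ^ 2 / lpNormOn 2 (cube d (2 * m)) σ ^ 2) := fun k j => by
    have h2 := measureReal_re_sum_ge_le (fun x : cube d (2 * m) => hg x.1 x.2) hind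
      (fun x => quarterTurn j * (σ x.1 * expo (-fourierNode m k) x.1)) ht
    have h3 : ∑ x : cube d (2 * m), ‖quarterTurn j * (σ x.1 * expo (-fourierNode m k) x.1)‖ ^ 2
        = lpNormOn 2 (cube d (2 * m)) σ ^ 2 := by
      rw [lpNormOn_two_sq, ← Finset.sum_coe_sort (cube d (2 * m)) fun x => ‖σ x‖ ^ 2]
      refine Finset.sum_congr rfl fun x _ => ?_
      rw [norm_mul, norm_mul, norm_quarterTurn, norm_expo, one_mul, mul_one, Complex.norm_real]
    rw [h3] at h2
    refine le_trans (le_of_eq ?_) h2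
    congr 1
    ext ω
    simp only [Set.mem_ofPred_eq, fourierCoeff, Finset.mul_sum]
    rw [← Finset.sum_coe_sort (cube d (2 * m)) fun x =>
      quarterTurn j * ((σ x : ℂ) * g x ω * expo (-fourierNode m k) x)]
    refine iff_of_eq ?_
    congr 2
    exact Finset.sum_congr rfl fun x _ => by ring
  have h2 : {ω | ∃ k ∈ cube d (2 * m), ∃ j : Fin 4,
      t ≤ (quarterTurn j * fourierCoeff m (fun x => (σ x : ℂ) * g x ω) k).re}
      = ⋃ i ∈ cube d (2 * m) ×ˢ (Finset.univ : Finset (Fin 4)),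
        {ω | t ≤ (quarterTurn i.2 * fourierCoeff m (fun x => (σ x : ℂ) * g x ω) i.1).re} := by
    ext ω
    simp [Prod.exists]
  rw [h2]
  refine (measureReal_biUnion_finset_le _ _).trans ?_
  refine (Finset.sum_le_card_nsmul _ _ _ fun i _ => h1 i.1 i.2).trans (le_of_eq ?_)
  rw [nsmul_eq_mul, Finset.card_product, Finset.card_univ, Fintype.card_fin, Nat.cast_mul,
    card_cube_eq]
  push_cast
  ring

/-- The number of events in the union bound; the exponent is not optimized. -/
lemma four_mul_cubeSize_mul_le (hd : 1 ≤ d) (hm : 2 ≤ m) :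
    4 * cubeSize d (2 * m) ≤ (m : ℝ) ^ (6 * d) := by
  have hm0 : (2 : ℝ) ≤ m := by exact_mod_cast hm
  have h5 : (20 : ℝ) ≤ (m : ℝ) ^ 5 :=
    le_trans (by norm_num) (pow_le_pow_left₀ (by norm_num) hm0 5)
  have h6 : 4 * (2 * ((2 * m : ℕ) : ℝ) + 1) ≤ (m : ℝ) ^ 6 := by
    push_cast
    calc 4 * (2 * (2 * (m : ℝ)) + 1) ≤ 20 * m := by linarith
      _ ≤ (m : ℝ) ^ 5 * m := by gcongr
      _ = (m : ℝ) ^ 6 := by ring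
  calc 4 * cubeSize d (2 * m) ≤ 4 ^ d * (2 * ((2 * m : ℕ) : ℝ) + 1) ^ d := by
        rw [cubeSize]
        gcongr
        exact le_self_pow₀ (by norm_num) (by omega)
    _ = (4 * (2 * ((2 * m : ℕ) : ℝ) + 1)) ^ d := (mul_pow _ _ _).symm
    _ ≤ ((m : ℝ) ^ 6) ^ d := by gcongr
    _ = (m : ℝ) ^ (6 * d) := by rw [pow_mul]

variable [IsProbabilityMeasure P]

/-- The Hankel matrix of independent Gaussian noise has norm of order `‖σ‖₂ √(log m)`, outside an
event of probability `m^{-d}`. -/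
theorem exists_event_norm_hankel_le (hd : 1 ≤ d) (hm : 2 ≤ m)
    (hg : ∀ x ∈ cube d (2 * m), HasLaw (g x) stdComplexNormal P)
    (hind : iIndepFun (fun x : cube d (2 * m) => g x) P) :
    ∃ E : Set Ω, MeasurableSet E ∧ 1 - ((m : ℝ) ^ d)⁻¹ ≤ P.real E ∧ ∀ ω ∈ E, ∀ v,
      ‖hankel m (fun x => (σ x : ℂ) * g x ω) v‖
        ≤ 2 * √(7 * d) * (lpNormOn 2 (cube d (2 * m)) σ * √(Real.log m)) * ‖v‖ := by
  have hm0 : (2 : ℝ) ≤ m := by exact_mod_cast hm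
  have hlog : 0 < Real.log m := Real.log_pos (by linarith)
  set s := lpNormOn 2 (cube d (2 * m)) σ with hs
  have hs0 : 0 ≤ s := lpNormOn_nonneg (by norm_num) _ _
  rcases hs0.eq_or_lt with hs1 | hs1
  · -- the noise vanishes on the sampling set
    refine ⟨Set.univ, MeasurableSet.univ, by simp, fun ω _ => ?_⟩
    have hσ : ∀ x ∈ cube d (2 * m), σ x = 0 := fun x hx => by
      have h1 := lpNormOn_two_sq (cube d (2 * m)) σ
      rw [← hs, ← hs1, zero_pow two_ne_zero] at h1
      have h2 := (Finset.sum_eq_zero_iff_of_nonneg fun x _ => by positivity).1 h1.symm x hx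
      simpa using h2
    refine norm_hankel_le_of_fourierCoeff_le (by positivity) fun k _ => ?_
    rw [fourierCoeff, Finset.sum_eq_zero fun x hx => by rw [hσ x hx]; simp, norm_zero]
    positivity
  -- the tail at `t` is `m ^ (-7 d)`, and there are at most `m ^ (6 d)` events
  set t := √(7 * d) * (s * √(Real.log m)) with ht
  have ht0 : 0 ≤ t := by positivity
  set B := {ω | ∃ k ∈ cube d (2 * m), ∃ j : Fin 4,
        t ≤ (quarterTurn j * fourierCoeff m (fun x => (σ x : ℂ) * g x ω) k).re} with hB
  have hPB : P.real B ≤ ((m : ℝ) ^ d)⁻¹ := by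
    refine (measureReal_exists_fourierCoeff_ge_le hg hind ht0).trans ?_
    have h1 : -t ^ 2 / s ^ 2 = -(Real.log m * ((7 * d : ℕ) : ℝ)) := by
      rw [ht, mul_pow, mul_pow, Real.sq_sqrt (by positivity), Real.sq_sqrt hlog.le]
      push_cast
      field_simp
    rw [← hs, h1, Real.exp_neg, ← Real.rpow_def_of_pos (by linarith), Real.rpow_natCast]
    refine (mul_le_mul_of_nonneg_right (four_mul_cubeSize_mul_le hd hm) (by positivity)).trans
      (le_of_eq ?_)
    rw [show 7 * d = 6 * d + d by ring, pow_add]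
    field_simp
  -- the noise is only almost everywhere measurable, so `B` is replaced by a measurable hull
  refine ⟨(toMeasurable P B)ᶜ, (measurableSet_toMeasurable P B).compl, ?_, fun ω hω => ?_⟩
  · rw [probReal_compl_eq_one_sub (measurableSet_toMeasurable P B), measureReal_def,
      measure_toMeasurable, ← measureReal_def]
    linarith
  · have h1 : ω ∉ B := fun h => hω (subset_toMeasurable P B h)
    have h2 : ∀ k ∈ cube d (2 * m), ∀ j : Fin 4,
        (quarterTurn j * fourierCoeff m (fun x => (σ x : ℂ) * g x ω) k).re < t := by
      intro k hk j
      by_contra! h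
      exact h1 ⟨k, hk, j, h⟩
    rw [mul_assoc 2]
    refine norm_hankel_le_of_fourierCoeff_le (by positivity) fun k hk => ?_
    refine norm_lt_of_re_lt ?_ (h2 k hk 1) (h2 k hk 2) (h2 k hk 3)
    have h3 := h2 k hk 0
    rwa [show quarterTurn 0 = 1 from rfl, one_mul] at h3

end Tail

/-! ### Recovery -/

lemma pow_le_of_log_le {x : ℝ} (hx : 0 < x) {n : ℕ} (hn : 16 * Real.log x⁻¹ ≤ n) :
    (15 / 16 : ℝ) ^ n ≤ x := by
  -- `16` iterations gain a factor `e`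
  have h1 : (15 / 16 : ℝ) ≤ Real.exp (-(1 / 16)) := by
    have := Real.add_one_le_exp (-(1 / 16 : ℝ))
    linarith
  calc (15 / 16 : ℝ) ^ n ≤ Real.exp (-(1 / 16)) ^ n := by gcongr
    _ = Real.exp (-(n / 16)) := by rw [← Real.exp_nat_mul]; congr 1; ring
    _ ≤ Real.exp (Real.log x) := by
        rw [Real.log_inv] at hn
        exact Real.exp_le_exp.2 (by linarith)
    _ = x := Real.exp_log hx

lemma Recovers.mono {d s : ℕ} {θ : Fin s → Freq d} {q : Freq d → ℝ} {G : Finset (Freq d)}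
    {α r h : ℝ} {n : ℕ} {ε ε' : ℝ} (H : Recovers θ q G α r h n ε) (hε : ε ≤ ε') :
    Recovers θ q G α r h n ε' :=
  ⟨H.1, fun out hout => by
    obtain ⟨π, hπ⟩ := H.2 out hout
    exact ⟨π, fun l => (hπ l).trans hε⟩⟩

/-- The common part of both noise models: if the Hankel matrix of the noise has norm at most
`K x (2m+1)^d`, then Gradient-MUSIC recovers the frequencies up to a multiple of `x / m` once the
number of iterations exceeds `16 log (1/x)`. -/
theorem recovers_of_norm_hankel_le {d m s : ℕ} (hd : 1 ≤ d) (hm : 1 ≤ m) (hs : 1 ≤ s)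
    {θ : Fin s → Freq d} {a : Fin s → ℂ} (ha : ∀ l, 1 ≤ ‖a l‖) (hθ : WellSeparated m θ)
    (hφ : NearlyOrthonormal (1 / 4) fun l => steering m (θ l))
    (hφ' : NearlyOrthonormal (1 / 4) fun l => steering m (-θ l)) {β : ℝ} (hβ : 8 ≤ β)
    (hsep : ∀ j k, j ≠ k → β / m ≤ torusDist (θ j) (θ k)) {G : Finset (Freq d)}
    (hG : G.Nonempty) (hmesh : mesh G ≤ 1 / (250000 * d) / m) {r α h : ℝ} (hr : 2 * mesh G ≤ r)
    (hr' : r ≤ 1 / m) (hα : 1 / 800 ≤ α) (hα' : α ≤ 1 / 400)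
    (hh1 : 3 / (32 * Real.pi ^ 2) / (m : ℝ) ^ 2 ≤ h)
    (hh2 : h ≤ 3 / (16 * Real.pi ^ 2) / (m : ℝ) ^ 2) {η : (Fin d → ℤ) → ℂ} {K x : ℝ}
    (hK : 0 ≤ K) (hx : 0 ≤ x) (hKx : K * x ≤ 1 / 12000)
    (hη : ∀ v, ‖hankel m η v‖ ≤ K * x * cubeSize d m * ‖v‖) :
    LeadingSpaceWellDefined (hankel m (signal θ a + η)) s ∧
      ∀ n : ℕ, 0 < x → 16 * Real.log x⁻¹ ≤ n →
        Recovers θ (estimatedMusic m s (signal θ a + η)) G α r h n ((1 + 24 * K) * x / m) := by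
  obtain ⟨h1, h2⟩ := leadingSpace_of_noise hs hφ hφ' ha (mul_nonneg hK hx) hKx hη
  refine ⟨h1, fun n hx0 hn => ?_⟩
  refine (recovers_of_projectionsClose hd hm hθ hβ hsep (by positivity) (by linarith) h2 hG hmesh
    hr hr' hα hα' hh1 hh2 n).mono ?_
  have h3 := pow_le_of_log_le hx0 hn
  gcongr
  linarith

end GradientMusic

theorem theorem4p1 :
    ∃ h₁ h₂ c N : ℝ, 0 < h₁ ∧ h₁ < h₂ ∧ 0 < c ∧ 0 < N ∧
    ∀ d : ℕ, 2 ≤ d →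
    ∃ β κ ρ α₁ α₂ c' C : ℝ,
      0 < β ∧ 0 < κ ∧ 2 * κ ≤ ρ ∧ 0 < α₁ ∧ α₁ < α₂ ∧ 0 < c' ∧ 0 < C ∧
    ∀ m s : ℕ, 1 ≤ m → 1 ≤ s →
    ∀ (θ : Fin s → GradientMusic.Freq d) (a : Fin s → ℂ),
      IsLeast (Set.range fun l => ‖a l‖) 1 →
      (∀ j k, j ≠ k → β / m ≤ GradientMusic.torusDist (θ j) (θ k)) →
    ∀ (G : Finset (GradientMusic.Freq d)) (r α h : ℝ),
      G.Nonempty → GradientMusic.mesh G ≤ κ / m →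
      2 * GradientMusic.mesh G ≤ r → r ≤ ρ / m →
      α₁ ≤ α → α ≤ α₂ →
      h₁ / (m : ℝ) ^ 2 ≤ h → h ≤ h₂ / (m : ℝ) ^ 2 →
    -- adversarial noise
    (∀ (p : ℝ≥0∞) (η : (Fin d → ℤ) → ℂ), 1 ≤ p →
      GradientMusic.lpNormOn p (GradientMusic.cube d (2 * m)) η
        ≤ c * (m : ℝ) ^ ((d : ℝ) * p⁻¹.toReal) / ‖a‖ →
      GradientMusic.LeadingSpaceWellDefined
        (GradientMusic.hankel m (GradientMusic.signal θ a + η)) s ∧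
      ∀ n : ℕ, 0 < GradientMusic.lpNormOn p (GradientMusic.cube d (2 * m)) η →
        N * Real.log ((m : ℝ) ^ ((d : ℝ) * p⁻¹.toReal)
            / GradientMusic.lpNormOn p (GradientMusic.cube d (2 * m)) η) ≤ n →
        GradientMusic.Recovers θ
          (GradientMusic.estimatedMusic m s (GradientMusic.signal θ a + η)) G α r h n
          (C * GradientMusic.lpNormOn p (GradientMusic.cube d (2 * m)) η
            / (m : ℝ) ^ (1 + (d : ℝ) * p⁻¹.toReal))) ∧
    -- independent nonstationary Gaussian noise
    (∀ (Ω : Type*) [MeasurableSpace Ω] (P : Measure Ω) [IsProbabilityMeasure P]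
      (g : (Fin d → ℤ) → Ω → ℂ) (σ : (Fin d → ℤ) → ℝ),
      (∀ x ∈ GradientMusic.cube d (2 * m), HasLaw (g x) GradientMusic.stdComplexNormal P) →
      iIndepFun (fun x : GradientMusic.cube d (2 * m) => g x) P →
      (∀ x, 0 ≤ σ x) →
      GradientMusic.lpNormOn 2 (GradientMusic.cube d (2 * m)) σ * √(Real.log m)
        ≤ c' * (m : ℝ) ^ d / ‖a‖ →
      ∃ E : Set Ω, MeasurableSet E ∧ 1 - ((m : ℝ) ^ d)⁻¹ ≤ P.real E ∧
        ∀ ω ∈ E,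
          GradientMusic.LeadingSpaceWellDefined
            (GradientMusic.hankel m (GradientMusic.signal θ a + fun x => (σ x : ℂ) * g x ω)) s ∧
          ∀ n : ℕ, 0 < GradientMusic.lpNormOn 2 (GradientMusic.cube d (2 * m)) σ →
            N * Real.log ((m : ℝ) ^ d
                / (GradientMusic.lpNormOn 2 (GradientMusic.cube d (2 * m)) σ * √(Real.log m))) ≤ n →
            GradientMusic.Recovers θ
              (GradientMusic.estimatedMusic m s
                (GradientMusic.signal θ a + fun x => (σ x : ℂ) * g x ω)) G α r h n
              (C * (GradientMusic.lpNormOn 2 (GradientMusic.cube d (2 * m)) σ * √(Real.log m))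
                / (m : ℝ) ^ (d + 1))) := by
  have hπ : (0 : ℝ) < Real.pi ^ 2 := by positivity
  refine ⟨3 / (32 * Real.pi ^ 2), 3 / (16 * Real.pi ^ 2), 1 / 12000, 16, by positivity, ?_,
    by norm_num, by norm_num, fun d hd => ?_⟩
  · rw [div_lt_div_iff₀ (by positivity) (by positivity)]
    nlinarith
  have hd1 : 1 ≤ d := by omega
  have hd0 : (1 : ℝ) ≤ d := by exact_mod_cast hd1
  obtain ⟨β, hβ, hgeom⟩ := GradientMusic.exists_separation hd1
  set K : ℝ := 2 * √(7 * d) with hK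
  have hK1 : 1 ≤ K := by
    have : (1 : ℝ) ≤ √(7 * d) := Real.one_le_sqrt.2 (by linarith)
    linarith
  have hK0 : 0 < K := by linarith
  refine ⟨β, 1 / (250000 * d), 1, 1 / 800, 1 / 400, 1 / (12000 * K), 1 + 24 * K, by linarith,
    by positivity, ?_, by norm_num, by norm_num, by positivity, by positivity, ?_⟩
  · rw [mul_one_div, div_le_one (by positivity)]
    linarith
  intro m s hm hs θ a ha hsep G r α h hG hmesh hr hr' hα hα' hh1 hh2
  have hm0 : (0 : ℝ) < m := by exact_mod_cast hm
  have ha1 : ∀ l, 1 ≤ ‖a l‖ := fun l => ha.2 ⟨l, rfl⟩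
  have hanorm : 1 ≤ ‖a‖ := (ha1 ⟨0, hs⟩).trans (norm_le_pi_norm a _)
  obtain ⟨hθ, hφ, hφ'⟩ := hgeom hm hs θ hsep
  refine ⟨fun p η hp hη => ?_, fun Ω _ P _ g σ hg hind _ hσ => ?_⟩
  · set e := GradientMusic.lpNormOn p (GradientMusic.cube d (2 * m)) η with he
    set M := (m : ℝ) ^ ((d : ℝ) * p⁻¹.toReal) with hM
    have hM0 : 0 < M := by positivity
    have he0 : 0 ≤ e := GradientMusic.lpNormOn_nonneg hp _ _
    have hx : 1 * (e / M) ≤ 1 / 12000 := by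
      rw [one_mul, div_le_iff₀ hM0]
      exact hη.trans (div_le_self (by positivity) hanorm)
    obtain ⟨h1, h2⟩ := GradientMusic.recovers_of_norm_hankel_le hd1 hm hs ha1 hθ hφ hφ' hβ hsep hG
      hmesh hr hr' hα hα' hh1 hh2 zero_le_one (by positivity) hx fun v => by
        rw [one_mul]; exact GradientMusic.norm_hankel_le_lpNormOn hm hp η v
    refine ⟨h1, fun n hpos hn => (h2 n (by positivity) (by rwa [inv_div])).mono ?_⟩
    rw [Real.rpow_add hm0, Real.rpow_one, mul_div_assoc', div_div, mul_comm M]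
    gcongr
  · rcases hm.eq_or_lt with rfl | hm2
    -- for `m = 1` the required probability is `0`
    · exact ⟨∅, MeasurableSet.empty, by simp, fun ω hω => hω.elim⟩
    obtain ⟨E, hE, hPE, hnorm⟩ := GradientMusic.exists_event_norm_hankel_le (σ := σ) hd1 hm2 hg hind
    refine ⟨E, hE, hPE, fun ω hω => ?_⟩
    have hlog : 0 < Real.log m := Real.log_pos (by exact_mod_cast hm2)
    have hs0 : 0 ≤ GradientMusic.lpNormOn 2 (GradientMusic.cube d (2 * m)) σ :=
      GradientMusic.lpNormOn_nonneg (by norm_num) _ _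
    set e := GradientMusic.lpNormOn 2 (GradientMusic.cube d (2 * m)) σ * √(Real.log m) with he
    have he0 : 0 ≤ e := by positivity
    have hx : K * (e / (m : ℝ) ^ d) ≤ 1 / 12000 := by
      have h1 : e ≤ 1 / (12000 * K) * (m : ℝ) ^ d := hσ.trans (div_le_self (by positivity) hanorm)
      rw [mul_div_assoc', div_le_iff₀ (by positivity)]
      calc K * e ≤ K * (1 / (12000 * K) * (m : ℝ) ^ d) := by gcongr
        _ = 1 / 12000 * (m : ℝ) ^ d := by field_simp
    obtain ⟨h1, h2⟩ := GradientMusic.recovers_of_norm_hankel_le hd1 hm hs ha1 hθ hφ hφ' hβ hsep hG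
      hmesh hr hr' hα hα' hh1 hh2 hK0.le (by positivity) hx fun v => by
        refine (hnorm ω hω v).trans ?_
        rw [← hK, mul_div_assoc']
        have h3 := GradientMusic.pow_le_cubeSize d m
        refine mul_le_mul_of_nonneg_right ?_ (norm_nonneg v)
        rw [div_mul_eq_mul_div, le_div_iff₀ (by positivity)]
        gcongr
    refine ⟨h1, fun n hpos hn => (h2 n (by positivity) (by rwa [inv_div])).mono (le_of_eq ?_)⟩
    rw [mul_div_assoc', div_div, pow_succ]
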